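/- **Theorem.** Let $n:\mathbb N\to\mathbb N$ satisfy $n(\lambda)=\omega(\log\lambda)$. There is no quantum fully black-box reduction $(C,S)$ from QCCC key agreements (quantum computation, classical communication) to $(\lambda,n)$-pseudorandom state generators (PRSGs) in which $C$ makes only classical queries to the PRSG. This holds even if the local computation of $C$ and $S$ is unbounded and non-uniform and only their queries are restricted to be polynomial. Here the terms have the following meaning. * *Generators.* An implementation $I$ of a $(\lambda,n)$-PRSG assigns to each $\lambda$ and each key $k\in\{0,1\}^\lambda$ a pure $n(\lambda)$-qubit state $|I_k\rangle$; it need not be efficient. An algorithm $D$ that receives $t(\lambda)$ copies of an $n(\lambda)$-qubit state, $t$ being polynomially bounded, *breaks* $I$ if $$\Bigl|\Pr_{k\leftarrow\{0,1\}^\lambda}\bigl[D(|I_k\rangle^{\otimes t(\lambda)})=1\bigr]-\Pr_{|\varphi\rangle\leftarrow\mathcal H_{n(\lambda)}}\bigl[D(|\varphi\rangle^{\otimes t(\lambda)})=1\bigr]\Bigr|$$ is not negligible in $\lambda$, where $\mathcal H_m$ is the Haar distribution on $m$-qubit pure states. * *Construction.* $C$ is a pair of parties $(A,B)$. For each security parameter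 $\lambda$ they start in a product state and run a protocol of polynomially many rounds in which they apply local quantum operations, exchange classical messages $\tau$ (the transcript) and make polynomially many classical queries to $I$: a party that asks a classical key $k$, of polynomial length, receives a copy of $|I_k\rangle$. At the end they output bits $k_A$ and $k_B$. The protocol obtained with generator $I$ is denoted $C^I$. It is a *key agreement* if $\Pr[k_A=k_B]\ge 1-\varepsilon(\lambda)$ for all $\lambda$, for some negligible $\varepsilon$. * *Eavesdroppers.* An eavesdropper $E$ is an arbitrary (unbounded) quantum algorithm, given by a family of unitaries indexed by $\lambda$, that takes the transcript $\tau$ and outputs a bit $k_E$. It *breaks* $C^I$ if there is no negligible $\delta$ with $\Pr[k_E=k_B]\le\frac12+\delta(\lambda)$ for all $\lambda$. * *Security reduction.* $S$ is a quantum oracle algorithm that receives polynomially many copies of a state and makes polynomially many quantum queries to $I$, through the isometries $|k\rangle\mapsto|k\rangle|I_k\rangle$ on keys of polynomial length, and to the unitaries of $E$ and their inverses, on polynomially bounded security parameters. * *Reduction.* $(C,S)$ is a quantum fully black-box reduction if, for every implementation $I$, $C^I$ is a key agreement, and, for every implementation $I$ and every eavesdropper $E$, if $E$ breaks $C^I$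 then $S^{E,I}$ breaks $I$. -/

import Mathlib

open Matrix MeasureTheory Filter
open scoped Kronecker

noncomputable section

namespace QCCC

/-! ### Asymptotics -/

/-- Negligible functions of the security parameter: `f` is eventually smaller than every inverse
polynomial. -/
def Negligible (f : ℕ → ℝ) : Prop :=
  Asymptotics.SuperpolynomialDecay atTop (fun l : ℕ => (l : ℝ)) f

/-- `f` is bounded by a polynomial in the security parameter. -/
def PolyBounded (f : ℕ → ℕ) : Prop :=
  ∃ p : Polynomial ℕ, ∀ l, f l ≤ p.eval l

/-- `n l = ω(log l)`. -/
def SuperLog (n : ℕ → ℕ) : Prop :=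
  (fun l : ℕ => Real.log (l : ℝ)) =o[atTop] (fun l : ℕ => (n l : ℝ))

/-! ### Finite-dimensional quantum operations -/

abbrev BitString (m : ℕ) : Type := Fin m → Bool

/-- Pure states of `m` qubits: unit vectors of `(ℂ²)^{⊗ m}`, in the computational basis. -/
abbrev PureState (m : ℕ) : Type :=
  Metric.sphere (0 : EuclideanSpace ℂ (BitString m)) 1

/-- The Haar distribution on `m`-qubit pure states: the normalized (unitarily invariant) surface
measure of the unit sphere. -/
def haarState (m : ℕ) : Measure (PureState m) :=
  ((volume : Measure (EuclideanSpace ℂ (BitString m))).toSphere Set.univ)⁻¹ •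
    (volume : Measure (EuclideanSpace ℂ (BitString m))).toSphere

/-- A quantum instrument with classical outcomes in `Ω`, from the quantum system with basis `X` to
the one with basis `Y`, in Kraus form.  On outcome `o` the (subnormalized) post-measurement state
of `ρ` is `∑ i, K o i * ρ * (K o i)ᴴ`; the sum over all outcomes is trace preserving. -/
structure Instrument (Ω X Y : Type) [Fintype Ω] [Fintype X] [DecidableEq X] [Fintype Y] where
  size : ℕ
  K : Ω → Fin size → Matrix Y X ℂ
  complete : ∑ o, ∑ i, (K o i)ᴴ * K o i = 1

/-- Subnormalized state after observing outcome `o`. -/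
def Instrument.apply {Ω X Y : Type} [Fintype Ω] [Fintype X] [DecidableEq X] [Fintype Y]
    (E : Instrument Ω X Y) (o : Ω) (ρ : Matrix X X ℂ) : Matrix Y Y ℂ :=
  ∑ i, E.K o i * ρ * (E.K o i)ᴴ

/-- The density matrix `|v⟩⟨v|`. -/
def ketbra {X : Type} (v : X → ℂ) : Matrix X X ℂ := vecMulVec v (star v)

/-! ### Pseudorandom state generators as oracles -/

/-- The (not necessarily efficient) implementations of a state generator with `l`-bit keys and
`n l`-qubit outputs: on key `k` of length `l` the generator outputs a pure `n l`-qubit state. -/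
abbrev Generator (n : ℕ → ℕ) : Type := ∀ l : ℕ, BitString l → PureState (n l)

/-- Keys of length at most `L`. -/
abbrev Key (L : ℕ) : Type := Σ i : Fin (L + 1), BitString i

instance (L : ℕ) : DecidableEq (Key L) := instDecidableEqSigma

/-- Basis of the register that holds a key together with the generator's answer to it. -/
abbrev Answer (n : ℕ → ℕ) (L : ℕ) : Type := Σ x : Key L, BitString (n x.1)

instance (n : ℕ → ℕ) (L : ℕ) : DecidableEq (Answer n L) := instDecidableEqSigma

/-- A quantum query to the generator `I`: the isometry `|k⟩ ↦ |k⟩ |I k⟩`. -/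
def genIsometry {n : ℕ → ℕ} (I : Generator n) (L : ℕ) : Matrix (Answer n L) (Key L) ℂ :=
  fun s x => if s.1 = x then (I s.1.1 s.1.2 : EuclideanSpace ℂ (BitString (n s.1.1))) s.2 else 0

/-- The answer to a classical query `x`, handed to a party with memory basis `X`: the isometry
`|a⟩ ↦ |a⟩ |x⟩ |I x⟩`. -/
def answerIsometry {n : ℕ → ℕ} (I : Generator n) (L : ℕ) (X : Type) [DecidableEq X] (x : Key L) :
    Matrix (X × Answer n L) X ℂ :=
  fun s a => if s.1 = a then genIsometry I L s.2 x else 0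

/-! ### Two-party protocols with classical communication and classical queries -/

/-- One party of a protocol with `r` rounds, message alphabet `M`, and oracle access to a generator
on keys of length at most `L`.  In each round, depending on the messages `h` exchanged in the
previous rounds (both parties' messages), the party
measures its memory to obtain a classical key, receives the state that the generator outputs on this
key, and then measures to obtain its (classical) message of this round.  After the last
round it measures to obtain its output bit.  Messages and queries may be dummies, so that
protocols with alternating messages, or with several queries between messages, are covered. -/
structure Party (n : ℕ → ℕ) (L : ℕ) (M : Type) [Fintype M] (r : ℕ) where
  dim : ℕ
  start : Fin dim
  query : ∀ j : ℕ, (Fin j → M × M) → Instrument (Key L) (Fin dim) (Fin dim)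
  send : ∀ j : ℕ, (Fin j → M × M) → Instrument M (Fin dim × Answer n L) (Fin dim)
  out : (Fin r → M × M) → Instrument Bool (Fin dim) Unit

/-- Kraus operators of one round of a party, on the events that it asks the key `x` and sends the
message `m`. -/
def Party.roundKraus {n : ℕ → ℕ} {L : ℕ} {M : Type} [Fintype M] {r : ℕ} (P : Party n L M r)
    (I : Generator n) {j : ℕ} (h : Fin j → M × M) (m : M) (x : Key L)
    (a : Fin (P.query j h).size) (b : Fin (P.send j h).size) :
    Matrix (Fin P.dim) (Fin P.dim) ℂ :=
  (P.send j h).K m b * answerIsometry I L (Fin P.dim) x * (P.query j h).K x a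

/-- The subnormalized joint state of the two parties after `j` rounds with transcript `h`; its trace
is the probability of this transcript.  The parties start in a product state, and in
each round both act locally on their own memory. -/
def jointState {n : ℕ → ℕ} {L : ℕ} {M : Type} [Fintype M] {r : ℕ} (A B : Party n L M r)
    (I : Generator n) : ∀ j : ℕ, (Fin j → M × M) →
      Matrix (Fin A.dim × Fin B.dim) (Fin A.dim × Fin B.dim) ℂ
  | 0, _ => ketbra (Pi.single (A.start, B.start) 1)
  | j + 1, h =>
    ∑ x, ∑ a, ∑ b, ∑ x', ∑ a', ∑ b',
      (A.roundKraus I (Fin.init h) (h (Fin.last j)).1 x a b ⊗ₖ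
        B.roundKraus I (Fin.init h) (h (Fin.last j)).2 x' a' b') *
      jointState A B I j (Fin.init h) *
      (A.roundKraus I (Fin.init h) (h (Fin.last j)).1 x a b ⊗ₖ
        B.roundKraus I (Fin.init h) (h (Fin.last j)).2 x' a' b')ᴴ

/-- The probability that the execution yields transcript `τ` and output bits `kA`, `kB`. -/
def outcomeProb {n : ℕ → ℕ} {L : ℕ} {M : Type} [Fintype M] {r : ℕ} (A B : Party n L M r)
    (I : Generator n) (τ : Fin r → M × M) (kA kB : Bool) : ℝ :=
  (trace (∑ a, ∑ b,
    ((A.out τ).K kA a ⊗ₖ (B.out τ).K kB b) * jointState A B I r τ *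
      ((A.out τ).K kA a ⊗ₖ (B.out τ).K kB b)ᴴ)).re

/-- An oracle construction of a (bit) key agreement with classical communication from a generator,
with classical queries only: for each security parameter `l`, two parties that exchange, in each of
`rounds l` rounds, messages from an alphabet of size `alphabet l`. -/
structure Construction (n : ℕ → ℕ) where
  rounds : ℕ → ℕ
  keyLen : ℕ → ℕ
  alphabet : ℕ → ℕ
  alice : ∀ l, Party n (keyLen l) (Fin (alphabet l)) (rounds l)
  bob : ∀ l, Party n (keyLen l) (Fin (alphabet l)) (rounds l)

namespace Construction

variable {n : ℕ → ℕ}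

/-- Query efficiency: polynomially many rounds, hence queries (one per party and round), on keys of
polynomial length.  Local computation is not restricted. -/
def Efficient (C : Construction n) : Prop := PolyBounded C.rounds ∧ PolyBounded C.keyLen

/-- Transcripts at security parameter `l`. -/
abbrev Transcript (C : Construction n) (l : ℕ) : Type :=
  Fin (C.rounds l) → Fin (C.alphabet l) × Fin (C.alphabet l)

/-- `Pr[k_A = k_B]` in the key agreement built from the generator `I`. -/
def agreeProb (C : Construction n) (I : Generator n) (l : ℕ) : ℝ :=
  ∑ τ : C.Transcript l, ∑ k : Bool, outcomeProb (C.alice l) (C.bob l) I τ k k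

/-- The construction, run with the generator `I`, is a key agreement: negligible completeness
error. -/
def IsComplete (C : Construction n) (I : Generator n) : Prop :=
  ∃ ε : ℕ → ℝ, Negligible ε ∧ ∀ l, 1 - ε l ≤ C.agreeProb I l

/-- Registers of an eavesdropper: transcript, output bit and `w l + 1`-dimensional ancilla. -/
abbrev EveReg (C : Construction n) (w : ℕ → ℕ) (l : ℕ) : Type :=
  C.Transcript l × Bool × Fin (w l + 1)

/-- An eavesdropper: an arbitrary quantum algorithm, that is, a family of unitaries. -/
abbrev Eavesdropper (C : Construction n) (w : ℕ → ℕ) : Type :=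
  ∀ l, Matrix.unitaryGroup (C.EveReg w l) ℂ

/-- The probability that the eavesdropper outputs `k` on transcript `τ`: its unitary is applied to
`|τ⟩|0⟩|0⟩` and the output bit is measured. -/
def eveProb (C : Construction n) {w : ℕ → ℕ} (E : C.Eavesdropper w) (l : ℕ)
    (τ : C.Transcript l) (k : Bool) : ℝ :=
  ∑ σ : C.Transcript l, ∑ c : Fin (w l + 1),
    ‖(E l : Matrix (C.EveReg w l) (C.EveReg w l) ℂ) (σ, k, c) (τ, false, 0)‖ ^ 2

/-- `Pr[k_E = k_B]`. -/
def eveWinProb (C : Construction n) (I : Generator n) {w : ℕ → ℕ} (E : C.Eavesdropper w)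
    (l : ℕ) : ℝ :=
  ∑ τ : C.Transcript l, ∑ kA : Bool, ∑ kB : Bool,
    outcomeProb (C.alice l) (C.bob l) I τ kA kB * C.eveProb E l τ kB

/-- The eavesdropper breaks the key agreement built from `I`: its probability of finding Bob's key
is not bounded by `1/2` plus a negligible function. -/
def IsBrokenBy (C : Construction n) (I : Generator n) {w : ℕ → ℕ} (E : C.Eavesdropper w) : Prop :=
  ¬ ∃ δ : ℕ → ℝ, Negligible δ ∧ ∀ l, C.eveWinProb I E l ≤ 1 / 2 + δ l

end Construction

/-! ### Security reductions -/

/-- Basis of the eavesdropper's registers for all security parameters at most `N`. -/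
abbrev EveRegs {n : ℕ → ℕ} (C : Construction n) (w : ℕ → ℕ) (N : ℕ) : Type :=
  Σ l : Fin (N + 1), C.EveReg w l

instance {n : ℕ → ℕ} (C : Construction n) (w : ℕ → ℕ) (N : ℕ) : DecidableEq (EveRegs C w N) :=
  instDecidableEqSigma

/-- Basis of the query register of the security reduction.  A query goes to the generator (keys of
length at most `L`), to the eavesdropper, or to the inverse of the eavesdropper's unitary (for
security parameters at most `N`), possibly in superposition. -/
abbrev RedQuery {n : ℕ → ℕ} (C : Construction n) (w : ℕ → ℕ) (L N : ℕ) : Type :=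
  Key L ⊕ (EveRegs C w N ⊕ EveRegs C w N)

/-- Basis of the register that holds the answer to such a query. -/
abbrev RedAnswer {n : ℕ → ℕ} (C : Construction n) (w : ℕ → ℕ) (L N : ℕ) : Type :=
  Answer n L ⊕ (EveRegs C w N ⊕ EveRegs C w N)

/-- The joint oracle: generator, eavesdropper and inverse of the eavesdropper. -/
def redOracle {n : ℕ → ℕ} (C : Construction n) {w : ℕ → ℕ} (I : Generator n)
    (E : C.Eavesdropper w) (L N : ℕ) : Matrix (RedAnswer C w L N) (RedQuery C w L N) ℂ :=
  fromBlocks (genIsometry I L) 0 0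
    (fromBlocks
      (blockDiagonal' fun l : Fin (N + 1) => (E l : Matrix (C.EveReg w l) (C.EveReg w l) ℂ)) 0 0
      (blockDiagonal' fun l : Fin (N + 1) => (E l : Matrix (C.EveReg w l) (C.EveReg w l) ℂ)ᴴ))

/-- A distinguisher with quantum oracle access to the generator and to the eavesdropper (whose
ancilla sizes are `w`).  At security parameter `l` it takes `copies l` copies of an `n l`-qubit
state, makes `queries l` oracle queries with arbitrary quantum operations in between, and outputs
a bit. -/
structure Distinguisher {n : ℕ → ℕ} (C : Construction n) (w : ℕ → ℕ) where
  copies : ℕ → ℕ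
  queries : ℕ → ℕ
  keyLen : ℕ → ℕ
  eveLen : ℕ → ℕ
  work : ℕ → ℕ
  prepare : ∀ l, Instrument Unit (Fin (copies l) → BitString (n l))
    (Fin (work l) × RedQuery C w (keyLen l) (eveLen l))
  step : ∀ l : ℕ, ℕ → Instrument Unit
    (Fin (work l) × RedAnswer C w (keyLen l) (eveLen l))
    (Fin (work l) × RedQuery C w (keyLen l) (eveLen l))
  out : ∀ l, Instrument Bool (Fin (work l) × RedQuery C w (keyLen l) (eveLen l)) Unit

namespace Distinguisher

variable {n : ℕ → ℕ} {C : Construction n} {w : ℕ → ℕ}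

/-- Query efficiency: polynomially many copies and queries, the queries being on keys of polynomial
length and on polynomial security parameters.  Local computation is not restricted. -/
def Efficient (S : Distinguisher C w) : Prop :=
  PolyBounded S.copies ∧ PolyBounded S.queries ∧ PolyBounded S.keyLen ∧ PolyBounded S.eveLen

/-- The state after `j` queries, on input `φ^{⊗ copies}`. -/
def state (S : Distinguisher C w) (I : Generator n) (E : C.Eavesdropper w) (l : ℕ)
    (φ : PureState (n l)) : ℕ →
      Matrix (Fin (S.work l) × RedQuery C w (S.keyLen l) (S.eveLen l))
        (Fin (S.work l) × RedQuery C w (S.keyLen l) (S.eveLen l)) ℂ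
  | 0 => (S.prepare l).apply ()
      (ketbra fun y => ∏ i, (φ : EuclideanSpace ℂ (BitString (n l))) (y i))
  | j + 1 => (S.step l j).apply ()
      (((1 : Matrix (Fin (S.work l)) (Fin (S.work l)) ℂ) ⊗ₖ
          redOracle C I E (S.keyLen l) (S.eveLen l)) *
        S.state I E l φ j *
        ((1 : Matrix (Fin (S.work l)) (Fin (S.work l)) ℂ) ⊗ₖ
          redOracle C I E (S.keyLen l) (S.eveLen l))ᴴ)

/-- The probability of output `1` on input `φ^{⊗ copies}`. -/
def acceptProb (S : Distinguisher C w) (I : Generator n) (E : C.Eavesdropper w) (l : ℕ)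
    (φ : PureState (n l)) : ℝ :=
  (trace ((S.out l).apply true (S.state I E l φ (S.queries l)))).re

/-- The advantage in distinguishing copies of the generator's output on a uniform key from
copies of a Haar random state. -/
def advantage (S : Distinguisher C w) (I : Generator n) (E : C.Eavesdropper w) (l : ℕ) : ℝ :=
  |(∑ k : BitString l, S.acceptProb I E l (I l k)) / 2 ^ l -
    ∫ φ, S.acceptProb I E l φ ∂(haarState (n l))|

/-- The distinguisher breaks the pseudorandomness of `I`. -/
def Breaks (S : Distinguisher C w) (I : Generator n) (E : C.Eavesdropper w) : Prop :=
  ¬ Negligible (S.advantage I E)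

end Distinguisher

/-- `(C, S)` is a quantum fully black-box reduction from key agreements with classical communication
to state generators with output length `n`, where `C` makes only classical queries.  The security
reduction has access to the eavesdropper's ancilla, so its format depends on the ancilla sizes `w`. -/
structure IsFullyBlackBoxReduction {n : ℕ → ℕ} (C : Construction n)
    (S : ∀ w : ℕ → ℕ, Distinguisher C w) : Prop where
  efficient_construction : C.Efficient
  efficient_reduction : ∀ w, (S w).Efficient
  correctness : ∀ I : Generator n, C.IsComplete I
  security : ∀ (I : Generator n) (w : ℕ → ℕ) (E : C.Eavesdropper w),
    C.IsBrokenBy I E → (S w).Breaks I E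

end QCCC

end

/-! Take a generator whose outputs are independent Haar random states. One eavesdropper, computed
from the generator, almost surely helps nobody to distinguish it from random, and on average it
predicts Bob's bit unless the parties disagree. A reduction would then force `7/8 ≤ 1/2`.

Breaking the agreement. Given the transcript and the generator, the parties are in a product state
(`jointState_eq_kronecker`), so the probability of an outcome is a product of a weight of Alice and
a weight of Bob. These weights are correlated only through the random generator. Because queries are
classical, each weight is a sum of squared moduli of polynomials that are homogeneous in the state
of every key, of total degree at most the number of rounds `r` (`exists_weight_eq_sum_normSq`).
Bombieri's inequality, transferred from the Fischer norm to the sphere by a Gaussian integral, says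
that squared moduli of homogeneous polynomials are almost nonnegatively correlated in dimension much
larger than `r ^ 2` (`integral_haarState_mul_ge`). Applied key by key, this bounds every outcome
probability below by almost its value in a decoupled execution, where the parties see independent
states for all keys of high dimension (`avgWt_mul_avgWt_le`). The decoupled probabilities sum to
one, so a one-sided termwise bound suffices. In the decoupled execution Bob's likelier bit, given
the transcript and the low-dimensional states, is a function that an eavesdropper can compute, and
guessing it fails only when the parties disagree (`le_lintegral_guess_add_disagree`).

Uselessness for distinguishing. This eavesdropper depends only on states of dimension below `8 * (r
+ 1) ^ 2`. Since `n l` is superlogarithmic, the states for keys of length `l` are eventually too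
large to influence any instance of it that a polynomial-query distinguisher at parameter `l` can
call. Reprogramming a random key of length `l` therefore changes only the generator oracle, and a
hybrid argument shows that this is hardly noticed (`insensitive_accept`). Insensitivity makes the
second moment of the advantage exponentially small up to a polynomial factor
(`integral_tableBias_sq_le`), and summability over `l` gives almost sure negligibility
(`ae_negligible_advantage`). -/

noncomputable section

namespace QCCC

/-! ### Bombieri's inequality for coefficients. -/

section Fischer

open scoped ComplexConjugate

variable {X : Type} [Fintype X]

/-- The factorial `α! = ∏ i, (α i)!` of a multi-index. -/
def multiFactorial (α : X → ℕ) : ℝ := ∏ i, ((α i).factorial : ℝ)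

lemma multiFactorial_pos (α : X → ℕ) : 0 < multiFactorial α :=
  Finset.prod_pos fun i _ => by exact_mod_cast (α i).factorial_pos

/-- Vandermonde's identity, as a sum over the `2 × 2` contingency tables with given margins. -/
lemma sum_contingency_tables {K a b c e : ℕ} (ha : a < K) (hb : b < K) (hc : c < K) :
    (∑ x ∈ Finset.range K, ∑ y ∈ Finset.range K, ∑ u ∈ Finset.range K, ∑ v ∈ Finset.range K,
      if x + y = a ∧ u + v = b ∧ x + u = c ∧ y + v = e then
        ((x.factorial : ℝ) * y.factorial * u.factorial * v.factorial)⁻¹ else 0) =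
    if a + b = c + e then ((a + b).factorial : ℝ) *
      ((a.factorial : ℝ) * b.factorial * c.factorial * e.factorial)⁻¹ else 0 := by
  split_ifs with h
  · have hV := Nat.add_choose_eq a b c
    have h1 : ((a + b).choose c : ℝ) = ((a + b).factorial : ℝ) / (c.factorial * e.factorial) := by
      rw [h, Nat.cast_add_choose]
    have h2 : ((a + b).factorial : ℝ) *
        ((a.factorial : ℝ) * b.factorial * c.factorial * e.factorial)⁻¹ =
        ((a + b).choose c : ℝ) * ((a.factorial : ℝ) * b.factorial)⁻¹ := by
      rw [h1]; simp only [mul_inv, div_eq_mul_inv]; ring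
    rw [h2, hV]
    push_cast
    rw [Finset.sum_mul, Finset.Nat.sum_antidiagonal_eq_sum_range_succ_mk]
    symm
    refine Finset.sum_subset_zero_on_sdiff (Finset.range_subset_range.2 (show c.succ ≤ K by omega))
      (fun x hx => ?_) (fun x hx => ?_)
    · have hcx : c < x := by simp only [Finset.mem_sdiff, Finset.mem_range] at hx; omega
      refine Finset.sum_eq_zero fun y _ => Finset.sum_eq_zero fun u _ =>
        Finset.sum_eq_zero fun v _ => if_neg ?_
      omega
    · have hxc : x ≤ c := by simp only [Finset.mem_range] at hx; omega
      dsimp only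
      -- The entry `x` determines the table: `y = a - x`, `u = c - x`, `v = b - (c - x)`. It exists
      -- exactly when none of these subtractions truncates.
      by_cases hx' : x ≤ a ∧ c - x ≤ b
      · rw [Finset.sum_eq_single_of_mem (a - x) (by simp; omega)
            (fun y _ hy => Finset.sum_eq_zero fun u _ => Finset.sum_eq_zero fun v _ =>
              if_neg (by omega)),
          Finset.sum_eq_single_of_mem (c - x) (by simp; omega)
            (fun u _ hu => Finset.sum_eq_zero fun v _ => if_neg (by omega)),
          Finset.sum_eq_single_of_mem (b - (c - x)) (by simp; omega)
            (fun v _ hv => if_neg (by omega)),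
          if_pos (by omega), Nat.cast_choose ℝ hx'.1, Nat.cast_choose ℝ hx'.2]
        have := fun k : ℕ => (by exact_mod_cast k.factorial_ne_zero : (k.factorial : ℝ) ≠ 0)
        field_simp [this]
      · have h0 : (a.choose x : ℝ) * (b.choose (c - x) : ℝ) = 0 := by
          rw [not_and_or, not_le, not_le] at hx'
          rcases hx' with h' | h' <;> simp [Nat.choose_eq_zero_of_lt h']
        rw [h0, zero_mul]
        symm
        refine Finset.sum_eq_zero fun y _ => Finset.sum_eq_zero fun u _ =>
          Finset.sum_eq_zero fun v _ => if_neg ?_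
        omega
  · refine Finset.sum_eq_zero fun x _ => Finset.sum_eq_zero fun y _ => Finset.sum_eq_zero fun u _ =>
      Finset.sum_eq_zero fun v _ => if_neg ?_
    omega

/-- Multi-indices with entries less than `K`. -/
def multiBox (X : Type) [Fintype X] [DecidableEq X] (K : ℕ) : Finset (X → ℕ) :=
  Fintype.piFinset fun _ => Finset.range K

variable [DecidableEq X]

lemma mem_multiBox {K : ℕ} {α : X → ℕ} : α ∈ multiBox X K ↔ ∀ i, α i < K := by
  simp [multiBox]

lemma mem_multiBox_of_sum_lt {K : ℕ} {α : X → ℕ} (h : ∑ i, α i < K) : α ∈ multiBox X K :=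
  mem_multiBox.2 fun i =>
    (Finset.single_le_sum (fun _ _ => Nat.zero_le _) (Finset.mem_univ i)).trans_lt h

lemma sum_multiBox_prod (K : ℕ) (f : X → ℕ → ℝ) :
    ∑ α ∈ multiBox X K, ∏ i, f i (α i) = ∏ i, ∑ j ∈ Finset.range K, f i j :=
  (Finset.prod_univ_sum _ _).symm

/-- Constraints and weights are products over the coordinates, so exchanging the sums over the box
with the product reduces everything to the scalar case `sum_contingency_tables`. -/
lemma sum_multi_contingency_tables {K : ℕ} {A B C D : X → ℕ} (hA : A ∈ multiBox X K)
    (hB : B ∈ multiBox X K) (hC : C ∈ multiBox X K) :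
    (∑ x ∈ multiBox X K, ∑ y ∈ multiBox X K, ∑ u ∈ multiBox X K, ∑ v ∈ multiBox X K,
      if x + y = A ∧ u + v = B ∧ x + u = C ∧ y + v = D then
        (multiFactorial x * multiFactorial y * multiFactorial u * multiFactorial v)⁻¹ else 0) =
    if A + B = C + D then multiFactorial (A + B) *
      (multiFactorial A * multiFactorial B * multiFactorial C * multiFactorial D)⁻¹ else 0 := by
  rw [mem_multiBox] at hA hB hC
  have h1 : ∀ x y u v : X → ℕ,
      (if x + y = A ∧ u + v = B ∧ x + u = C ∧ y + v = D then
        (multiFactorial x * multiFactorial y * multiFactorial u * multiFactorial v)⁻¹ else 0) =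
      ∏ i, if x i + y i = A i ∧ u i + v i = B i ∧ x i + u i = C i ∧ y i + v i = D i then
        (((x i).factorial : ℝ) * (y i).factorial * (u i).factorial * (v i).factorial)⁻¹ else 0 := by
    intro x y u v
    rw [Finset.prod_ite_zero]
    simp only [multiFactorial, Finset.prod_inv_distrib, Finset.prod_mul_distrib]
    congr 1
    simp only [funext_iff, Pi.add_apply, Finset.mem_univ, true_imp_iff, forall_and]
  have h2 : (if A + B = C + D then multiFactorial (A + B) *
      (multiFactorial A * multiFactorial B * multiFactorial C * multiFactorial D)⁻¹ else 0) =
      ∏ i, if A i + B i = C i + D i then ((A i + B i).factorial : ℝ) *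
      (((A i).factorial : ℝ) * (B i).factorial * (C i).factorial * (D i).factorial)⁻¹ else 0 := by
    rw [Finset.prod_ite_zero]
    simp only [multiFactorial, Finset.prod_inv_distrib, Finset.prod_mul_distrib]
    congr 1
    simp only [funext_iff, Pi.add_apply, Finset.mem_univ, true_imp_iff]
  rw [h2]
  simp_rw [h1]
  calc _ = ∑ x ∈ multiBox X K, ∑ y ∈ multiBox X K, ∑ u ∈ multiBox X K,
        ∏ i, ∑ v ∈ Finset.range K,
        if x i + y i = A i ∧ u i + v = B i ∧ x i + u i = C i ∧ y i + v = D i then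
        (((x i).factorial : ℝ) * (y i).factorial * (u i).factorial * v.factorial)⁻¹ else 0 := by
        refine Finset.sum_congr rfl fun x _ => Finset.sum_congr rfl fun y _ =>
          Finset.sum_congr rfl fun u _ => ?_
        exact sum_multiBox_prod K fun i v =>
          if x i + y i = A i ∧ u i + v = B i ∧ x i + u i = C i ∧ y i + v = D i then
          (((x i).factorial : ℝ) * (y i).factorial * (u i).factorial * v.factorial)⁻¹ else 0
    _ = ∑ x ∈ multiBox X K, ∑ y ∈ multiBox X K,
        ∏ i, ∑ u ∈ Finset.range K, ∑ v ∈ Finset.range K,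
        if x i + y i = A i ∧ u + v = B i ∧ x i + u = C i ∧ y i + v = D i then
        (((x i).factorial : ℝ) * (y i).factorial * u.factorial * v.factorial)⁻¹ else 0 := by
        refine Finset.sum_congr rfl fun x _ => Finset.sum_congr rfl fun y _ => ?_
        exact sum_multiBox_prod K fun i u => ∑ v ∈ Finset.range K,
          if x i + y i = A i ∧ u + v = B i ∧ x i + u = C i ∧ y i + v = D i then
          (((x i).factorial : ℝ) * (y i).factorial * u.factorial * v.factorial)⁻¹ else 0
    _ = ∑ x ∈ multiBox X K,
        ∏ i, ∑ y ∈ Finset.range K, ∑ u ∈ Finset.range K, ∑ v ∈ Finset.range K,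
        if x i + y = A i ∧ u + v = B i ∧ x i + u = C i ∧ y + v = D i then
        (((x i).factorial : ℝ) * y.factorial * u.factorial * v.factorial)⁻¹ else 0 := by
        refine Finset.sum_congr rfl fun x _ => ?_
        exact sum_multiBox_prod K fun i y => ∑ u ∈ Finset.range K, ∑ v ∈ Finset.range K,
          if x i + y = A i ∧ u + v = B i ∧ x i + u = C i ∧ y + v = D i then
          (((x i).factorial : ℝ) * y.factorial * u.factorial * v.factorial)⁻¹ else 0
    _ = ∏ i, ∑ x ∈ Finset.range K,
        ∑ y ∈ Finset.range K, ∑ u ∈ Finset.range K, ∑ v ∈ Finset.range K,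
        if x + y = A i ∧ u + v = B i ∧ x + u = C i ∧ y + v = D i then
        ((x.factorial : ℝ) * y.factorial * u.factorial * v.factorial)⁻¹ else 0 :=
        sum_multiBox_prod K fun i x => ∑ y ∈ Finset.range K, ∑ u ∈ Finset.range K,
          ∑ v ∈ Finset.range K,
          if x + y = A i ∧ u + v = B i ∧ x + u = C i ∧ y + v = D i then
          ((x.factorial : ℝ) * y.factorial * u.factorial * v.factorial)⁻¹ else 0
    _ = _ := Finset.prod_congr rfl fun i _ => sum_contingency_tables (hA i) (hB i) (hC i)

/-- Bombieri's inequality in terms of coefficients: the Fischer norm `∑ α! |c α|²` of a product of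
homogeneous polynomials is at least the product of the norms. -/
lemma fischer_mul_le {K a b : ℕ} (hK : a + b < K) {c e : (X → ℕ) → ℂ}
    (hc : ∀ α, c α ≠ 0 → ∑ i, α i = a) (he : ∀ α, e α ≠ 0 → ∑ i, α i = b) :
    (∑ α ∈ multiBox X K, multiFactorial α * ‖c α‖ ^ 2) *
      (∑ β ∈ multiBox X K, multiFactorial β * ‖e β‖ ^ 2) ≤
    ∑ n ∈ multiBox X K, multiFactorial n *
      ‖∑ A ∈ multiBox X K, ∑ B ∈ multiBox X K, if A + B = n then c A * e B else 0‖ ^ 2 := by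
  set Q := multiBox X K with hQ
  have hcQ : ∀ α, α ∉ Q → c α = 0 := fun α hα => by
    by_contra h
    exact hα (mem_multiBox_of_sum_lt (by rw [hc α h]; omega))
  have heQ : ∀ α, α ∉ Q → e α = 0 := fun α hα => by
    by_contra h
    exact hα (mem_multiBox_of_sum_lt (by rw [he α h]; omega))
  have hceQ : ∀ A B, A + B ∉ Q → c A * e B = 0 := fun A B hAB => by
    by_contra h
    refine hAB (mem_multiBox_of_sum_lt ?_)
    simp only [Pi.add_apply, Finset.sum_add_distrib]
    rw [hc A (left_ne_zero_of_mul h), he B (right_ne_zero_of_mul h)]; omega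
  let m : (X → ℕ) → ℂ := fun α => (multiFactorial α : ℂ)
  have hm : ∀ α, m α ≠ 0 := fun α => Complex.ofReal_ne_zero.2 (multiFactorial_pos α).ne'
  -- the amplitude of the overlap `y`
  let g : (X → ℕ) → (X → ℕ) → (X → ℕ) → ℂ := fun x v y =>
    c (x + y) * m (x + y) * conj (e (y + v)) * m (y + v) / m y
  -- Expanding the square gives quadruples with `A + B = C + D`, weighted by `(A + B)!`. Splitting
  -- this weight over the tables with margins `A, B, C, D` and then fixing the diagonal entries `x`,
  -- `v` makes the sums over `y` and `u` complex conjugates of each other.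
  have key : ((∑ n ∈ Q, multiFactorial n *
      ‖∑ A ∈ Q, ∑ B ∈ Q, if A + B = n then c A * e B else 0‖ ^ 2 : ℝ) : ℂ) =
      ((∑ x ∈ Q, ∑ v ∈ Q, (multiFactorial x * multiFactorial v)⁻¹ *
        ‖∑ y ∈ Q, g x v y‖ ^ 2 : ℝ) : ℂ) := by
    push_cast
    calc _ = ∑ n ∈ Q, ∑ A ∈ Q, ∑ B ∈ Q, ∑ C ∈ Q, ∑ D ∈ Q,
          (if A + B = n then if C + D = n then
            m n * (c A * e B) * conj (c C * e D) else 0 else 0) := by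
          refine Finset.sum_congr rfl fun n _ => ?_
          rw [← Complex.conj_mul']
          simp only [map_sum, apply_ite conj, map_zero]
          simp only [Finset.sum_mul, Finset.mul_sum]
          refine Finset.sum_congr rfl fun A _ => ?_
          refine Finset.sum_congr rfl fun B _ => ?_
          refine Finset.sum_congr rfl fun C _ => ?_
          refine Finset.sum_congr rfl fun D _ => ?_
          split_ifs <;> simp [m]
          ring
      _ = ∑ A ∈ Q, ∑ B ∈ Q, ∑ C ∈ Q, ∑ D ∈ Q,
          (if A + B = C + D then m (A + B) else 0) * ((c A * e B) * conj (c C * e D)) := by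
          rw [Finset.sum_comm]
          refine Finset.sum_congr rfl fun A _ => ?_
          rw [Finset.sum_comm]
          refine Finset.sum_congr rfl fun B _ => ?_
          rw [Finset.sum_comm]
          refine Finset.sum_congr rfl fun C _ => ?_
          rw [Finset.sum_comm]
          refine Finset.sum_congr rfl fun D _ => ?_
          rw [Finset.sum_ite_eq]
          by_cases h : A + B ∈ Q
          · rw [if_pos h]
            by_cases h' : A + B = C + D
            · rw [if_pos h'.symm, if_pos h']; ring
            · rw [if_neg (Ne.symm h'), if_neg h']; ring
          · rw [if_neg h, hceQ A B h]; ring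
      _ = ∑ A ∈ Q, ∑ B ∈ Q, ∑ C ∈ Q, ∑ D ∈ Q, ∑ x ∈ Q, ∑ y ∈ Q, ∑ u ∈ Q, ∑ v ∈ Q,
          (if x + y = A then if u + v = B then if x + u = C then if y + v = D then
            (m x * m y * m u * m v)⁻¹ * (m A * m B * m C * m D) *
              ((c A * e B) * conj (c C * e D)) else 0 else 0 else 0 else 0) := by
          refine Finset.sum_congr rfl fun A hA => Finset.sum_congr rfl fun B hB =>
            Finset.sum_congr rfl fun C hC => Finset.sum_congr rfl fun D _ => ?_
          have h1 := congrArg (fun r : ℝ => (r : ℂ) * (m A * m B * m C * m D) *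
            ((c A * e B) * conj (c C * e D))) (sum_multi_contingency_tables hA hB hC (D := D))
          have h2 : ((if A + B = C + D then multiFactorial (A + B) * (multiFactorial A *
              multiFactorial B * multiFactorial C * multiFactorial D)⁻¹ else 0 : ℝ) : ℂ) *
              (m A * m B * m C * m D) = if A + B = C + D then m (A + B) else 0 := by
            split_ifs
            · push_cast
              have := hm A; have := hm B; have := hm C; have := hm D
              simp only [m] at *
              field_simp
            · simp
          rw [h2] at h1
          rw [← h1]
          push_cast
          simp only [Finset.sum_mul]
          refine Finset.sum_congr rfl fun x _ => Finset.sum_congr rfl fun y _ =>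
            Finset.sum_congr rfl fun u _ => Finset.sum_congr rfl fun v _ => ?_
          simp only [← ite_and]
          split_ifs <;> simp [m]
      _ = ∑ x ∈ Q, ∑ y ∈ Q, ∑ u ∈ Q, ∑ v ∈ Q,
            (m x * m y * m u * m v)⁻¹ * (m (x + y) * m (u + v) * m (x + u) * m (y + v)) *
              ((c (x + y) * e (u + v)) * conj (c (x + u) * e (y + v))) := by
          let T := Q ×ˢ Q ×ˢ Q ×ˢ Q
          have hT : ∀ f : (X → ℕ) → (X → ℕ) → (X → ℕ) → (X → ℕ) → ℂ,
              ∑ A ∈ Q, ∑ B ∈ Q, ∑ C ∈ Q, ∑ D ∈ Q, f A B C D =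
                ∑ t ∈ T, f t.1 t.2.1 t.2.2.1 t.2.2.2 := fun f => by
            simp only [T, Finset.sum_product]
          simp only [hT]
          rw [Finset.sum_comm]
          refine Finset.sum_congr rfl fun t _ => ?_
          rw [← hT fun A B C D => if t.1 + t.2.1 = A then if t.2.2.1 + t.2.2.2 = B then
            if t.1 + t.2.2.1 = C then if t.2.1 + t.2.2.2 = D then
            (m t.1 * m t.2.1 * m t.2.2.1 * m t.2.2.2)⁻¹ * (m A * m B * m C * m D) *
              ((c A * e B) * conj (c C * e D)) else 0 else 0 else 0 else 0]
          simp only [Finset.sum_ite_irrel, Finset.sum_const_zero, Finset.sum_ite_eq]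
          split_ifs with h1 h2 h3 h4
          · rfl
          · rw [heQ _ h4]; simp
          · rw [hcQ _ h3]; simp
          · rw [heQ _ h2]; simp
          · rw [hcQ _ h1]; simp
      _ = _ := by
          refine Finset.sum_congr rfl fun x _ => ?_
          rw [Finset.sum_congr rfl fun y _ => Finset.sum_comm, Finset.sum_comm]
          refine Finset.sum_congr rfl fun v _ => ?_
          rw [← Complex.mul_conj', map_sum, Finset.sum_mul_sum, Finset.mul_sum]
          refine Finset.sum_congr rfl fun y _ => ?_
          rw [Finset.mul_sum]
          refine Finset.sum_congr rfl fun u _ => ?_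
          simp only [g, m, map_mul, Complex.conj_ofReal, Complex.conj_conj, mul_inv,
            div_eq_mul_inv, map_inv₀]
          ring
  rw [Complex.ofReal_inj.1 key, Finset.sum_mul_sum]
  refine Finset.sum_le_sum fun x hx => Finset.sum_le_sum fun v hv => ?_
  -- After `key` all terms are nonnegative squares, so those with `c x * e v = 0` may be dropped.
  by_cases h : c x = 0 ∨ e v = 0
  · have : multiFactorial x * ‖c x‖ ^ 2 * (multiFactorial v * ‖e v‖ ^ 2) = 0 := by
      rcases h with h | h <;> simp [h]
    rw [this]
    have := multiFactorial_pos x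
    have := multiFactorial_pos v
    positivity
  · rw [not_or] at h
    have h0 : (0 : X → ℕ) ∈ Q := mem_multiBox.2 fun i => by simp only [Pi.zero_apply]; omega
    -- If `c x ≠ 0`, then `x` already has the full degree `a`, so `c (x + y)` vanishes for every `y
    -- ≠ 0` and only the zero overlap survives.
    rw [Finset.sum_eq_single_of_mem 0 h0]
    · have hx' := multiFactorial_pos x
      have hv' := multiFactorial_pos v
      have hg : ‖g x v 0‖ = ‖c x‖ * multiFactorial x * ‖e v‖ * multiFactorial v := by
        simp only [g, m, add_zero, zero_add, norm_mul, norm_div, RCLike.norm_conj,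
          Complex.norm_real, Real.norm_of_nonneg hx'.le, Real.norm_of_nonneg hv'.le]
        simp [multiFactorial]
      rw [hg]
      apply le_of_eq
      field_simp
    · intro y _ hy
      have : c (x + y) = 0 := by
        by_contra hcy
        have h1 := hc _ hcy
        simp only [Pi.add_apply, Finset.sum_add_distrib, hc x h.1, Nat.add_eq_left,
          Finset.sum_eq_zero_iff, Finset.mem_univ, true_imp_iff] at h1
        exact hy (funext h1)
      simp [g, this]

end Fischer

/-! ### Bombieri's inequality for multivariate polynomials. -/

section Bombieri

open scoped ComplexConjugate

variable {X : Type} [Fintype X]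

/-- The square of the Fischer (Bombieri) norm of a polynomial. -/
def fischerNormSq (P : MvPolynomial X ℂ) : ℝ :=
  ∑ α ∈ P.support, multiFactorial α * ‖P.coeff α‖ ^ 2

lemma fischerNormSq_eq_sum_multiBox [DecidableEq X] {a K : ℕ} {P : MvPolynomial X ℂ}
    (hP : P.IsHomogeneous a) (hK : a < K) :
    fischerNormSq P = ∑ α ∈ multiBox X K,
      multiFactorial α * ‖P.coeff (Finsupp.equivFunOnFinite.symm α)‖ ^ 2 := by
  refine Finset.sum_of_injOn (fun α : X →₀ ℕ => (α : X → ℕ)) (fun α _ β _ h => DFunLike.coe_injective h)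
    (fun α hα => ?_) (fun α _ hα' => ?_) (fun α _ => ?_)
  · refine mem_multiBox_of_sum_lt ?_
    have : (α : X →₀ ℕ).degree = a := by
      rw [Finsupp.degree_eq_weight_one]; exact hP (MvPolynomial.mem_support_iff.1 hα)
    rw [Finsupp.degree_eq_sum] at this
    exact this.trans_lt hK
  · have : P.coeff (Finsupp.equivFunOnFinite.symm α) = 0 := by
      by_contra h
      exact hα' ⟨_, MvPolynomial.mem_support_iff.2 h, by simp⟩
    simp [this]
  · simp

/-- Bombieri's inequality. -/
lemma fischerNormSq_mul_le {a b : ℕ} {P Q : MvPolynomial X ℂ} (hP : P.IsHomogeneous a)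
    (hQ : Q.IsHomogeneous b) : fischerNormSq P * fischerNormSq Q ≤ fischerNormSq (P * Q) := by
  classical
  have hdeg : ∀ {c : ℕ} {R : MvPolynomial X ℂ}, R.IsHomogeneous c → ∀ α : X → ℕ,
      R.coeff (Finsupp.equivFunOnFinite.symm α) ≠ 0 → ∑ i, α i = c := fun {c _} hR α hα => by
    have : (Finsupp.equivFunOnFinite.symm α).degree = c := by
      rw [Finsupp.degree_eq_weight_one]; exact hR hα
    rw [Finsupp.degree_eq_sum] at this
    simpa using this
  rw [fischerNormSq_eq_sum_multiBox hP (show a < a + b + 1 by omega),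
    fischerNormSq_eq_sum_multiBox hQ (show b < a + b + 1 by omega),
    fischerNormSq_eq_sum_multiBox (hP.mul hQ) (Nat.lt_succ_self _)]
  refine (fischer_mul_le (Nat.lt_succ_self _) (hdeg hP) (hdeg hQ)).trans (le_of_eq ?_)
  refine Finset.sum_congr rfl fun n _ => ?_
  congr 3
  rw [MvPolynomial.coeff_mul, ← Finset.sum_product', ← Finset.sum_filter]
  symm
  refine Finset.sum_of_injOn (fun p : (X →₀ ℕ) × (X →₀ ℕ) => ((p.1 : X → ℕ), (p.2 : X → ℕ)))
    (fun p _ q _ h => Prod.ext (DFunLike.coe_injective (congrArg Prod.fst h))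
      (DFunLike.coe_injective (congrArg Prod.snd h)))
    (fun p hp => ?_) (fun p hp hp' => ?_) (fun p _ => ?_)
  · have hp : p.1 + p.2 = Finsupp.equivFunOnFinite.symm n := by simpa using hp
    have hp' : (p.1 : X → ℕ) + (p.2 : X → ℕ) = n := by
      rw [← Finsupp.coe_add, hp]; simp
    have hn : n ∈ multiBox X (a + b + 1) := ‹_›
    rw [mem_multiBox] at hn
    simp only [Finset.coe_filter, Finset.mem_product, mem_multiBox, Set.mem_ofPred_eq]
    refine ⟨⟨fun i => ?_, fun i => ?_⟩, hp'⟩ <;>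
    · have h1 := congrFun hp' i
      have h2 := hn i
      simp only [Pi.add_apply] at h1
      omega
  · refine absurd ⟨(Finsupp.equivFunOnFinite.symm p.1, Finsupp.equivFunOnFinite.symm p.2), ?_, by simp⟩ hp'
    simp only [Finset.mem_filter] at hp
    refine Finset.mem_coe.2 (Finset.HasAntidiagonal.mem_antidiagonal.2 ?_)
    rw [← hp.2]
    ext i
    simp
  · simp

end Bombieri

/-! ### The Fischer norm as a Gaussian integral. -/

section Gaussian

open scoped ComplexConjugate

lemma integrable_complex_pow_mul_exp (a : ℕ) :
    Integrable fun z : ℂ => ‖z‖ ^ a * Real.exp (-‖z‖ ^ 2) := by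
  have h := Complex.integral_rpow_mul_exp_neg_rpow (p := 2) (q := a) (by norm_num)
    (by linarith [Nat.cast_nonneg (α := ℝ) a])
  -- A nonzero value certifies integrability, because the integral of a non-integrable function is
  -- zero by convention.
  have h' : ∫ z : ℂ, ‖z‖ ^ a * Real.exp (-‖z‖ ^ 2) ≠ 0 := by
    simp only [Real.rpow_natCast, Real.rpow_ofNat] at h
    rw [h]
    have : 0 < Real.Gamma ((a + 2) / 2) := Real.Gamma_pos_of_pos (by positivity)
    positivity
  exact not_imp_comm.1 integral_undef h'

lemma integrable_gaussian_monomial (a b : ℕ) :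
    Integrable fun z : ℂ => z ^ a * conj z ^ b * Real.exp (-‖z‖ ^ 2) := by
  refine (integrable_complex_pow_mul_exp (a + b)).mono' (by fun_prop) (.of_forall fun z => ?_)
  simp only [norm_mul, norm_pow, RCLike.norm_conj, Complex.norm_real, Real.norm_eq_abs,
    Real.abs_exp, pow_add, le_refl]

/-- On the diagonal this is a Gamma integral. Off the diagonal, the rotation by `π / (a - b)`
preserves Lebesgue measure and flips the sign of the integrand. -/
lemma integral_gaussian_monomial (a b : ℕ) :
    ∫ z : ℂ, z ^ a * conj z ^ b * Real.exp (-‖z‖ ^ 2) =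
      if a = b then (Real.pi : ℂ) * a.factorial else 0 := by
  split_ifs with h
  · subst h
    have h := Complex.integral_rpow_mul_exp_neg_rpow (p := 2) (q := (2 * a : ℕ)) (by norm_num)
      (by linarith [Nat.cast_nonneg (α := ℝ) (2 * a)])
    simp only [Real.rpow_natCast, Real.rpow_ofNat] at h
    have h2 : ((2 * a : ℕ) + 2 : ℝ) / 2 = a + 1 := by push_cast; ring
    rw [h2, Real.Gamma_nat_eq_factorial] at h
    have h3 := integral_ofReal.trans (congrArg (fun r : ℝ => (r : ℂ)) h)
    convert h3 using 1
    · refine integral_congr_ae (.of_forall fun z => ?_)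
      simp only
      rw [← mul_pow, Complex.mul_conj']
      refine Eq.trans ?_ (Complex.ofReal_mul _ _).symm
      rw [Complex.ofReal_pow, pow_mul]
    · push_cast; ring
  · set f : ℂ → ℂ := fun z => z ^ a * conj z ^ b * Real.exp (-‖z‖ ^ 2)
    have hab : (a : ℝ) - b ≠ 0 := sub_ne_zero.2 (by exact_mod_cast h)
    let w : Circle := Circle.exp (Real.pi / (a - b))
    have hw : ∀ z, f (rotation w z) = - f z := by
      intro z
      have h1 : (w : ℂ) ^ a * conj (w : ℂ) ^ b = -1 := by
        rw [← Circle.coe_inv_eq_conj]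
        simp only [w, ← Circle.exp_neg, Circle.coe_exp, ← Complex.exp_nat_mul, ← Complex.exp_add]
        rw [← Complex.exp_pi_mul_I]
        congr 1
        have : (a : ℂ) - b ≠ 0 := by exact_mod_cast hab
        push_cast
        field_simp
        ring
      simp only [f, rotation_apply, map_mul, norm_mul, Circle.norm_coe, one_mul, mul_pow]
      linear_combination (z ^ a * conj z ^ b * Real.exp (-‖z‖ ^ 2)) * h1
    have h2 := (rotation w).measurePreserving.integral_comp
      (rotation w).toHomeomorph.measurableEmbedding f
    simp only [hw, integral_neg] at h2
    exact self_eq_neg.1 h2.symm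

variable {X : Type} [Fintype X]

lemma gaussian_monomial_prod (α β : X → ℕ) (z : X → ℂ) :
    (∏ i, z i ^ α i) * conj (∏ i, z i ^ β i) * Real.exp (-∑ i, ‖z i‖ ^ 2) =
      ∏ i, (z i ^ α i * conj (z i) ^ β i * Real.exp (-‖z i‖ ^ 2)) := by
  simp only [Finset.prod_mul_distrib, map_prod, map_pow]
  rw [← Finset.sum_neg_distrib, Real.exp_sum]
  push_cast
  rfl

lemma integrable_gaussian_monomials (α β : X → ℕ) :
    Integrable fun z : X → ℂ =>
      (∏ i, z i ^ α i) * conj (∏ i, z i ^ β i) * Real.exp (-∑ i, ‖z i‖ ^ 2) := by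
  simp only [gaussian_monomial_prod]
  exact Integrable.fintype_prod fun i => integrable_gaussian_monomial (α i) (β i)

lemma integral_gaussian_monomials (α β : X → ℕ) :
    ∫ z : X → ℂ, (∏ i, z i ^ α i) * conj (∏ i, z i ^ β i) * Real.exp (-∑ i, ‖z i‖ ^ 2) =
      if α = β then (Real.pi : ℂ) ^ Fintype.card X * multiFactorial α else 0 := by
  simp only [gaussian_monomial_prod]
  rw [volume_pi, integral_fintype_prod_eq_prod
    (f := fun i (z : ℂ) => z ^ α i * conj z ^ β i * Real.exp (-‖z‖ ^ 2))]
  simp only [integral_gaussian_monomial, Finset.prod_ite_zero, funext_iff, Finset.mem_univ,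
    true_imp_iff, Finset.prod_mul_distrib, Finset.prod_const, Finset.card_univ, multiFactorial]
  push_cast
  rfl

/-- The Fischer norm is the `L²` norm with respect to the Gaussian weight. -/
lemma integral_gaussian_normSq (P : MvPolynomial X ℂ) :
    ∫ z : X → ℂ, ‖MvPolynomial.eval z P‖ ^ 2 * Real.exp (-∑ i, ‖z i‖ ^ 2) =
      Real.pi ^ Fintype.card X * fischerNormSq P := by
  classical
  have h : ∀ z : X → ℂ, ((‖MvPolynomial.eval z P‖ ^ 2 * Real.exp (-∑ i, ‖z i‖ ^ 2) : ℝ) : ℂ) =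
      ∑ α ∈ P.support, ∑ β ∈ P.support, P.coeff α * conj (P.coeff β) *
        ((∏ i, z i ^ α i) * conj (∏ i, z i ^ β i) * Real.exp (-∑ i, ‖z i‖ ^ 2)) := by
    intro z
    push_cast
    rw [← Complex.mul_conj', MvPolynomial.eval_eq', map_sum, Finset.sum_mul_sum, Finset.sum_mul]
    refine Finset.sum_congr rfl fun α _ => ?_
    rw [Finset.sum_mul]
    refine Finset.sum_congr rfl fun β _ => ?_
    rw [map_mul]
    ring
  apply Complex.ofReal_injective
  refine integral_ofReal.symm.trans ?_
  have hint : ∀ α β : X →₀ ℕ, Integrable fun z : X → ℂ => P.coeff α * conj (P.coeff β) *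
      ((∏ i, z i ^ α i) * conj (∏ i, z i ^ β i) * Real.exp (-∑ i, ‖z i‖ ^ 2)) := fun α β =>
    (integrable_gaussian_monomials (α : X → ℕ) β).const_mul _
  simp only [Complex.coe_algebraMap, h]
  rw [integral_finsetSum _ fun α _ => integrable_finsetSum _ fun β _ => hint α β]
  rw [fischerNormSq, Complex.ofReal_mul, Complex.ofReal_pow, Complex.ofReal_sum, Finset.mul_sum]
  refine Finset.sum_congr rfl fun α hα => ?_
  rw [integral_finsetSum _ fun β _ => hint α β]
  simp only [integral_const_mul, integral_gaussian_monomials]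
  rw [Finset.sum_eq_single_of_mem α hα]
  · rw [if_pos rfl, Complex.mul_conj', Complex.ofReal_mul, Complex.ofReal_pow]
    ring
  · intro β _ hβ
    rw [if_neg fun h => hβ (DFunLike.coe_injective h.symm), mul_zero]

end Gaussian

/-! ### Polar coordinates: from Gaussian integrals to the unit sphere. -/

section Sphere

variable {X : Type} [Fintype X]

lemma eval_smul_of_isHomogeneous {a : ℕ} {P : MvPolynomial X ℂ} (hP : P.IsHomogeneous a)
    (r : ℂ) (z : X → ℂ) : MvPolynomial.eval (r • z) P = r ^ a * MvPolynomial.eval z P := by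
  rw [MvPolynomial.eval_eq', MvPolynomial.eval_eq', Finset.mul_sum]
  refine Finset.sum_congr rfl fun α hα => ?_
  have h : ∑ i, α i = a := by
    rw [← Finsupp.degree_eq_sum, Finsupp.degree_eq_weight_one]
    exact hP (MvPolynomial.mem_support_iff.1 hα)
  simp only [Pi.smul_apply, smul_eq_mul, mul_pow, Finset.prod_mul_distrib]
  rw [Finset.prod_pow_eq_pow_sum, h]
  ring

/-- Here `d` is a complex dimension, so the radial density has exponent `2 * d - 1`; the squared
modulus of a form of degree `a` contributes `r ^ (2 * a)`. -/
lemma integral_volumeIoiPow_gaussian (d a : ℕ) (hd : 0 < d) :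
    ∫ r : Set.Ioi (0 : ℝ), (r : ℝ) ^ (2 * a) * Real.exp (-(r : ℝ) ^ 2)
      ∂(Measure.volumeIoiPow (2 * d - 1)) = 1 / 2 * Real.Gamma (d + a) := by
  simp only [Measure.volumeIoiPow, ENNReal.ofReal]
  rw [integral_withDensity_eq_integral_smul (measurable_subtype_coe.pow_const _).real_toNNReal,
    integral_subtype_comap measurableSet_Ioi fun r : ℝ => Real.toNNReal (r ^ (2 * d - 1)) •
      (r ^ (2 * a) * Real.exp (-r ^ 2))]
  have h := integral_rpow_mul_exp_neg_rpow (p := 2) (q := (2 * d - 1 + 2 * a : ℕ)) (by norm_num)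
    (by linarith [Nat.cast_nonneg (α := ℝ) (2 * d - 1 + 2 * a)])
  have h2 : (((2 * d - 1 + 2 * a : ℕ) : ℝ) + 1) / 2 = d + a := by
    have : ((2 * d - 1 + 2 * a : ℕ) : ℝ) + 1 = ((2 * d + 2 * a : ℕ) : ℝ) := by
      rw [← Nat.cast_add_one]; congr 1; omega
    rw [this]; push_cast; ring
  rw [h2] at h
  rw [← h]
  refine setIntegral_congr_fun measurableSet_Ioi fun r hr => ?_
  simp only [NNReal.smul_def, Real.coe_toNNReal _ (pow_nonneg (Set.mem_Ioi.1 hr).le _),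
    Real.rpow_natCast, Real.rpow_ofNat, smul_eq_mul, pow_add]
  ring

/-- The Gaussian weight is radial and `P` is homogeneous, so the integrand is a function of the
direction times a function of the radius. -/
lemma integral_gaussian_polar [Nonempty X] {a : ℕ} {P : MvPolynomial X ℂ}
    (hP : P.IsHomogeneous a) :
    ∫ z : EuclideanSpace ℂ X, ‖MvPolynomial.eval z P‖ ^ 2 * Real.exp (-‖z‖ ^ 2) =
      (∫ φ : Metric.sphere (0 : EuclideanSpace ℂ X) 1,
        ‖MvPolynomial.eval (φ : EuclideanSpace ℂ X) P‖ ^ 2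
          ∂(volume : Measure (EuclideanSpace ℂ X)).toSphere) *
      (1 / 2 * Real.Gamma (Fintype.card X + a)) := by
  set μ := (volume : Measure (EuclideanSpace ℂ X))
  have hdim : Module.finrank ℝ (EuclideanSpace ℂ X) = 2 * Fintype.card X := by
    rw [finrank_real_of_complex, finrank_euclideanSpace]
  set f : EuclideanSpace ℂ X → ℝ := fun z => ‖MvPolynomial.eval z P‖ ^ 2 * Real.exp (-‖z‖ ^ 2)
  calc ∫ z, f z ∂μ = ∫ z : ({(0)}ᶜ : Set (EuclideanSpace ℂ X)), f z ∂(μ.comap (↑)) := by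
        rw [integral_subtype_comap (measurableSet_singleton _).compl f,
          restrict_compl_singleton]
    _ = ∫ x, ‖MvPolynomial.eval (x.1 : EuclideanSpace ℂ X) P‖ ^ 2 *
          ((x.2 : ℝ) ^ (2 * a) * Real.exp (-(x.2 : ℝ) ^ 2))
          ∂μ.toSphere.prod (.volumeIoiPow (Module.finrank ℝ (EuclideanSpace ℂ X) - 1)) := by
        rw [← μ.measurePreserving_homeomorphUnitSphereProd.integral_comp
          (Homeomorph.measurableEmbedding _)]
        refine integral_congr_ae (.of_forall fun z => ?_)
        have hz : (z : EuclideanSpace ℂ X) = (‖(z : EuclideanSpace ℂ X)‖ : ℂ) •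
            ((homeomorphUnitSphereProd _ z).1 : EuclideanSpace ℂ X) := by
          have h0 : ‖(z : EuclideanSpace ℂ X)‖ ≠ 0 := norm_ne_zero_iff.2 z.2
          rw [homeomorphUnitSphereProd_apply_fst_coe, Complex.coe_smul, smul_smul,
            mul_inv_cancel₀ h0, one_smul]
        have h1 : ‖MvPolynomial.eval (z : EuclideanSpace ℂ X) P‖ =
            ‖(z : EuclideanSpace ℂ X)‖ ^ a *
              ‖MvPolynomial.eval ((homeomorphUnitSphereProd _ z).1 : EuclideanSpace ℂ X) P‖ := by
          conv_lhs => rw [hz]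
          rw [WithLp.ofLp_smul, eval_smul_of_isHomogeneous hP, norm_mul, norm_pow,
            Complex.norm_real, norm_norm]
        simp only [f, h1, homeomorphUnitSphereProd_apply_snd_coe]
        ring
    _ = _ := by
        refine (integral_prod_mul
          (fun φ : Metric.sphere (0 : EuclideanSpace ℂ X) 1 =>
            ‖MvPolynomial.eval (φ : EuclideanSpace ℂ X) P‖ ^ 2)
          (fun r : Set.Ioi (0 : ℝ) => (r : ℝ) ^ (2 * a) * Real.exp (-(r : ℝ) ^ 2))).trans ?_
        rw [hdim, integral_volumeIoiPow_gaussian _ _ Fintype.card_pos]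

/-- The Euclidean volume and the product volume are Haar measures on isomorphic spaces, hence
proportional. The value of `κ` is irrelevant, since it cancels in the normalization of the Haar
distribution. -/
lemma integral_gaussian_euclideanSpace (X : Type) [Fintype X] :
    ∃ κ : ℝ, 0 < κ ∧ ∀ P : MvPolynomial X ℂ,
      ∫ z : EuclideanSpace ℂ X, ‖MvPolynomial.eval z P‖ ^ 2 * Real.exp (-‖z‖ ^ 2) =
        κ * fischerNormSq P := by
  let e : EuclideanSpace ℂ X ≃L[ℝ] (X → ℂ) := PiLp.continuousLinearEquiv 2 ℝ fun _ => ℂ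
  let μ := (volume : Measure (EuclideanSpace ℂ X)).map e
  have : μ.IsAddHaarMeasure := e.isAddHaarMeasure_map _
  have hμ := Measure.isAddLeftInvariant_eq_smul μ (volume : Measure (X → ℂ))
  set c := μ.addHaarScalarFactor (volume : Measure (X → ℂ))
  have hc : 0 < c := Measure.addHaarScalarFactor_pos_of_isAddHaarMeasure _ _
  refine ⟨c * Real.pi ^ Fintype.card X, by positivity, fun P => ?_⟩
  rw [mul_assoc, ← integral_gaussian_normSq]
  have h1 : ∫ y, ‖MvPolynomial.eval y P‖ ^ 2 * Real.exp (-∑ i, ‖y i‖ ^ 2) ∂μ =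
      ∫ z : EuclideanSpace ℂ X, ‖MvPolynomial.eval z P‖ ^ 2 * Real.exp (-‖z‖ ^ 2) := by
    refine (e.toHomeomorph.measurableEmbedding.integral_map _).trans ?_
    refine integral_congr_ae (.of_forall fun z => ?_)
    simp only [EuclideanSpace.norm_sq_eq]
    rfl
  rw [← h1, hμ, integral_smul_nnreal_measure]
  rfl

end Sphere

/-! ### Near-positive correlation of homogeneous polynomials under the Haar distribution. -/

section Haar

instance isProbabilityMeasure_haarState (m : ℕ) : IsProbabilityMeasure (haarState m) where
  measure_univ := by
    rw [haarState, Measure.smul_apply, smul_eq_mul]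
    refine ENNReal.inv_mul_cancel ?_ (measure_ne_top _ _)
    rw [Measure.measure_univ_ne_zero]
    exact Measure.toSphere_ne_zero _

/-- Comparing the polar formula for `P` with the one for the constant polynomial `1` eliminates both
`κ` and the area of the sphere. -/
lemma integral_haarState_of_isHomogeneous {m a : ℕ} {P : MvPolynomial (BitString m) ℂ}
    (hP : P.IsHomogeneous a) :
    (∫ φ : PureState m, ‖MvPolynomial.eval (φ : EuclideanSpace ℂ (BitString m)) P‖ ^ 2
      ∂(haarState m)) * Real.Gamma ((2 : ℝ) ^ m + a) =
      Real.Gamma ((2 : ℝ) ^ m) * fischerNormSq P := by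
  obtain ⟨κ, hκ, h⟩ := integral_gaussian_euclideanSpace (BitString m)
  have hcard : (Fintype.card (BitString m) : ℝ) = 2 ^ m := by simp
  have h1 := integral_gaussian_polar hP
  have h2 := integral_gaussian_polar (MvPolynomial.isHomogeneous_one (BitString m) ℂ)
  rw [h, hcard] at h1 h2
  simp only [map_one, norm_one, one_pow, integral_const, smul_eq_mul, mul_one, CharP.cast_eq_zero,
    add_zero] at h2
  have h3 : fischerNormSq (1 : MvPolynomial (BitString m) ℂ) = 1 := by
    simp [fischerNormSq, MvPolynomial.support_one, multiFactorial]
  rw [h3, mul_one] at h2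
  rw [haarState, integral_smul_measure, smul_eq_mul, ENNReal.toReal_inv]
  change κ = (_ : Measure _).real Set.univ * _ at h2
  rw [Measure.real] at h2
  set s := ((volume : Measure (EuclideanSpace ℂ (BitString m))).toSphere Set.univ).toReal
  have hs : s ≠ 0 := fun h0 => hκ.ne' (by rw [h2, h0, zero_mul])
  field_simp
  linear_combination 2 * (-h1) + 2 * fischerNormSq P * h2

/-- The Gamma ratio compares the sphere normalizations for degrees `a`, `b` and `a + b`. Raising `b`
by one multiplies the sides by `d / (d + a) * (d + a + b)` and `d + b`, and `d * (d + a + b) ≤ (d +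
a) * (d + b)`. -/
lemma gamma_ratio_ge {d : ℝ} (hd : 0 < d) (a b : ℕ) :
    (d / (d + a)) ^ b * (Real.Gamma d * Real.Gamma (d + (a + b : ℕ))) ≤
      Real.Gamma (d + a) * Real.Gamma (d + b) := by
  induction b with
  | zero => simp [mul_comm]
  | succ b ih =>
    have h1 : Real.Gamma (d + (b + 1 : ℕ)) = (d + b) * Real.Gamma (d + b) := by
      push_cast; rw [← add_assoc, Real.Gamma_add_one (by positivity)]
    have h2 : Real.Gamma (d + (a + (b + 1) : ℕ)) = (d + (a + b : ℕ)) * Real.Gamma (d + (a + b : ℕ)) := by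
      push_cast
      rw [← add_assoc, ← add_assoc, Real.Gamma_add_one (by positivity), add_assoc d]
    have h3 : d / (d + a) * (d + (a + b : ℕ)) ≤ d + b := by
      rw [div_mul_eq_mul_div, div_le_iff₀ (by positivity)]
      push_cast
      nlinarith [mul_nonneg (Nat.cast_nonneg (α := ℝ) a) (Nat.cast_nonneg (α := ℝ) b)]
    rw [h1, h2, pow_succ]
    calc _ = ((d / (d + a)) ^ b * (Real.Gamma d * Real.Gamma (d + (a + b : ℕ)))) *
          (d / (d + a) * (d + (a + b : ℕ))) := by ring
      _ ≤ (Real.Gamma (d + a) * Real.Gamma (d + b)) * (d + b) := by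
          have := Real.Gamma_pos_of_pos (show 0 < d + a by positivity)
          have := Real.Gamma_pos_of_pos (show 0 < d + b by positivity)
          gcongr
      _ = _ := by ring

/-- Squared moduli of homogeneous polynomials are almost positively correlated under the Haar
distribution. -/
lemma integral_haarState_mul_ge {m a b : ℕ} {P Q : MvPolynomial (BitString m) ℂ}
    (hP : P.IsHomogeneous a) (hQ : Q.IsHomogeneous b) :
    ((2 : ℝ) ^ m / ((2 : ℝ) ^ m + a)) ^ b *
      ((∫ φ : PureState m, ‖MvPolynomial.eval (φ : EuclideanSpace ℂ (BitString m)) P‖ ^ 2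
        ∂(haarState m)) *
      ∫ φ : PureState m, ‖MvPolynomial.eval (φ : EuclideanSpace ℂ (BitString m)) Q‖ ^ 2
        ∂(haarState m)) ≤
    ∫ φ : PureState m, ‖MvPolynomial.eval (φ : EuclideanSpace ℂ (BitString m)) P‖ ^ 2 *
      ‖MvPolynomial.eval (φ : EuclideanSpace ℂ (BitString m)) Q‖ ^ 2 ∂(haarState m) := by
  have hd : (0 : ℝ) < 2 ^ m := by positivity
  have h1 := integral_haarState_of_isHomogeneous hP
  have h2 := integral_haarState_of_isHomogeneous hQ
  have h3 := integral_haarState_of_isHomogeneous (hP.mul hQ)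
  simp only [map_mul, norm_mul, mul_pow] at h3
  have hB := fischerNormSq_mul_le hP hQ
  have hG := gamma_ratio_ge hd a b
  set d : ℝ := 2 ^ m
  have g0 := Real.Gamma_pos_of_pos hd
  have ga := Real.Gamma_pos_of_pos (show 0 < d + a by positivity)
  have gb := Real.Gamma_pos_of_pos (show 0 < d + b by positivity)
  have gab := Real.Gamma_pos_of_pos (show 0 < d + (a + b : ℕ) by positivity)
  set x := ∫ φ : PureState m, ‖MvPolynomial.eval (φ : EuclideanSpace ℂ (BitString m)) P‖ ^ 2
        ∂(haarState m)
  set y := ∫ φ : PureState m, ‖MvPolynomial.eval (φ : EuclideanSpace ℂ (BitString m)) Q‖ ^ 2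
        ∂(haarState m)
  have hx : 0 ≤ x := integral_nonneg fun _ => by positivity
  have hy : 0 ≤ y := integral_nonneg fun _ => by positivity
  rw [← mul_le_mul_iff_left₀ (show 0 < Real.Gamma d * Real.Gamma (d + (a + b : ℕ)) by positivity)]
  calc _ = ((d / (d + a)) ^ b * (Real.Gamma d * Real.Gamma (d + (a + b : ℕ)))) * (x * y) := by ring
    _ ≤ (Real.Gamma (d + a) * Real.Gamma (d + b)) * (x * y) := by gcongr
    _ = Real.Gamma d ^ 2 * (fischerNormSq P * fischerNormSq Q) := by
        linear_combination y * Real.Gamma (d + b) * h1 + Real.Gamma d * fischerNormSq P * h2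
    _ ≤ Real.Gamma d ^ 2 * fischerNormSq (P * Q) := by gcongr
    _ = _ := by linear_combination -Real.Gamma d * h3

lemma continuous_eval_pureState {m : ℕ} (P : MvPolynomial (BitString m) ℂ) :
    Continuous fun φ : PureState m =>
      MvPolynomial.eval (φ : EuclideanSpace ℂ (BitString m)) P := by
  have := MvPolynomial.continuous_eval P
  fun_prop

lemma lintegral_haarState_eq {m : ℕ} {f : PureState m → ℝ} (hf : Continuous f) (h0 : ∀ φ, 0 ≤ f φ) :
    ∫⁻ φ, ENNReal.ofReal (f φ) ∂(haarState m) = ENNReal.ofReal (∫ φ, f φ ∂(haarState m)) :=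
  (ofReal_integral_eq_lintegral_ofReal
    (hf.integrable_of_hasCompactSupport (HasCompactSupport.of_compactSpace _))
    (.of_forall h0)).symm

lemma lintegral_haarState_mul_ge {m a b : ℕ} {P Q : MvPolynomial (BitString m) ℂ}
    (hP : P.IsHomogeneous a) (hQ : Q.IsHomogeneous b) :
    ENNReal.ofReal (((2 : ℝ) ^ m / ((2 : ℝ) ^ m + a)) ^ b) *
      ((∫⁻ φ : PureState m, ENNReal.ofReal
        (‖MvPolynomial.eval (φ : EuclideanSpace ℂ (BitString m)) P‖ ^ 2) ∂(haarState m)) *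
      ∫⁻ φ : PureState m, ENNReal.ofReal
        (‖MvPolynomial.eval (φ : EuclideanSpace ℂ (BitString m)) Q‖ ^ 2) ∂(haarState m)) ≤
    ∫⁻ φ : PureState m, ENNReal.ofReal
      (‖MvPolynomial.eval (φ : EuclideanSpace ℂ (BitString m)) P‖ ^ 2) * ENNReal.ofReal
      (‖MvPolynomial.eval (φ : EuclideanSpace ℂ (BitString m)) Q‖ ^ 2) ∂(haarState m) := by
  have hc : ∀ R : MvPolynomial (BitString m) ℂ, Continuous fun φ : PureState m =>
      ‖MvPolynomial.eval (φ : EuclideanSpace ℂ (BitString m)) R‖ ^ 2 := fun R =>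
    (continuous_eval_pureState R).norm.pow 2
  have hPQ : Continuous fun φ : PureState m =>
      ‖MvPolynomial.eval (φ : EuclideanSpace ℂ (BitString m)) P‖ ^ 2 *
      ‖MvPolynomial.eval (φ : EuclideanSpace ℂ (BitString m)) Q‖ ^ 2 := (hc P).mul (hc Q)
  simp_rw [← ENNReal.ofReal_mul (sq_nonneg _)]
  rw [lintegral_haarState_eq (hc P) (fun _ => sq_nonneg _),
    lintegral_haarState_eq (hc Q) (fun _ => sq_nonneg _),
    lintegral_haarState_eq hPQ (fun _ => by positivity),
    ← ENNReal.ofReal_mul (integral_nonneg fun _ => sq_nonneg _),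
    ← ENNReal.ofReal_mul (by positivity)]
  exact ENNReal.ofReal_le_ofReal (integral_haarState_mul_ge hP hQ)

end Haar

/-! ### Haar random generators and the resampling of some of their states. -/

section RandomGenerator

/-- All keys, of all lengths. -/
abbrev AnyKey : Type := Σ l : ℕ, BitString l

variable {n : ℕ → ℕ}

/-- Generators as families indexed by all keys. -/
abbrev GenTable (n : ℕ → ℕ) : Type := ∀ x : AnyKey, PureState (n x.1)

/-- The generator with a given table. -/
def GenTable.gen (ω : GenTable n) : Generator n := fun l k => ω ⟨l, k⟩

/-- The distribution of a generator whose outputs are independent Haar random states. -/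
def randomTable (n : ℕ → ℕ) : Measure (GenTable n) :=
  Measure.infinitePi fun x : AnyKey => haarState (n x.1)

instance : IsProbabilityMeasure (randomTable n) := by unfold randomTable; infer_instance

open Classical in
/-- The table that agrees with `ω` on `s` and with `ω'` elsewhere. -/
def splice (s : Set AnyKey) (ω ω' : GenTable n) : GenTable n :=
  fun x => if x ∈ s then ω x else ω' x

lemma splice_of_mem {s : Set AnyKey} {x : AnyKey} (hx : x ∈ s) (ω ω' : GenTable n) :
    splice s ω ω' x = ω x := if_pos hx

lemma splice_of_notMem {s : Set AnyKey} {x : AnyKey} (hx : x ∉ s) (ω ω' : GenTable n) :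
    splice s ω ω' x = ω' x := if_neg hx

lemma measurable_splice (s : Set AnyKey) :
    Measurable fun p : GenTable n × GenTable n => splice s p.1 p.2 := by
  refine measurable_pi_lambda _ fun x => ?_
  by_cases hx : x ∈ s
  · simp only [splice_of_mem hx]; fun_prop
  · simp only [splice_of_notMem hx]; fun_prop

/-- The product measure is determined by its cylinders, and a cylinder pulls back to a cylinder over
the keys in `s` times one over the remaining keys. -/
lemma measurePreserving_splice (s : Set AnyKey) :
    MeasurePreserving (fun p : GenTable n × GenTable n => splice s p.1 p.2)
      ((randomTable n).prod (randomTable n)) (randomTable n) := by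
  classical
  refine ⟨measurable_splice s, Measure.eq_infinitePi _ fun F t ht => ?_⟩
  have hpre : (fun p : GenTable n × GenTable n => splice s p.1 p.2) ⁻¹' ((F : Set AnyKey).pi t) =
      ((F.filter (· ∈ s) : Finset AnyKey) : Set AnyKey).pi t ×ˢ
        ((F.filter (· ∉ s) : Finset AnyKey) : Set AnyKey).pi t := by
    ext p
    simp only [Set.mem_preimage, Set.mem_pi, Set.mem_prod, Finset.coe_filter, Finset.mem_coe,
      Set.mem_ofPred_eq]
    constructor
    · refine fun h => ⟨fun x hx => ?_, fun x hx => ?_⟩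
      · have := h x hx.1; rwa [splice_of_mem hx.2] at this
      · have := h x hx.1; rwa [splice_of_notMem hx.2] at this
    · rintro ⟨h1, h2⟩ x hx
      by_cases hs : x ∈ s
      · rw [splice_of_mem hs]; exact h1 x ⟨hx, hs⟩
      · rw [splice_of_notMem hs]; exact h2 x ⟨hx, hs⟩
  rw [Measure.map_apply (measurable_splice s)
    (MeasurableSet.pi F.countable_toSet fun i _ => ht i), hpre, Measure.prod_prod,
    randomTable, Measure.infinitePi_pi _ fun i _ => ht i, Measure.infinitePi_pi _ fun i _ => ht i,
    Finset.prod_filter_mul_prod_filter_not]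

lemma measurable_update_table (x : AnyKey) :
    Measurable fun p : GenTable n × PureState (n x.1) => Function.update p.1 x p.2 := by
  refine measurable_pi_lambda _ fun y => ?_
  by_cases hy : y = x
  · subst hy; simp only [Function.update_self]; fun_prop
  · simp only [Function.update_of_ne hy]; fun_prop

lemma measurePreserving_update (x : AnyKey) :
    MeasurePreserving (fun p : GenTable n × PureState (n x.1) => Function.update p.1 x p.2)
      ((randomTable n).prod (haarState (n x.1))) (randomTable n) := by
  classical
  refine ⟨measurable_update_table x, Measure.eq_infinitePi _ fun F t ht => ?_⟩
  have hpre : (fun p : GenTable n × PureState (n x.1) => Function.update p.1 x p.2) ⁻¹'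
      ((F : Set AnyKey).pi t) =
      ((F.erase x : Finset AnyKey) : Set AnyKey).pi t ×ˢ (if x ∈ F then t x else Set.univ) := by
    ext p
    simp only [Set.mem_preimage, Set.mem_pi, Set.mem_prod, Finset.coe_erase, Finset.mem_coe,
      Set.mem_sdiff, Set.mem_singleton_iff]
    constructor
    · refine fun h => ⟨fun y hy => ?_, ?_⟩
      · have := h y hy.1; rwa [Function.update_of_ne hy.2] at this
      · split_ifs with hx
        · have := h x hx; rwa [Function.update_self] at this
        · trivial
    · rintro ⟨h1, h2⟩ y hy
      by_cases hyx : y = x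
      · subst hyx; rw [Function.update_self]; rwa [if_pos hy] at h2
      · rw [Function.update_of_ne hyx]; exact h1 y ⟨hy, hyx⟩
  rw [Measure.map_apply (measurable_update_table x)
    (MeasurableSet.pi F.countable_toSet fun i _ => ht i), hpre, Measure.prod_prod,
    randomTable, Measure.infinitePi_pi _ fun i _ => ht i]
  split_ifs with hx
  · exact Finset.prod_erase_mul F (fun i => haarState (n i.1) (t i)) hx
  · rw [measure_univ, mul_one, Finset.erase_eq_of_notMem hx]

lemma splice_update_of_mem {s : Set AnyKey} {x : AnyKey} (hx : x ∈ s) (ω ω' : GenTable n)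
    (φ : PureState (n x.1)) :
    splice s (Function.update ω x φ) ω' = Function.update (splice s ω ω') x φ := by
  funext y
  by_cases hy : y = x
  · subst hy; rw [splice_of_mem hx]; simp
  · by_cases hs : y ∈ s <;> simp [splice, hs, hy]

lemma splice_update_of_notMem {s : Set AnyKey} {x : AnyKey} (hx : x ∉ s) (ω ω' : GenTable n)
    (φ : PureState (n x.1)) : splice s (Function.update ω x φ) ω' = splice s ω ω' := by
  funext y
  by_cases hs : y ∈ s
  · have : y ≠ x := fun h => hx (h ▸ hs)
    simp [splice, hs, this]
  · simp [splice, hs]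

lemma splice_update_right_of_notMem {s : Set AnyKey} {x : AnyKey} (hx : x ∉ s) (ω ω' : GenTable n)
    (φ : PureState (n x.1)) :
    splice s ω (Function.update ω' x φ) = Function.update (splice s ω ω') x φ := by
  funext y
  by_cases hy : y = x
  · subst hy; rw [splice_of_notMem hx]; simp
  · by_cases hs : y ∈ s <;> simp [splice, hs, hy]

/-- Resampling the state of one key. -/
lemma lintegral_resample (x : AnyKey) {f : GenTable n → ENNReal} (hf : Measurable f) :
    ∫⁻ ω, f ω ∂(randomTable n) =
      ∫⁻ ω, ∫⁻ φ, f (Function.update ω x φ) ∂(haarState (n x.1)) ∂(randomTable n) := by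
  rw [← (measurePreserving_update x).lintegral_comp hf, lintegral_prod]
  exact (hf.comp (measurable_update_table x)).aemeasurable

end RandomGenerator

/-! ### Decoupling two functions of the generator, one key at a time. -/

section Decoupling

variable {n : ℕ → ℕ}

/-- `p` is a homogeneous polynomial of degree `a` in the state of the key `x`. -/
def HomogeneousAt (x : AnyKey) (a : ℕ) (p : GenTable n → ℂ) : Prop :=
  ∀ ω, ∃ P : MvPolynomial (BitString (n x.1)) ℂ, P.IsHomogeneous a ∧ ∀ φ : PureState (n x.1),
    p (Function.update ω x φ) =
      MvPolynomial.eval (φ : EuclideanSpace ℂ (BitString (n x.1))) P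

/-- The squared modulus, as an extended nonnegative real. -/
def sqMod (p : GenTable n → ℂ) (ω : GenTable n) : ENNReal := ENNReal.ofReal (‖p ω‖ ^ 2)

lemma measurable_sqMod {p : GenTable n → ℂ} (hp : Measurable p) : Measurable (sqMod p) := by
  unfold sqMod; fun_prop

/-- The correlation of `|p|²` and `|q|²` when the states of the keys in `J` are sampled
independently for `p` and `q`. -/
def crossMoment (p q : GenTable n → ℂ) (J : Finset AnyKey) : ENNReal :=
  ∫⁻ ω, ∫⁻ ω', sqMod p ω * sqMod q (splice (J : Set AnyKey) ω' ω)
    ∂(randomTable n) ∂(randomTable n)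

-- With all other states frozen, `p` and `q` are homogeneous polynomials in the state of `x`. The
-- Haar correlation bound is then exactly the price of giving `q` its own independent state for `x`.
set_option maxHeartbeats 400000 in
lemma crossMoment_insert_le {p q : GenTable n → ℂ} (hp : Measurable p) (hq : Measurable q)
    {J : Finset AnyKey} {x : AnyKey} (hxJ : x ∉ J) {a b : ℕ} (hp_hom : HomogeneousAt x a p)
    (hq_hom : HomogeneousAt x b q) :
    ENNReal.ofReal (((2 : ℝ) ^ n x.1 / ((2 : ℝ) ^ n x.1 + a)) ^ b) *
      crossMoment p q (insert x J) ≤ crossMoment p q J := by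
  have hp' := measurable_sqMod hp
  have hq' := measurable_sqMod hq
  have hmeas : Measurable fun z : GenTable n × GenTable n =>
      sqMod p z.1 * sqMod q (splice (J : Set AnyKey) z.2 z.1) :=
    (hp'.comp measurable_fst).mul (hq'.comp ((measurable_splice _).comp measurable_swap))
  have hxJ' : x ∉ (J : Set AnyKey) := by simpa using hxJ
  have hx' : x ∈ ((insert x J : Finset AnyKey) : Set AnyKey) := by simp
  -- Since `x ∉ J`, both factors see the same state of `x`; a single resampled `φ` exposes it.
  have e1 : crossMoment p q J = ∫⁻ ω, ∫⁻ ω', ∫⁻ φ, sqMod p (Function.update ω x φ) *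
      sqMod q (Function.update (splice (J : Set AnyKey) ω' ω) x φ)
      ∂(haarState (n x.1)) ∂(randomTable n) ∂(randomTable n) := by
    simp only [crossMoment]
    rw [lintegral_resample x hmeas.lintegral_prod_right']
    refine lintegral_congr fun ω => ?_
    rw [lintegral_lintegral_swap]
    · simp only [splice_update_right_of_notMem hxJ']
    · refine (hmeas.comp (f := fun z : PureState (n x.1) × GenTable n =>
        (Function.update ω x z.1, z.2)) ?_).aemeasurable
      exact ((measurable_update_table x).comp (measurable_const.prodMk measurable_fst)).prodMk
        measurable_snd
  -- Now `q` takes the state of `x` from `ω'` and `p` takes it from `ω`, so the two are resampled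
  -- separately. `R` collects the average of the `q` factor, which no longer depends on the state of
  -- `x` in `ω`.
  have e2 : crossMoment p q (insert x J) = ∫⁻ ω, ∫⁻ ω', (∫⁻ φ, sqMod p (Function.update ω x φ)
      ∂(haarState (n x.1))) *
      (∫⁻ φ, sqMod q (Function.update (splice (J : Set AnyKey) ω' ω) x φ)
      ∂(haarState (n x.1))) ∂(randomTable n) ∂(randomTable n) := by
    let R : GenTable n → ENNReal := fun ω => ∫⁻ ω', ∫⁻ φ,
      sqMod q (Function.update (splice (J : Set AnyKey) ω' ω) x φ)
      ∂(haarState (n x.1)) ∂(randomTable n)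
    have hu : ∀ (ω ω' : GenTable n) (φ : PureState (n x.1)),
        Function.update (splice ((insert x J : Finset AnyKey) : Set AnyKey) ω' ω) x φ =
          Function.update (splice (J : Set AnyKey) ω' ω) x φ := fun ω ω' φ => by
      funext y
      by_cases hy : y = x
      · subst hy; simp
      · simp [splice, hy]
    have hinner : Measurable fun z : GenTable n × GenTable n => ∫⁻ φ,
        sqMod q (Function.update (splice (J : Set AnyKey) z.2 z.1) x φ) ∂(haarState (n x.1)) := by
      have hm : Measurable fun z : (GenTable n × GenTable n) × PureState (n x.1) =>
          sqMod q (Function.update (splice (J : Set AnyKey) z.1.2 z.1.1) x z.2) :=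
        hq'.comp ((measurable_update_table x).comp
          (((measurable_splice _).comp (measurable_swap.comp measurable_fst)).prodMk
            measurable_snd))
      exact hm.lintegral_prod_right'
    have hR : Measurable R := hinner.lintegral_prod_right'
    have hRx : ∀ ω φ, R (Function.update ω x φ) = R ω := fun ω φ => by
      simp only [R, splice_update_right_of_notMem hxJ', Function.update_idem]
    calc crossMoment p q (insert x J) = ∫⁻ ω, sqMod p ω * R ω ∂(randomTable n) := by
          refine lintegral_congr fun ω => ?_
          have hm : Measurable fun ω' : GenTable n =>
              sqMod q (splice ((insert x J : Finset AnyKey) : Set AnyKey) ω' ω) :=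
            hq'.comp ((measurable_splice _).comp (measurable_id.prodMk measurable_const))
          rw [lintegral_const_mul _ hm, lintegral_resample x hm]
          simp only [splice_update_of_mem hx', hu, R]
      _ = ∫⁻ ω, (∫⁻ φ, sqMod p (Function.update ω x φ) ∂(haarState (n x.1))) * R ω
            ∂(randomTable n) := by
          rw [lintegral_resample x (f := fun ω => sqMod p ω * R ω) (hp'.mul hR)]
          refine lintegral_congr fun ω => ?_
          simp only [hRx]
          rw [lintegral_mul_const]
          exact hp'.comp ((measurable_update_table x).comp
            (measurable_const.prodMk measurable_id))
      _ = _ := by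
          refine lintegral_congr fun ω => ?_
          exact (lintegral_const_mul _ (hinner.comp measurable_prodMk_left)).symm
  rw [e1, e2]
  rw [← lintegral_const_mul']
  · refine lintegral_mono fun ω => ?_
    rw [← lintegral_const_mul' _ _ ENNReal.ofReal_ne_top]
    refine lintegral_mono fun ω' => ?_
    obtain ⟨P, hP, hP'⟩ := hp_hom ω
    obtain ⟨Q, hQ, hQ'⟩ := hq_hom (splice (J : Set AnyKey) ω' ω)
    simp only [sqMod, hP', hQ']
    exact lintegral_haarState_mul_ge hP hQ
  · exact ENNReal.ofReal_ne_top

/-- `crossMoment` interpolates: at `∅` it is the joint moment, and at `K`, where `q` has lost all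
dependence on `ω`, it is the product of the means. Each inserted key costs one factor. -/
lemma lintegral_sqMod_mul_ge {p q : GenTable n → ℂ} (hp : Measurable p) (hq : Measurable q)
    {K : Finset AnyKey} {a b : AnyKey → ℕ} (hpK : ∀ x ∈ K, HomogeneousAt x (a x) p)
    (hqK : ∀ x ∈ K, HomogeneousAt x (b x) q)
    (hdep : ∀ ω ω' : GenTable n, (∀ x ∈ K, ω x = ω' x) → q ω = q ω') :
    (∏ x ∈ K, ENNReal.ofReal (((2 : ℝ) ^ n x.1 / ((2 : ℝ) ^ n x.1 + a x)) ^ b x)) *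
      ((∫⁻ ω, sqMod p ω ∂(randomTable n)) * ∫⁻ ω, sqMod q ω ∂(randomTable n)) ≤
    ∫⁻ ω, sqMod p ω * sqMod q ω ∂(randomTable n) := by
  classical
  have hp' := measurable_sqMod hp
  have hq' := measurable_sqMod hq
  have hind : ∀ J : Finset AnyKey, J ⊆ K →
      (∏ x ∈ J, ENNReal.ofReal (((2 : ℝ) ^ n x.1 / ((2 : ℝ) ^ n x.1 + a x)) ^ b x)) * crossMoment p q J ≤
        crossMoment p q ∅ := by
    intro J
    induction J using Finset.induction_on with
    | empty => simp
    | insert x J hx ih =>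
      intro hJ
      rw [Finset.prod_insert hx, mul_assoc, mul_left_comm]
      refine le_trans ?_ (ih ((Finset.subset_insert x J).trans hJ))
      gcongr
      exact crossMoment_insert_le hp hq hx (hpK x (hJ (Finset.mem_insert_self x J)))
        (hqK x (hJ (Finset.mem_insert_self x J)))
  have h0 : crossMoment p q ∅ = ∫⁻ ω, sqMod p ω * sqMod q ω ∂(randomTable n) := by
    simp only [crossMoment]
    refine lintegral_congr fun ω => ?_
    have : ∀ ω' : GenTable n, splice ((∅ : Finset AnyKey) : Set AnyKey) ω' ω = ω := fun ω' =>
      funext fun y => splice_of_notMem (by simp) _ _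
    simp only [this, lintegral_const, measure_univ, mul_one]
  have hK : crossMoment p q K = (∫⁻ ω, sqMod p ω ∂(randomTable n)) * ∫⁻ ω, sqMod q ω ∂(randomTable n) := by
    simp only [crossMoment]
    rw [← lintegral_mul_const _ hp']
    refine lintegral_congr fun ω => ?_
    rw [← lintegral_const_mul _ hq']
    refine lintegral_congr fun ω' => ?_
    simp only [sqMod]
    rw [hdep (splice (K : Set AnyKey) ω' ω) ω' fun x hx => splice_of_mem (by simpa using hx) _ _]
  rw [← h0, ← hK]
  exact hind K subset_rfl

end Decoupling

/-! ### Trace preservation and isometries. -/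

section Instruments

lemma Instrument.sum_trace_apply {Ω X Y : Type} [Fintype Ω] [Fintype X] [DecidableEq X] [Fintype Y]
    (E : Instrument Ω X Y) (ρ : Matrix X X ℂ) : ∑ o, trace (E.apply o ρ) = trace ρ := by
  simp only [Instrument.apply, trace_sum]
  have h : ∀ o i, trace (E.K o i * ρ * (E.K o i)ᴴ) = trace ((E.K o i)ᴴ * E.K o i * ρ) := fun o i => by
    rw [trace_mul_comm, ← Matrix.mul_assoc]
  simp only [h, ← trace_sum, ← Matrix.sum_mul]
  rw [E.complete, Matrix.one_mul]

lemma genIsometry_isometry {n : ℕ → ℕ} (I : Generator n) (L : ℕ) :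
    (genIsometry I L)ᴴ * genIsometry I L = 1 := by
  ext x x'
  rw [mul_apply, Fintype.sum_sigma, Finset.sum_eq_single x]
  · by_cases h : x = x'
    · subst h
      have h1 : ‖(I x.1 x.2 : EuclideanSpace ℂ (BitString (n x.1)))‖ ^ 2 = 1 := by
        rw [norm_eq_of_mem_sphere, one_pow]
      rw [EuclideanSpace.norm_sq_eq] at h1
      simp only [genIsometry, conjTranspose_apply, if_true, one_apply_eq, RCLike.star_def,
        Complex.conj_mul']
      exact_mod_cast h1
    · simp [genIsometry, h]
  · intro y _ hy
    simp [genIsometry, hy]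
  · simp

lemma answerIsometry_isometry {n : ℕ → ℕ} (I : Generator n) (L : ℕ) (X : Type) [Fintype X]
    [DecidableEq X] (x : Key L) :
    (answerIsometry I L X x)ᴴ * answerIsometry I L X x = 1 := by
  have h := congrFun (congrFun (genIsometry_isometry I L) x) x
  simp only [mul_apply, conjTranspose_apply, one_apply_eq] at h
  ext a a'
  rw [mul_apply, Fintype.sum_prod_type, Finset.sum_eq_single a]
  · by_cases ha : a = a'
    · subst ha
      simpa [answerIsometry] using h
    · simp [answerIsometry, ha]
  · intro y _ hy
    simp [answerIsometry, hy]
  · simp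

end Instruments

/-! ### Product structure of the joint state given the transcript. -/

section Parties

variable {n : ℕ → ℕ} {L : ℕ} {M : Type} [Fintype M] {r : ℕ}

/-- The effect of one round on the memory of a party that sends the message `m`. -/
def Party.round (P : Party n L M r) (I : Generator n) {j : ℕ} (h : Fin j → M × M) (m : M)
    (ρ : Matrix (Fin P.dim) (Fin P.dim) ℂ) : Matrix (Fin P.dim) (Fin P.dim) ℂ :=
  ∑ x, ∑ a, ∑ b, P.roundKraus I h m x a b * ρ * (P.roundKraus I h m x a b)ᴴ

/-- The subnormalized memory of one party after `j` rounds with transcript `h`, where `own` selects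
the message that this party sent. -/
def Party.memory (P : Party n L M r) (I : Generator n) (own : M × M → M) :
    ∀ j : ℕ, (Fin j → M × M) → Matrix (Fin P.dim) (Fin P.dim) ℂ
  | 0, _ => ketbra (Pi.single P.start 1)
  | j + 1, h => P.round I (Fin.init h) (own (h (Fin.last j))) (P.memory I own j (Fin.init h))

lemma ketbra_single_prod {X Y : Type} [DecidableEq X] [DecidableEq Y] (x : X) (y : Y) :
    ketbra (Pi.single (x, y) 1 : X × Y → ℂ) =
      ketbra (Pi.single x 1 : X → ℂ) ⊗ₖ ketbra (Pi.single y 1 : Y → ℂ) := by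
  ext ⟨a, b⟩ ⟨a', b'⟩
  simp only [ketbra, vecMulVec_apply, kroneckerMap_apply, Pi.star_apply, Pi.single_apply,
    Prod.mk.injEq]
  by_cases h1 : a = x <;> by_cases h2 : b = y <;> by_cases h3 : a' = x <;> by_cases h4 : b' = y <;>
    simp [h1, h2, h3, h4]

lemma sum_kronecker {ι X Y : Type} [Fintype ι] (f : ι → Matrix X X ℂ)
    (B : Matrix Y Y ℂ) : (∑ i, f i) ⊗ₖ B = ∑ i, f i ⊗ₖ B := by
  ext ⟨a, b⟩ ⟨a', b'⟩
  simp [Matrix.sum_apply, kroneckerMap_apply, Finset.sum_mul]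

lemma kronecker_sum {ι X Y : Type} [Fintype ι] (A : Matrix X X ℂ) (f : ι → Matrix Y Y ℂ) :
    A ⊗ₖ (∑ i, f i) = ∑ i, A ⊗ₖ f i := by
  ext ⟨a, b⟩ ⟨a', b'⟩
  simp [Matrix.sum_apply, kroneckerMap_apply, Finset.mul_sum]

/-- Conditioned on the transcript, the parties are in a product state. -/
lemma jointState_eq_kronecker (A B : Party n L M r) (I : Generator n) (j : ℕ)
    (h : Fin j → M × M) :
    jointState A B I j h = A.memory I Prod.fst j h ⊗ₖ B.memory I Prod.snd j h := by
  induction j with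
  | zero => exact ketbra_single_prod _ _
  | succ j ih =>
    simp only [jointState, Party.memory, Party.round, ih]
    simp only [sum_kronecker]
    simp only [kronecker_sum, conjTranspose_kronecker, ← mul_kronecker_mul]

/-- The unnormalized probability that a party contributes to transcript `τ` and output `k`. -/
def Party.weight (P : Party n L M r) (I : Generator n) (own : M × M → M) (τ : Fin r → M × M)
    (k : Bool) : ℂ :=
  trace ((P.out τ).apply k (P.memory I own r τ))

lemma trace_outcome (A B : Party n L M r) (I : Generator n) (τ : Fin r → M × M) (kA kB : Bool) :
    trace (∑ a, ∑ b, ((A.out τ).K kA a ⊗ₖ (B.out τ).K kB b) * jointState A B I r τ *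
      ((A.out τ).K kA a ⊗ₖ (B.out τ).K kB b)ᴴ) =
      A.weight I Prod.fst τ kA * B.weight I Prod.snd τ kB := by
  rw [Party.weight, Party.weight, ← trace_kronecker, Instrument.apply, Instrument.apply,
    sum_kronecker]
  simp only [kronecker_sum, jointState_eq_kronecker, conjTranspose_kronecker, ← mul_kronecker_mul]

lemma sum_trace_round (P : Party n L M r) (I : Generator n) {j : ℕ} (h : Fin j → M × M)
    (ρ : Matrix (Fin P.dim) (Fin P.dim) ℂ) : ∑ m, trace (P.round I h m ρ) = trace ρ := by
  have h1 : ∀ m, trace (P.round I h m ρ) = ∑ x, trace ((P.send j h).apply m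
      (answerIsometry I L (Fin P.dim) x * (P.query j h).apply x ρ *
        (answerIsometry I L (Fin P.dim) x)ᴴ)) := by
    intro m
    simp only [Party.round, Instrument.apply, Matrix.mul_sum, Matrix.sum_mul, trace_sum]
    refine Finset.sum_congr rfl fun x _ => ?_
    rw [Finset.sum_comm]
    refine Finset.sum_congr rfl fun b _ => Finset.sum_congr rfl fun a _ => ?_
    simp only [Party.roundKraus, conjTranspose_mul, Matrix.mul_assoc]
  simp only [h1]
  rw [Finset.sum_comm]
  simp only [Instrument.sum_trace_apply]
  rw [← (P.query j h).sum_trace_apply ρ]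
  refine Finset.sum_congr rfl fun x _ => ?_
  rw [trace_mul_comm, ← Matrix.mul_assoc, answerIsometry_isometry, Matrix.one_mul]

lemma sum_transcripts_succ {V : Type} [AddCommMonoid V] {j : ℕ} {T : Type} [Fintype T]
    (f : (Fin j → T) → T → V) :
    ∑ h : Fin (j + 1) → T, f (Fin.init h) (h (Fin.last j)) = ∑ h, ∑ t, f h t := by
  rw [← Fintype.sum_prod_type']
  symm
  refine Fintype.sum_equiv ((Equiv.prodComm _ _).trans (Fin.snocEquiv fun _ => T)) _ _ fun p => ?_
  simp [Fin.snocEquiv]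

/-- For a fixed history, each party's round preserves the trace once its own message is summed out.
Nothing links the two generators, which is what allows a decoupled execution to be treated as a
probability distribution. -/
lemma sum_trace_memory (A B : Party n L M r) (I I' : Generator n) (j : ℕ) :
    ∑ h, trace (A.memory I Prod.fst j h) * trace (B.memory I' Prod.snd j h) = 1 := by
  induction j with
  | zero => simp [Party.memory, ketbra, trace_vecMulVec]
  | succ j ih =>
    simp only [Party.memory]
    rw [sum_transcripts_succ fun h (t : M × M) =>
      trace (A.round I h t.1 (A.memory I Prod.fst j h)) *
      trace (B.round I' h t.2 (B.memory I' Prod.snd j h)), ← ih]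
    refine Finset.sum_congr rfl fun h _ => ?_
    rw [Fintype.sum_prod_type, ← sum_trace_round A I h, ← sum_trace_round B I' h,
      Finset.sum_mul_sum]

/-- The total probability is one, even if the parties use different generators. -/
lemma sum_weight_mul_weight (A B : Party n L M r) (I I' : Generator n) :
    ∑ τ, ∑ kA, ∑ kB, A.weight I Prod.fst τ kA * B.weight I' Prod.snd τ kB = 1 := by
  rw [← sum_trace_memory A B I I' r]
  refine Finset.sum_congr rfl fun τ _ => ?_
  rw [← Finset.sum_mul_sum]
  simp only [Party.weight, Instrument.sum_trace_apply]

end Parties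

/-! ### Functions of the generator that are homogeneous in each state. -/

section MultiHomogeneous

variable {n : ℕ → ℕ}

/-- `p` is a polynomial in the states of keys of length at most `L`, homogeneous of degree `deg x`
in the state of each key `x`. -/
structure MultiHomogeneous (L : ℕ) (deg : AnyKey → ℕ) (p : GenTable n → ℂ) : Prop where
  measurable : Measurable p
  homogeneousAt : ∀ x, HomogeneousAt x (deg x) p
  congr_of_eq : ∀ ω ω' : GenTable n, (∀ x : AnyKey, x.1 ≤ L → ω x = ω' x) → p ω = p ω'

namespace MultiHomogeneous

variable {L : ℕ} {deg deg' : AnyKey → ℕ} {p q : GenTable n → ℂ}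

lemma const (L : ℕ) (c : ℂ) : MultiHomogeneous (n := n) L 0 fun _ => c where
  measurable := measurable_const
  homogeneousAt _ _ := ⟨MvPolynomial.C c, MvPolynomial.isHomogeneous_C _ _, fun _ => by simp⟩
  congr_of_eq _ _ _ := rfl

lemma mul (hp : MultiHomogeneous L deg p) (hq : MultiHomogeneous L deg' q) :
    MultiHomogeneous L (deg + deg') fun ω => p ω * q ω where
  measurable := hp.measurable.mul hq.measurable
  homogeneousAt x ω := by
    obtain ⟨P, hP, hP'⟩ := hp.homogeneousAt x ω
    obtain ⟨Q, hQ, hQ'⟩ := hq.homogeneousAt x ω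
    exact ⟨P * Q, hP.mul hQ, fun φ => by simp only [hP', hQ', map_mul]⟩
  congr_of_eq ω ω' h := by rw [hp.congr_of_eq ω ω' h, hq.congr_of_eq ω ω' h]

lemma const_mul (c : ℂ) (hp : MultiHomogeneous L deg p) :
    MultiHomogeneous L deg fun ω => c * p ω := by
  simpa using (const L c).mul hp

lemma sum {ι : Type} [Fintype ι] {p : ι → GenTable n → ℂ}
    (hp : ∀ i, MultiHomogeneous L deg (p i)) :
    MultiHomogeneous L deg fun ω => ∑ i, p i ω where
  measurable := Finset.measurable_sum _ fun i _ => (hp i).measurable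
  homogeneousAt x ω := by
    choose P hP hP' using fun i => (hp i).homogeneousAt x ω
    exact ⟨∑ i, P i, MvPolynomial.IsHomogeneous.sum _ _ _ fun i _ => hP i,
      fun φ => by simp only [hP', map_sum]⟩
  congr_of_eq ω ω' h := Finset.sum_congr rfl fun i _ => (hp i).congr_of_eq ω ω' h

lemma coordinate {x : AnyKey} (hx : x.1 ≤ L) (y : BitString (n x.1)) :
    MultiHomogeneous L (Pi.single x 1) fun ω : GenTable n =>
      (ω x : EuclideanSpace ℂ (BitString (n x.1))) y where
  measurable := by fun_prop
  homogeneousAt z ω := by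
    by_cases h : z = x
    · subst h
      exact ⟨MvPolynomial.X y, by simpa using MvPolynomial.isHomogeneous_X _ _,
        fun φ => by simp⟩
    · refine ⟨MvPolynomial.C ((ω x : EuclideanSpace ℂ (BitString (n x.1))) y), ?_, fun φ => ?_⟩
      · simpa [h] using MvPolynomial.isHomogeneous_C _ _
      · simp [Function.update_of_ne (Ne.symm h)]
  congr_of_eq ω ω' h := by rw [h x hx]

end MultiHomogeneous

end MultiHomogeneous

/-! ### Outcome weights as sums of squared moduli of homogeneous polynomials. -/

section SumOfSquares

variable {n : ℕ → ℕ} {L : ℕ} {M : Type} [Fintype M] {r : ℕ}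

/-- A bounded-length key as a key. -/
abbrev Key.toAny (x : Key L) : AnyKey := ⟨x.1, x.2⟩

lemma Key.toAny_length_le (x : Key L) : x.toAny.1 ≤ L := Nat.lt_succ_iff.1 x.1.2

lemma roundKraus_apply (P : Party n L M r) (ω : GenTable n) {j : ℕ} (h : Fin j → M × M) (m : M)
    (x : Key L) (a : Fin (P.query j h).size) (b : Fin (P.send j h).size) (i i' : Fin P.dim) :
    P.roundKraus ω.gen h m x a b i i' =
      ∑ y : BitString (n x.1), (∑ d, (P.send j h).K m b i (d, ⟨x, y⟩) * (P.query j h).K x a d i') *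
        (ω ⟨x.1, x.2⟩ : EuclideanSpace ℂ (BitString (n x.1))) y := by
  have h1 : ∀ d, ((P.send j h).K m b * answerIsometry ω.gen L (Fin P.dim) x) i d =
      ∑ y : BitString (n x.1), (P.send j h).K m b i (d, ⟨x, y⟩) *
        (ω ⟨x.1, x.2⟩ : EuclideanSpace ℂ (BitString (n x.1))) y := by
    intro d
    rw [mul_apply, Fintype.sum_prod_type, Finset.sum_eq_single d, Fintype.sum_sigma,
      Finset.sum_eq_single x]
    · refine Finset.sum_congr rfl fun y _ => ?_
      simp [answerIsometry, genIsometry, GenTable.gen]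
    · intro x' _ hx'
      simp [answerIsometry, genIsometry, hx']
    · simp
    · intro d' _ hd'
      simp [answerIsometry, hd']
    · simp
  rw [Party.roundKraus, mul_apply]
  simp only [h1, Finset.sum_mul]
  rw [Finset.sum_comm]
  exact Finset.sum_congr rfl fun y _ => Finset.sum_congr rfl fun d _ => by ring

/-- This is where classical queries matter: a branch has a definite key `x`, so its Kraus operator
is linear in the state of that key. A superposition of keys would give a sum of terms of different
multidegrees. -/
lemma multiHomogeneous_roundKraus (P : Party n L M r) {j : ℕ} (h : Fin j → M × M) (m : M)
    (x : Key L) (a : Fin (P.query j h).size) (b : Fin (P.send j h).size) (i i' : Fin P.dim) :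
    MultiHomogeneous L (Pi.single x.toAny 1) fun ω : GenTable n =>
      P.roundKraus ω.gen h m x a b i i' := by
  simp only [roundKraus_apply]
  exact MultiHomogeneous.sum fun y =>
    (MultiHomogeneous.coordinate (x := x.toAny) x.toAny_length_le y).const_mul _

lemma mul_ketbra_mul_conjTranspose {X Y : Type} [Fintype X] (R : Matrix Y X ℂ) (v : X → ℂ) :
    R * ketbra v * Rᴴ = ketbra (R *ᵥ v) := by
  rw [ketbra, mul_vecMulVec, vecMulVec_mul, ketbra, star_mulVec]

/-- The memory of a party is a sum of pure states, with amplitudes that are homogeneous polynomials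
in the answers to its queries. -/
lemma exists_memory_eq_sum_ketbra (P : Party n L M r) (own : M × M → M) (j : ℕ)
    (h : Fin j → M × M) :
    ∃ (ι : Type) (_ : Fintype ι) (v : ι → GenTable n → Fin P.dim → ℂ) (deg : ι → AnyKey → ℕ),
      (∀ ω : GenTable n, P.memory ω.gen own j h = ∑ u, ketbra (v u ω)) ∧
      (∀ u i, MultiHomogeneous L (deg u) fun ω => v u ω i) ∧
      ∀ u (K : Finset AnyKey), ∑ x ∈ K, deg u x ≤ j := by
  induction j with
  | zero =>
    exact ⟨Unit, inferInstance, fun _ _ => Pi.single P.start 1, fun _ => 0,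
      fun ω => by simp [Party.memory], fun _ i => MultiHomogeneous.const L _, by simp⟩
  | succ j ih =>
    obtain ⟨ι, _, v, deg, h1, h2, h3⟩ := ih (Fin.init h)
    set g := Fin.init h
    set m := own (h (Fin.last j))
    -- A branch is refined by the key asked and the two Kraus indices of the new round. Its
    -- multidegree counts how often each key was asked, so its total grows by at most one per round.
    refine ⟨(Key L × Fin (P.query j g).size × Fin (P.send j g).size) × ι, inferInstance,
      fun u ω => P.roundKraus ω.gen g m u.1.1 u.1.2.1 u.1.2.2 *ᵥ v u.2 ω,
      fun u => Pi.single u.1.1.toAny 1 + deg u.2, fun ω => ?_, fun u i => ?_, fun u K => ?_⟩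
    · simp only [Party.memory, Party.round]
      rw [h1 ω]
      simp only [Fintype.sum_prod_type, Matrix.mul_sum, Matrix.sum_mul,
        mul_ketbra_mul_conjTranspose]
      rfl
    · exact MultiHomogeneous.sum fun i' =>
        (multiHomogeneous_roundKraus P g m _ _ _ i i').mul (h2 u.2 i')
    · simp only [Pi.add_apply, Finset.sum_add_distrib]
      have : ∑ x ∈ K, (Pi.single u.1.1.toAny 1 : AnyKey → ℕ) x ≤ 1 := by
        rw [Finset.sum_pi_single']; split_ifs <;> simp
      have := h3 u.2 K
      omega

/-- The output measurement acts linearly on the amplitudes and makes no query, so the degrees are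
those of the memory. -/
lemma exists_weight_eq_sum_normSq (P : Party n L M r) (own : M × M → M) (τ : Fin r → M × M)
    (k : Bool) :
    ∃ (ι : Type) (_ : Fintype ι) (p : ι → GenTable n → ℂ) (deg : ι → AnyKey → ℕ),
      (∀ ω : GenTable n, P.weight ω.gen own τ k = ((∑ u, ‖p u ω‖ ^ 2 : ℝ) : ℂ)) ∧
      (∀ u, MultiHomogeneous L (deg u) (p u)) ∧
      ∀ u (K : Finset AnyKey), ∑ x ∈ K, deg u x ≤ r := by
  obtain ⟨ι, _, v, deg, h1, h2, h3⟩ := exists_memory_eq_sum_ketbra P own r τ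
  refine ⟨Fin (P.out τ).size × ι, inferInstance,
    fun u ω => ((P.out τ).K k u.1 *ᵥ v u.2 ω) (), fun u => deg u.2, fun ω => ?_, fun u => ?_,
    fun u => h3 u.2⟩
  · rw [Party.weight, Instrument.apply, h1]
    simp only [Matrix.mul_sum, Matrix.sum_mul, mul_ketbra_mul_conjTranspose, trace_sum,
      Fintype.sum_prod_type]
    push_cast
    refine Finset.sum_congr rfl fun a _ => Finset.sum_congr rfl fun u _ => ?_
    rw [← Complex.mul_conj']
    simp [ketbra, trace, vecMulVec_apply]
  · exact MultiHomogeneous.sum fun i => (h2 u.2 i).const_mul _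

end SumOfSquares

/-! ### Decoupled executions and the prediction of Bob's output. -/

section Weights

variable {n : ℕ → ℕ} {L : ℕ} {M : Type} [Fintype M] {r : ℕ}

/-- The weight of a party as a function of the table of the generator. -/
def Party.wt (P : Party n L M r) (own : M × M → M) (τ : Fin r → M × M) (k : Bool)
    (ω : GenTable n) : ENNReal :=
  ENNReal.ofReal (P.weight ω.gen own τ k).re

lemma exists_wt_eq_sum_sqMod (P : Party n L M r) (own : M × M → M) (τ : Fin r → M × M)
    (k : Bool) :
    ∃ (ι : Type) (_ : Fintype ι) (p : ι → GenTable n → ℂ) (deg : ι → AnyKey → ℕ),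
      (∀ ω : GenTable n, P.wt own τ k ω = ∑ u, sqMod (p u) ω) ∧
      (∀ u, MultiHomogeneous L (deg u) (p u)) ∧
      ∀ u (K : Finset AnyKey), ∑ x ∈ K, deg u x ≤ r := by
  obtain ⟨ι, _, p, deg, h1, h2, h3⟩ := exists_weight_eq_sum_normSq P own τ k
  refine ⟨ι, inferInstance, p, deg, fun ω => ?_, h2, h3⟩
  rw [Party.wt, h1, Complex.ofReal_re, ENNReal.ofReal_sum_of_nonneg fun _ _ => sq_nonneg _]
  rfl

lemma measurable_wt (P : Party n L M r) (own : M × M → M) (τ : Fin r → M × M) (k : Bool) :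
    Measurable (P.wt own τ k) := by
  obtain ⟨ι, _, p, deg, h1, h2, -⟩ := exists_wt_eq_sum_sqMod P own τ k
  rw [funext h1]
  exact Finset.measurable_sum _ fun u _ => measurable_sqMod (h2 u).measurable

lemma weight_eq_ofReal_re (P : Party n L M r) (own : M × M → M) (τ : Fin r → M × M) (k : Bool)
    (ω : GenTable n) :
    0 ≤ (P.weight ω.gen own τ k).re ∧
      P.weight ω.gen own τ k = ((P.weight ω.gen own τ k).re : ℂ) := by
  obtain ⟨ι, _, p, deg, h1, -, -⟩ := exists_weight_eq_sum_normSq P own τ k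
  rw [h1, Complex.ofReal_re]
  exact ⟨Finset.sum_nonneg fun _ _ => sq_nonneg _, rfl⟩

lemma outcomeProb_eq_mul (A B : Party n L M r) (ω : GenTable n) (τ : Fin r → M × M)
    (kA kB : Bool) :
    outcomeProb A B ω.gen τ kA kB =
      (A.weight ω.gen Prod.fst τ kA).re * (B.weight ω.gen Prod.snd τ kB).re := by
  rw [outcomeProb, trace_outcome, (weight_eq_ofReal_re A Prod.fst τ kA ω).2,
    (weight_eq_ofReal_re B Prod.snd τ kB ω).2, ← Complex.ofReal_mul, Complex.ofReal_re,
    Complex.ofReal_re, Complex.ofReal_re]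

lemma outcomeProb_nonneg (A B : Party n L M r) (ω : GenTable n) (τ : Fin r → M × M)
    (kA kB : Bool) : 0 ≤ outcomeProb A B ω.gen τ kA kB := by
  rw [outcomeProb_eq_mul]
  exact mul_nonneg (weight_eq_ofReal_re ..).1 (weight_eq_ofReal_re ..).1

lemma ofReal_outcomeProb (A B : Party n L M r) (ω : GenTable n) (τ : Fin r → M × M)
    (kA kB : Bool) :
    ENNReal.ofReal (outcomeProb A B ω.gen τ kA kB) =
      A.wt Prod.fst τ kA ω * B.wt Prod.snd τ kB ω := by
  rw [outcomeProb_eq_mul, ENNReal.ofReal_mul (weight_eq_ofReal_re ..).1]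
  rfl

lemma measurable_outcomeProb (A B : Party n L M r) (τ : Fin r → M × M) (kA kB : Bool) :
    Measurable fun ω : GenTable n => outcomeProb A B ω.gen τ kA kB := by
  have h : (fun ω : GenTable n => outcomeProb A B ω.gen τ kA kB) =
      fun ω => (A.wt Prod.fst τ kA ω * B.wt Prod.snd τ kB ω).toReal := by
    funext ω
    rw [← ofReal_outcomeProb, ENNReal.toReal_ofReal (outcomeProb_nonneg ..)]
  rw [h]
  exact ((measurable_wt A ..).mul (measurable_wt B ..)).ennreal_toReal

lemma sum_outcomeProb (A B : Party n L M r) (ω : GenTable n) :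
    ∑ τ, ∑ kA, ∑ kB, outcomeProb A B ω.gen τ kA kB = 1 := by
  have h := sum_weight_mul_weight A B ω.gen ω.gen
  apply Complex.ofReal_injective
  push_cast
  rw [← h]
  refine Finset.sum_congr rfl fun τ _ => Finset.sum_congr rfl fun kA _ =>
    Finset.sum_congr rfl fun kB _ => ?_
  rw [outcomeProb_eq_mul, Complex.ofReal_mul, ← (weight_eq_ofReal_re A Prod.fst τ kA ω).2,
    ← (weight_eq_ofReal_re B Prod.snd τ kB ω).2]

lemma sum_wt_mul_wt (A B : Party n L M r) (ω ω' : GenTable n) :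
    ∑ τ, ∑ kA, ∑ kB, A.wt Prod.fst τ kA ω * B.wt Prod.snd τ kB ω' = 1 := by
  have h := sum_weight_mul_weight A B ω.gen ω'.gen
  have h1 : ∑ τ, ∑ kA, ∑ kB, (A.weight ω.gen Prod.fst τ kA).re *
      (B.weight ω'.gen Prod.snd τ kB).re = 1 := by
    apply Complex.ofReal_injective
    push_cast
    rw [← h]
    refine Finset.sum_congr rfl fun τ _ => Finset.sum_congr rfl fun kA _ =>
      Finset.sum_congr rfl fun kB _ => ?_
    rw [← (weight_eq_ofReal_re A Prod.fst τ kA ω).2, ← (weight_eq_ofReal_re B Prod.snd τ kB ω').2]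
  have h0 : ∀ τ kA kB, 0 ≤ (A.weight ω.gen Prod.fst τ kA).re *
      (B.weight ω'.gen Prod.snd τ kB).re := fun τ kA kB =>
    mul_nonneg (weight_eq_ofReal_re ..).1 (weight_eq_ofReal_re ..).1
  have h2 := congrArg ENNReal.ofReal h1
  rw [ENNReal.ofReal_one, ENNReal.ofReal_sum_of_nonneg fun τ _ => Finset.sum_nonneg fun _ _ =>
    Finset.sum_nonneg fun _ _ => h0 ..] at h2
  rw [← h2]
  refine Finset.sum_congr rfl fun τ _ => ?_
  rw [ENNReal.ofReal_sum_of_nonneg fun _ _ => Finset.sum_nonneg fun _ _ => h0 ..]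
  refine Finset.sum_congr rfl fun kA _ => ?_
  rw [ENNReal.ofReal_sum_of_nonneg fun _ _ => h0 ..]
  refine Finset.sum_congr rfl fun kB _ => ?_
  rw [ENNReal.ofReal_mul (weight_eq_ofReal_re ..).1]
  rfl

/-- The weight of a party, averaged over the states of the keys outside `s`. -/
def Party.avgWt (P : Party n L M r) (own : M × M → M) (s : Set AnyKey) (τ : Fin r → M × M)
    (k : Bool) (ω : GenTable n) : ENNReal :=
  ∫⁻ ω', P.wt own τ k (splice s ω ω') ∂(randomTable n)

lemma measurable_splice_right (s : Set AnyKey) (ω : GenTable n) :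
    Measurable fun ω' : GenTable n => splice s ω ω' :=
  (measurable_splice s).comp measurable_prodMk_left

lemma measurable_avgWt (P : Party n L M r) (own : M × M → M) (s : Set AnyKey)
    (τ : Fin r → M × M) (k : Bool) : Measurable (P.avgWt own s τ k) :=
  ((measurable_wt P own τ k).comp (measurable_splice s)).lintegral_prod_right'

/-- Freezing the states in `s` turns them into coefficients and leaves the degree in every other
state unchanged. Conditioning on the low-dimensional states is thus compatible with decoupling. -/
lemma MultiHomogeneous.homogeneousAt_splice {deg : AnyKey → ℕ} {p : GenTable n → ℂ}
    (hp : MultiHomogeneous L deg p) {s : Set AnyKey} {x : AnyKey} (hx : x ∉ s) (ω : GenTable n) :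
    HomogeneousAt x (deg x) fun ω' => p (splice s ω ω') := fun ω' => by
  obtain ⟨P, hP, hP'⟩ := hp.homogeneousAt x (splice s ω ω')
  exact ⟨P, hP, fun φ => by simp only [splice_update_right_of_notMem hx, hP']⟩

/-- If all keys outside `s` have high-dimensional states, then the parties are almost positively
correlated given the states of the keys in `s`. -/
lemma avgWt_mul_avgWt_le (A B : Party n L M r) {s : Set AnyKey} {D : ℝ} (hD : 0 < D)
    (hs : ∀ x ∉ s, D ≤ 2 ^ n x.1) (τ : Fin r → M × M) (kA kB : Bool) (ω : GenTable n) :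
    ENNReal.ofReal ((D / (D + r)) ^ r) *
      (A.avgWt Prod.fst s τ kA ω * B.avgWt Prod.snd s τ kB ω) ≤
    ∫⁻ ω', A.wt Prod.fst τ kA (splice s ω ω') * B.wt Prod.snd τ kB (splice s ω ω')
      ∂(randomTable n) := by
  classical
  obtain ⟨ι, _, p, a, hp1, hp2, hp3⟩ := exists_wt_eq_sum_sqMod A Prod.fst τ kA
  obtain ⟨κ, _, q, b, hq1, hq2, hq3⟩ := exists_wt_eq_sum_sqMod B Prod.snd τ kB
  have hpm : ∀ u, Measurable fun ω' => p u (splice s ω ω') := fun u =>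
    (hp2 u).measurable.comp (measurable_splice_right s ω)
  have hqm : ∀ u, Measurable fun ω' => q u (splice s ω ω') := fun u =>
    (hq2 u).measurable.comp (measurable_splice_right s ω)
  have hpm' : ∀ u, Measurable fun ω' => sqMod (p u) (splice s ω ω') := fun u =>
    measurable_sqMod (hpm u)
  have hqm' : ∀ u, Measurable fun ω' => sqMod (q u) (splice s ω ω') := fun u =>
    measurable_sqMod (hqm u)
  -- Once the states in `s` are fixed, these finitely many keys are all that Bob's amplitudes can
  -- depend on.
  let K : Finset AnyKey := (Finset.univ.image (Key.toAny (L := L))).filter (· ∉ s)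
  have key : ∀ u v, ENNReal.ofReal ((D / (D + r)) ^ r) *
      ((∫⁻ ω', sqMod (p u) (splice s ω ω') ∂(randomTable n)) *
        ∫⁻ ω', sqMod (q v) (splice s ω ω') ∂(randomTable n)) ≤
      ∫⁻ ω', sqMod (p u) (splice s ω ω') * sqMod (q v) (splice s ω ω') ∂(randomTable n) := by
    intro u v
    have hKs : ∀ x ∈ K, x ∉ s := fun x hx => (Finset.mem_filter.1 hx).2
    have h := lintegral_sqMod_mul_ge (hpm u) (hqm v) (K := K) (a := a u) (b := b v)
      (fun x hx => (hp2 u).homogeneousAt_splice (hKs x hx) ω)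
      (fun x hx => (hq2 v).homogeneousAt_splice (hKs x hx) ω)
      (fun ω₁ ω₂ h12 => (hq2 v).congr_of_eq _ _ fun x hx => by
        by_cases hxs : x ∈ s
        · rw [splice_of_mem hxs, splice_of_mem hxs]
        · rw [splice_of_notMem hxs, splice_of_notMem hxs]
          refine h12 x (Finset.mem_filter.2 ⟨Finset.mem_image.2 ?_, hxs⟩)
          exact ⟨⟨⟨x.1, Nat.lt_succ_iff.2 hx⟩, x.2⟩, Finset.mem_univ _, rfl⟩)
    refine le_trans ?_ h
    gcongr
    · rw [← ENNReal.ofReal_prod_of_nonneg fun _ _ => by positivity]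
      refine ENNReal.ofReal_le_ofReal ?_
      -- Bob's total degree bounds the exponent and Alice's degree at each single key is at most
      -- `r`, so the loss is independent of the number of keys in `K`.
      have hle1 : D / (D + r) ≤ 1 := div_le_one_of_le₀ (by simp) (by positivity)
      calc (D / (D + r)) ^ r ≤ (D / (D + r)) ^ (∑ x ∈ K, b v x) :=
            pow_le_pow_of_le_one (by positivity) hle1 (hq3 v K)
        _ = ∏ x ∈ K, (D / (D + r)) ^ b v x := (Finset.prod_pow_eq_pow_sum ..).symm
        _ ≤ _ := by
            refine Finset.prod_le_prod (fun _ _ => by positivity) fun x hx => ?_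
            refine pow_le_pow_left₀ (by positivity) ?_ _
            have h1 : (a u x : ℝ) ≤ r := by
              have := hp3 u {x}
              rw [Finset.sum_singleton] at this
              exact_mod_cast this
            have h2 := hs x (hKs x hx)
            rw [div_le_div_iff₀ (by positivity) (by positivity)]
            have : D * a u x ≤ (2 : ℝ) ^ n x.1 * r := by gcongr
            linarith
    · exact le_rfl
    · exact le_rfl
  simp only [Party.avgWt, hp1, hq1]
  rw [lintegral_finsetSum _ fun u _ => hpm' u, lintegral_finsetSum _ fun v _ => hqm' v,
    Finset.sum_mul_sum, Finset.mul_sum]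
  have hm : ∀ u v, Measurable fun ω' =>
      sqMod (p u) (splice s ω ω') * sqMod (q v) (splice s ω ω') := fun u v =>
    (hpm' u).mul (hqm' v)
  have hR : ∀ ω', (∑ u, sqMod (p u) (splice s ω ω')) * ∑ v, sqMod (q v) (splice s ω ω') =
      ∑ u, ∑ v, sqMod (p u) (splice s ω ω') * sqMod (q v) (splice s ω ω') := fun ω' =>
    Finset.sum_mul_sum ..
  simp only [hR]
  rw [lintegral_finsetSum _ fun u _ => Finset.measurable_sum _ fun v _ => hm u v]
  refine Finset.sum_le_sum fun u _ => ?_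
  rw [lintegral_finsetSum _ fun v _ => hm u v, Finset.mul_sum]
  exact Finset.sum_le_sum fun v _ => key u v

/-- Resampling the states of the keys outside `s`. -/
lemma lintegral_splice (s : Set AnyKey) {f : GenTable n → ENNReal} (hf : Measurable f) :
    ∫⁻ ω, f ω ∂(randomTable n) =
      ∫⁻ ω, ∫⁻ ω', f (splice s ω ω') ∂(randomTable n) ∂(randomTable n) := by
  rw [← (measurePreserving_splice s).lintegral_comp hf, lintegral_prod]
  exact (hf.comp (measurable_splice s)).aemeasurable

lemma splice_splice (s : Set AnyKey) (ω ω' ω'' : GenTable n) :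
    splice s (splice s ω ω') ω'' = splice s ω ω'' := by
  funext x
  by_cases hx : x ∈ s <;> simp [splice, hx]

lemma avgWt_splice (P : Party n L M r) (own : M × M → M) (s : Set AnyKey) (τ : Fin r → M × M)
    (k : Bool) (ω ω' : GenTable n) : P.avgWt own s τ k (splice s ω ω') = P.avgWt own s τ k ω := by
  simp only [Party.avgWt, splice_splice]

lemma avgWt_update (P : Party n L M r) (own : M × M → M) {s : Set AnyKey} (τ : Fin r → M × M)
    (k : Bool) (ω : GenTable n) {x : AnyKey} (hx : x ∉ s) (φ : PureState (n x.1)) :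
    P.avgWt own s τ k (Function.update ω x φ) = P.avgWt own s τ k ω := by
  simp only [Party.avgWt, splice_update_of_notMem hx]

/-- The summands are outcome probabilities of an execution whose parties use generators that agree
on `s` and are independent elsewhere. -/
lemma sum_avgWt_mul_avgWt (A B : Party n L M r) (s : Set AnyKey) (ω : GenTable n) :
    ∑ τ, ∑ kA, ∑ kB, A.avgWt Prod.fst s τ kA ω * B.avgWt Prod.snd s τ kB ω = 1 := by
  have hA : ∀ τ k, Measurable fun ω' => A.wt Prod.fst τ k (splice s ω ω') := fun τ k =>
    (measurable_wt A ..).comp (measurable_splice_right s ω)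
  have hB : ∀ τ k, Measurable fun ω' => B.wt Prod.snd τ k (splice s ω ω') := fun τ k =>
    (measurable_wt B ..).comp (measurable_splice_right s ω)
  have h1 : ∀ τ kA kB, A.avgWt Prod.fst s τ kA ω * B.avgWt Prod.snd s τ kB ω =
      ∫⁻ z, A.wt Prod.fst τ kA (splice s ω z.1) * B.wt Prod.snd τ kB (splice s ω z.2)
        ∂((randomTable n).prod (randomTable n)) := fun τ kA kB =>
    (lintegral_prod_mul (hA τ kA).aemeasurable (hB τ kB).aemeasurable).symm
  have hm : ∀ τ kA kB, Measurable fun z : GenTable n × GenTable n =>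
      A.wt Prod.fst τ kA (splice s ω z.1) * B.wt Prod.snd τ kB (splice s ω z.2) :=
    fun τ kA kB => ((hA τ kA).comp measurable_fst).mul ((hB τ kB).comp measurable_snd)
  simp only [h1]
  simp_rw [← lintegral_finsetSum _ fun kB _ => hm _ _ kB]
  simp_rw [← lintegral_finsetSum _ fun kA _ => Finset.measurable_sum _ fun kB _ => hm _ kA kB]
  rw [← lintegral_finsetSum _ fun τ _ => Finset.measurable_sum _ fun kA _ =>
    Finset.measurable_sum _ fun kB _ => hm τ kA kB]
  simp only [sum_wt_mul_wt, lintegral_const, measure_univ, mul_one]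

open Classical in
/-- The more likely output of a party on transcript `τ`, given the states of the keys in `s`. -/
def Party.guess (P : Party n L M r) (own : M × M → M) (s : Set AnyKey) (ω : GenTable n)
    (τ : Fin r → M × M) : Bool :=
  decide (P.avgWt own s τ false ω ≤ P.avgWt own s τ true ω)

lemma avgWt_le_guess (P : Party n L M r) (own : M × M → M) (s : Set AnyKey) (ω : GenTable n)
    (τ : Fin r → M × M) (k : Bool) :
    P.avgWt own s τ k ω ≤ P.avgWt own s τ (P.guess own s ω τ) ω := by
  unfold Party.guess
  by_cases h : P.avgWt own s τ false ω ≤ P.avgWt own s τ true ω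
  · rw [decide_eq_true h]; cases k <;> simp [h]
  · rw [decide_eq_false h]
    cases k
    · exact le_rfl
    · exact (not_le.1 h).le

lemma measurable_guess (P : Party n L M r) (own : M × M → M) (s : Set AnyKey)
    (τ : Fin r → M × M) : Measurable fun ω => P.guess own s ω τ := by
  unfold Party.guess
  refine measurable_to_bool ?_
  have : (fun ω => decide (P.avgWt own s τ false ω ≤ P.avgWt own s τ true ω)) ⁻¹' {true} =
      {ω | P.avgWt own s τ false ω ≤ P.avgWt own s τ true ω} := by
    ext ω; simp
  rw [this]
  exact measurableSet_le (measurable_avgWt ..) (measurable_avgWt ..)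

/-- Guessing Bob's output from the transcript succeeds unless the parties disagree. -/
lemma le_lintegral_guess_add_disagree (A B : Party n L M r) {s : Set AnyKey} {D : ℝ} (hD : 0 < D)
    (hs : ∀ x ∉ s, D ≤ 2 ^ n x.1) :
    ENNReal.ofReal ((D / (D + r)) ^ r) ≤
      (∫⁻ ω, ∑ τ, ∑ k, A.wt Prod.fst τ k ω * B.wt Prod.snd τ (B.guess Prod.snd s ω τ) ω
        ∂(randomTable n)) +
      ∫⁻ ω, ∑ τ, ∑ k, A.wt Prod.fst τ k ω * B.wt Prod.snd τ (!k) ω ∂(randomTable n) := by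
  have hA : ∀ τ k, Measurable (A.wt Prod.fst τ k) := fun τ k => measurable_wt A ..
  have hB : ∀ τ k, Measurable (B.wt Prod.snd τ k) := fun τ k => measurable_wt B ..
  have hG : ∀ τ, Measurable fun ω => B.wt Prod.snd τ (B.guess Prod.snd s ω τ) ω := by
    intro τ
    have : (fun ω => B.wt Prod.snd τ (B.guess Prod.snd s ω τ) ω) =
        fun ω => if B.guess Prod.snd s ω τ = true then B.wt Prod.snd τ true ω
          else B.wt Prod.snd τ false ω := by
      funext ω; cases h : B.guess Prod.snd s ω τ <;> simp
    rw [this]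
    exact Measurable.ite (measurable_guess B Prod.snd s τ (measurableSet_singleton true))
      (hB τ true) (hB τ false)
  have hF : Measurable fun ω => (∑ τ, ∑ k, A.wt Prod.fst τ k ω *
      B.wt Prod.snd τ (B.guess Prod.snd s ω τ) ω) := by
    refine Finset.measurable_sum _ fun τ _ => Finset.measurable_sum _ fun k _ => ?_
    exact (hA τ k).mul (hG τ)
  have hF' : Measurable fun ω => ∑ τ, ∑ k, A.wt Prod.fst τ k ω * B.wt Prod.snd τ (!k) ω := by
    refine Finset.measurable_sum _ fun τ _ => Finset.measurable_sum _ fun k _ => ?_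
    exact (hA τ k).mul (hB τ _)
  have hFF : Measurable fun ω => (∑ τ, ∑ k, A.wt Prod.fst τ k ω *
      B.wt Prod.snd τ (B.guess Prod.snd s ω τ) ω) +
      ∑ τ, ∑ k, A.wt Prod.fst τ k ω * B.wt Prod.snd τ (!k) ω := hF.add hF'
  -- Condition on the states in `s`. The guess is constant on each fibre, so it suffices to prove
  -- the bound fibrewise.
  rw [← lintegral_add_left hF, lintegral_splice s hFF]
  have hpt : ∀ ω : GenTable n, ENNReal.ofReal ((D / (D + r)) ^ r) ≤ ∫⁻ ω',
      ((∑ τ, ∑ k, A.wt Prod.fst τ k (splice s ω ω') *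
        B.wt Prod.snd τ (B.guess Prod.snd s (splice s ω ω') τ) (splice s ω ω')) +
      ∑ τ, ∑ k, A.wt Prod.fst τ k (splice s ω ω') * B.wt Prod.snd τ (!k) (splice s ω ω'))
        ∂(randomTable n) := by
    intro ω
    have hg : ∀ ω' τ, B.guess Prod.snd s (splice s ω ω') τ = B.guess Prod.snd s ω τ :=
      fun ω' τ => by simp only [Party.guess, avgWt_splice]
    have hA' : ∀ τ k, Measurable fun ω' => A.wt Prod.fst τ k (splice s ω ω') := fun τ k =>
      (hA τ k).comp (measurable_splice_right s ω)
    have hB' : ∀ τ k, Measurable fun ω' => B.wt Prod.snd τ k (splice s ω ω') := fun τ k =>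
      (hB τ k).comp (measurable_splice_right s ω)
    have hm : ∀ τ k k', Measurable fun ω' => A.wt Prod.fst τ k (splice s ω ω') *
        B.wt Prod.snd τ k' (splice s ω ω') := fun τ k k' => (hA' τ k).mul (hB' τ k')
    have hmm : ∀ τ k k' k'', Measurable fun ω' =>
        A.wt Prod.fst τ k (splice s ω ω') * B.wt Prod.snd τ k' (splice s ω ω') +
        A.wt Prod.fst τ k (splice s ω ω') * B.wt Prod.snd τ k'' (splice s ω ω') :=
      fun τ k k' k'' => (hm τ k k').add (hm τ k k'')
    simp only [hg, ← Finset.sum_add_distrib]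
    rw [lintegral_finsetSum _ fun τ _ => Finset.measurable_sum _ fun k _ => hmm τ k _ _]
    -- The factor `1` is replaced by the total mass of the decoupled execution, to be compared with
    -- the real one outcome by outcome.
    rw [← mul_one (ENNReal.ofReal _), ← sum_avgWt_mul_avgWt A B s ω, Finset.mul_sum]
    refine Finset.sum_le_sum fun τ _ => ?_
    rw [lintegral_finsetSum _ fun k _ => hmm τ k _ _, Finset.mul_sum]
    refine Finset.sum_le_sum fun k _ => ?_
    rw [lintegral_add_left (hm τ k _)]
    -- Of Bob's two outputs, `!k` counts as a disagreement, and `k` is at most as likely as the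
    -- guess.
    have h1 : ∑ kB, A.avgWt Prod.fst s τ k ω * B.avgWt Prod.snd s τ kB ω ≤
        A.avgWt Prod.fst s τ k ω * B.avgWt Prod.snd s τ (B.guess Prod.snd s ω τ) ω +
        A.avgWt Prod.fst s τ k ω * B.avgWt Prod.snd s τ (!k) ω := by
      have h2 := avgWt_le_guess B Prod.snd s ω τ k
      rw [Fintype.sum_bool]
      cases k
      · rw [add_comm]; gcongr; exact le_rfl
      · gcongr; exact le_rfl
    calc _ ≤ ENNReal.ofReal ((D / (D + r)) ^ r) *
          (A.avgWt Prod.fst s τ k ω * B.avgWt Prod.snd s τ (B.guess Prod.snd s ω τ) ω +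
          A.avgWt Prod.fst s τ k ω * B.avgWt Prod.snd s τ (!k) ω) := by gcongr
      _ ≤ _ := by
          rw [mul_add]
          exact add_le_add (avgWt_mul_avgWt_le A B hD hs ..) (avgWt_mul_avgWt_le A B hD hs ..)
  calc _ = ∫⁻ _ω : GenTable n, ENNReal.ofReal ((D / (D + r)) ^ r) ∂(randomTable n) := by simp
    _ ≤ _ := lintegral_mono hpt

end Weights

/-! ### The eavesdropper and its success probability. -/

section Eve

variable {n : ℕ → ℕ}

/-- The dimension above which a state counts as long at security parameter `l`. -/
def Construction.longDim (C : Construction n) (l : ℕ) : ℝ := 8 * ((C.rounds l : ℝ) + 1) ^ 2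

/-- The keys whose states have low dimension. -/
def Construction.shortKeys (C : Construction n) (l : ℕ) : Set AnyKey :=
  {x | (2 : ℝ) ^ n x.1 < C.longDim l}

/-- The guess of Bob's key from the transcript, given the states of the short keys. -/
def Construction.eveGuess (C : Construction n) (ω : GenTable n) (l : ℕ) (τ : C.Transcript l) :
    Bool :=
  (C.bob l).guess Prod.snd (C.shortKeys l) ω τ

/-- The unitary that computes a function of the transcript. -/
def Construction.guessMatrix (C : Construction n) {l : ℕ} (g : C.Transcript l → Bool) :
    Matrix (C.EveReg (fun _ => 0) l) (C.EveReg (fun _ => 0) l) ℂ :=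
  fun i j => if i = (j.1, xor j.2.1 (g j.1), j.2.2) then 1 else 0

lemma guessMatrix_mem (C : Construction n) {l : ℕ} (g : C.Transcript l → Bool) :
    C.guessMatrix g ∈ Matrix.unitaryGroup (C.EveReg (fun _ => 0) l) ℂ := by
  rw [Matrix.mem_unitaryGroup_iff']
  ext i j
  rw [mul_apply]
  simp only [star_apply, Construction.guessMatrix, apply_ite star, star_one, star_zero, one_apply]
  simp only [ite_mul, one_mul, zero_mul, Finset.sum_ite_eq', Finset.mem_univ, if_true]
  obtain ⟨i1, i2, i3⟩ := i
  obtain ⟨j1, j2, j3⟩ := j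
  simp only [Prod.mk.injEq]
  congr 1
  rw [eq_iff_iff]
  constructor
  · rintro ⟨rfl, h, rfl⟩
    exact ⟨rfl, by simpa using h, rfl⟩
  · rintro ⟨rfl, rfl, rfl⟩
    exact ⟨rfl, rfl, rfl⟩

/-- The eavesdropper that guesses Bob's key from the transcript and the states of the short keys. -/
def Construction.eve (C : Construction n) (ω : GenTable n) : C.Eavesdropper fun _ => 0 :=
  fun l => ⟨C.guessMatrix (C.eveGuess ω l), guessMatrix_mem C _⟩

lemma eveProb_eve (C : Construction n) (ω : GenTable n) (l : ℕ) (τ : C.Transcript l) (k : Bool) :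
    C.eveProb (C.eve ω) l τ k = if k = C.eveGuess ω l τ then 1 else 0 := by
  simp only [Construction.eveProb, Construction.eve, Construction.guessMatrix, Prod.mk.injEq,
    Bool.false_xor]
  rw [Finset.sum_eq_single τ]
  · rw [Finset.sum_eq_single (0 : Fin ((fun _ : ℕ => 0) l + 1))]
    · by_cases h : k = C.eveGuess ω l τ <;> simp [h]
    · intro c _ hc; exact absurd (Subsingleton.elim (α := Fin 1) c 0) hc
    · simp
  · intro σ _ hσ
    simp [hσ]
  · simp

lemma eveWinProb_eve (C : Construction n) (ω : GenTable n) (l : ℕ) :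
    C.eveWinProb ω.gen (C.eve ω) l = ∑ τ, ∑ k,
      outcomeProb (C.alice l) (C.bob l) ω.gen τ k (C.eveGuess ω l τ) := by
  simp only [Construction.eveWinProb, eveProb_eve, mul_ite, mul_one, mul_zero, Finset.sum_ite_eq',
    Finset.mem_univ, if_true]

lemma one_sub_agreeProb (C : Construction n) (ω : GenTable n) (l : ℕ) :
    1 - C.agreeProb ω.gen l = ∑ τ, ∑ k,
      outcomeProb (C.alice l) (C.bob l) ω.gen τ k (!k) := by
  rw [← sum_outcomeProb (C.alice l) (C.bob l) ω, Construction.agreeProb, ← Finset.sum_sub_distrib]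
  refine Finset.sum_congr rfl fun τ _ => ?_
  simp only [Fintype.sum_bool, Bool.not_true, Bool.not_false]
  ring

lemma one_sub_agreeProb_mem (C : Construction n) (ω : GenTable n) (l : ℕ) :
    0 ≤ 1 - C.agreeProb ω.gen l ∧ 1 - C.agreeProb ω.gen l ≤ 1 := by
  constructor
  · rw [one_sub_agreeProb]
    exact Finset.sum_nonneg fun _ _ => Finset.sum_nonneg fun _ _ => outcomeProb_nonneg ..
  · have : 0 ≤ C.agreeProb ω.gen l :=
      Finset.sum_nonneg fun _ _ => Finset.sum_nonneg fun _ _ => outcomeProb_nonneg ..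
    linarith

lemma eveWinProb_eve_mem (C : Construction n) (ω : GenTable n) (l : ℕ) :
    0 ≤ C.eveWinProb ω.gen (C.eve ω) l ∧ C.eveWinProb ω.gen (C.eve ω) l ≤ 1 := by
  rw [eveWinProb_eve]
  refine ⟨Finset.sum_nonneg fun _ _ => Finset.sum_nonneg fun _ _ => outcomeProb_nonneg .., ?_⟩
  rw [← sum_outcomeProb (C.alice l) (C.bob l) ω]
  refine Finset.sum_le_sum fun τ _ => Finset.sum_le_sum fun k _ => ?_
  exact Finset.single_le_sum (fun k' _ => outcomeProb_nonneg (C.alice l) (C.bob l) ω τ k k')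
    (Finset.mem_univ _)

lemma measurable_eveGuess (C : Construction n) (l : ℕ) (τ : C.Transcript l) :
    Measurable fun ω => C.eveGuess ω l τ :=
  measurable_guess ..

lemma measurable_eveWinProb_eve (C : Construction n) (l : ℕ) :
    Measurable fun ω : GenTable n => C.eveWinProb ω.gen (C.eve ω) l := by
  simp only [eveWinProb_eve]
  refine Finset.measurable_sum _ fun τ _ => Finset.measurable_sum _ fun k _ => ?_
  have : (fun ω : GenTable n => outcomeProb (C.alice l) (C.bob l) ω.gen τ k (C.eveGuess ω l τ)) =
      fun ω => if C.eveGuess ω l τ = true then outcomeProb (C.alice l) (C.bob l) ω.gen τ k true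
        else outcomeProb (C.alice l) (C.bob l) ω.gen τ k false := by
    funext ω; cases h : C.eveGuess ω l τ <;> simp
  rw [this]
  exact Measurable.ite (measurable_eveGuess C l τ (measurableSet_singleton true))
    (measurable_outcomeProb ..) (measurable_outcomeProb ..)

lemma measurable_agreeProb (C : Construction n) (l : ℕ) :
    Measurable fun ω : GenTable n => C.agreeProb ω.gen l :=
  Finset.measurable_sum _ fun _ _ => Finset.measurable_sum _ fun _ _ => measurable_outcomeProb ..

/-- Bernoulli's inequality bounds the loss by `r ^ 2 / (D + r)`, which `D = 8 * (r + 1) ^ 2` keeps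
below `1 / 8`. The final contradiction only needs a constant above `1 / 2`. -/
lemma longDim_ratio (r : ℕ) :
    (7 / 8 : ℝ) ≤ (8 * ((r : ℝ) + 1) ^ 2 / (8 * ((r : ℝ) + 1) ^ 2 + r)) ^ r := by
  set D : ℝ := 8 * ((r : ℝ) + 1) ^ 2
  have hD : 0 < D := by positivity
  have h1 : D / (D + r) = 1 + -(r / (D + r)) := by field_simp; ring
  have h2 : (r : ℝ) / (D + r) ≤ 1 := div_le_one_of_le₀ (by linarith) (by positivity)
  have h3 := one_add_mul_le_pow (a := -((r : ℝ) / (D + r))) (by linarith) r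
  rw [h1]
  refine le_trans ?_ h3
  have h4 : (r : ℝ) * (r / (D + r)) ≤ 1 / 8 := by
    rw [mul_div_assoc', div_le_div_iff₀ (by positivity) (by norm_num)]
    have : (0 : ℝ) ≤ r := Nat.cast_nonneg r
    simp only [D]
    nlinarith
  linarith

/-- On average over the generator, the eavesdropper wins or the parties disagree. -/
lemma le_lintegral_eveWinProb_add (C : Construction n) (l : ℕ) :
    ENNReal.ofReal (7 / 8) ≤
      (∫⁻ ω, ENNReal.ofReal (C.eveWinProb ω.gen (C.eve ω) l) ∂(randomTable n)) +
      ∫⁻ ω : GenTable n, ENNReal.ofReal (1 - C.agreeProb ω.gen l) ∂(randomTable n) := by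
  have h := le_lintegral_guess_add_disagree (C.alice l) (C.bob l) (s := C.shortKeys l)
    (D := C.longDim l) (by unfold Construction.longDim; positivity)
    (fun x hx => not_lt.1 hx)
  refine le_trans (ENNReal.ofReal_le_ofReal (longDim_ratio (C.rounds l))) (h.trans (le_of_eq ?_))
  congr 1
  · refine lintegral_congr fun ω => ?_
    rw [eveWinProb_eve, ENNReal.ofReal_sum_of_nonneg fun _ _ =>
      Finset.sum_nonneg fun _ _ => outcomeProb_nonneg ..]
    refine Finset.sum_congr rfl fun τ _ => ?_
    rw [ENNReal.ofReal_sum_of_nonneg fun _ _ => outcomeProb_nonneg ..]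
    exact Finset.sum_congr rfl fun k _ => (ofReal_outcomeProb ..).symm
  · refine lintegral_congr fun ω => ?_
    rw [one_sub_agreeProb, ENNReal.ofReal_sum_of_nonneg fun _ _ =>
      Finset.sum_nonneg fun _ _ => outcomeProb_nonneg ..]
    refine Finset.sum_congr rfl fun τ _ => ?_
    rw [ENNReal.ofReal_sum_of_nonneg fun _ _ => outcomeProb_nonneg ..]
    exact Finset.sum_congr rfl fun k _ => (ofReal_outcomeProb ..).symm

/-- Every high-dimensional state is averaged out of the guess. This keeps the eavesdropper unchanged
when such a state is reprogrammed. -/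
lemma eveGuess_update (C : Construction n) (l : ℕ) {x : AnyKey} (hx : C.longDim l ≤ 2 ^ n x.1)
    (ω : GenTable n) (φ : PureState (n x.1)) :
    C.eveGuess (Function.update ω x φ) l = C.eveGuess ω l := by
  have hx' : x ∉ C.shortKeys l := fun h => absurd h (not_lt.2 hx)
  funext τ
  simp only [Construction.eveGuess, Party.guess, avgWt_update _ _ _ _ _ hx']

end Eve

/-! ### The hybrid argument for quantum query algorithms. -/

section QueryProcesses

variable {X Y U : Type} [Fintype X] [Fintype Y] [Fintype U]

attribute [local instance] Matrix.frobeniusNormedAddCommGroup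

lemma frobenius_sq (V : Matrix X U ℂ) : ‖V‖ ^ 2 = ∑ x, ∑ u, ‖V x u‖ ^ 2 := by
  rw [frobenius_norm_def, ← Real.sqrt_eq_rpow, Real.sq_sqrt (by positivity)]
  simp

lemma mul_conjTranspose_self_diag {X : Type} (V : Matrix X U ℂ) (x : X) :
    ((V * Vᴴ) x x).re = ∑ u, ‖V x u‖ ^ 2 := by
  rw [mul_apply, Complex.re_sum]
  refine Finset.sum_congr rfl fun u _ => ?_
  rw [conjTranspose_apply, RCLike.star_def, Complex.mul_conj']
  norm_cast

lemma frobenius_sq_eq_trace (V : Matrix X U ℂ) : ‖V‖ ^ 2 = (trace (V * Vᴴ)).re := by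
  rw [frobenius_sq, trace, Complex.re_sum]
  exact Finset.sum_congr rfl fun x _ => (mul_conjTranspose_self_diag V x).symm

variable [DecidableEq X]

lemma frobenius_norm_isometry_mul {O : Matrix Y X ℂ} (hO : Oᴴ * O = 1) (V : Matrix X U ℂ) :
    ‖O * V‖ = ‖V‖ := by
  rw [← sq_eq_sq₀ (norm_nonneg _) (norm_nonneg _), frobenius_sq_eq_trace, frobenius_sq_eq_trace,
    conjTranspose_mul, Matrix.mul_assoc, trace_mul_comm, Matrix.mul_assoc, Matrix.mul_assoc, hO,
    Matrix.mul_one]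

/-- The purification of the post-measurement state on outcome `o`: the Kraus index becomes part of
the environment. -/
def Instrument.dilate {Ω : Type} [Fintype Ω] (E : Instrument Ω X Y) (o : Ω) (V : Matrix X U ℂ) :
    Matrix Y (Fin E.size × U) ℂ :=
  fun y p => (E.K o p.1 * V) y p.2

lemma Instrument.dilate_mul_conjTranspose {Ω : Type} [Fintype Ω] (E : Instrument Ω X Y) (o : Ω)
    (V : Matrix X U ℂ) : E.dilate o V * (E.dilate o V)ᴴ = E.apply o (V * Vᴴ) := by
  ext y y'
  rw [mul_apply, Fintype.sum_prod_type, Instrument.apply, Matrix.sum_apply]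
  refine Finset.sum_congr rfl fun i _ => ?_
  rw [← Matrix.mul_assoc, Matrix.mul_assoc (E.K o i * V), ← conjTranspose_mul, mul_apply]
  rfl

lemma Instrument.dilate_sub {Ω U : Type} [Fintype Ω] (E : Instrument Ω X Y) (o : Ω)
    (V V' : Matrix X U ℂ) : E.dilate o (V - V') = E.dilate o V - E.dilate o V' := by
  ext y p
  simp [Instrument.dilate, Matrix.mul_sub]

lemma Instrument.sum_norm_dilate_sq {Ω : Type} [Fintype Ω] (E : Instrument Ω X Y)
    (V : Matrix X U ℂ) : ∑ o, ‖E.dilate o V‖ ^ 2 = ‖V‖ ^ 2 := by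
  simp only [frobenius_sq_eq_trace, Instrument.dilate_mul_conjTranspose]
  rw [← Complex.re_sum, E.sum_trace_apply]

lemma Instrument.norm_dilate_le {Ω : Type} [Fintype Ω] (E : Instrument Ω X Y) (o : Ω)
    (V : Matrix X U ℂ) : ‖E.dilate o V‖ ≤ ‖V‖ := by
  rw [← sq_le_sq₀ (norm_nonneg _) (norm_nonneg _), ← E.sum_norm_dilate_sq V]
  exact Finset.single_le_sum (f := fun o => ‖E.dilate o V‖ ^ 2) (fun _ _ => sq_nonneg _)
    (Finset.mem_univ o)

variable [DecidableEq Y]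

/-- The states of an algorithm that alternates between queries `O` and arbitrary operations. -/
def queryState (step : ℕ → Instrument Unit Y X) (O : Matrix Y X ℂ) (ρ : Matrix X X ℂ) :
    ℕ → Matrix X X ℂ
  | 0 => ρ
  | j + 1 => (step j).apply () (O * queryState step O ρ j * Oᴴ)

/-- The probability of finding the query register in `s`. -/
def queryMass (s : Finset X) (ρ : Matrix X X ℂ) : ℝ := ∑ x ∈ s, (ρ x x).re

lemma norm_diagonal_mul_sq (s : Finset X) (V : Matrix X U ℂ) :
    ‖diagonal (fun x => if x ∈ s then (1 : ℂ) else 0) * V‖ ^ 2 = queryMass s (V * Vᴴ) := by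
  simp only [frobenius_sq, queryMass, mul_conjTranspose_self_diag, diagonal_mul]
  rw [← Finset.sum_filter_add_sum_filter_not Finset.univ (· ∈ s)]
  rw [Finset.sum_eq_zero (s := Finset.univ.filter (· ∉ s)), add_zero, Finset.filter_univ_mem]
  · refine Finset.sum_congr rfl fun x hx => ?_
    simp [hx]
  · intro x hx
    simp [(Finset.mem_filter.1 hx).2]

/-- Two oracles that differ only on the queries in `s` lead to close purifications. -/
lemma exists_purifications (step : ℕ → Instrument Unit Y X) {O O' : Matrix Y X ℂ}
    (hO : Oᴴ * O = 1) (hO' : O'ᴴ * O' = 1) (s : Finset X) (hs : ∀ y, ∀ x ∉ s, O y x = O' y x)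
    {ρ : Matrix X X ℂ} (hρ : ∃ (U : Type) (_ : Fintype U) (V : Matrix X U ℂ), ρ = V * Vᴴ) (j : ℕ) :
    ∃ (U : Type) (_ : Fintype U) (V V' : Matrix X U ℂ),
      queryState step O ρ j = V * Vᴴ ∧ queryState step O' ρ j = V' * V'ᴴ ∧
      ‖V - V'‖ ≤ ∑ i ∈ Finset.range j, 2 * √(queryMass s (queryState step O ρ i)) := by
  induction j with
  | zero =>
    obtain ⟨U, hU, V, rfl⟩ := hρ
    exact ⟨U, hU, V, V, rfl, rfl, by simp⟩
  | succ j ih =>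
    obtain ⟨U, hU, V, V', h1, h2, h3⟩ := ih
    have hdil : ∀ (Q : Matrix Y X ℂ) (W : Matrix X U ℂ), (step j).apply () (Q * (W * Wᴴ) * Qᴴ) =
        (step j).dilate () (Q * W) * ((step j).dilate () (Q * W))ᴴ := by
      intro Q W
      rw [Instrument.dilate_mul_conjTranspose, conjTranspose_mul]
      simp only [Matrix.mul_assoc]
    refine ⟨_, inferInstance, (step j).dilate () (O * V), (step j).dilate () (O' * V'), ?_, ?_, ?_⟩
    · rw [queryState, h1, hdil]
    · rw [queryState, h2, hdil]
    · rw [← Instrument.dilate_sub, Finset.sum_range_succ]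
      refine (Instrument.norm_dilate_le _ _ _).trans ?_
      set P : Matrix X X ℂ := diagonal fun x => if x ∈ s then (1 : ℂ) else 0
      -- The oracles differ only on the range of the projection `P` onto queries in `s`. One query
      -- adds at most twice the norm of the projected state, while the earlier difference passes
      -- through an isometry.
      have hP : O - O' = O * P - O' * P := by
        ext y x
        by_cases hx : x ∈ s
        · simp [P, mul_diagonal, hx]
        · simp [P, mul_diagonal, hx, hs y x hx]
      have hsplit : O * V - O' * V' = O' * (V - V') + (O * (P * V) - O' * (P * V)) := by
        rw [← Matrix.mul_assoc, ← Matrix.mul_assoc, ← Matrix.sub_mul (O * P), ← hP, Matrix.sub_mul,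
          Matrix.mul_sub]
        abel
      rw [hsplit]
      refine (norm_add_le _ _).trans (add_le_add ?_ ((norm_sub_le _ _).trans (le_of_eq ?_)))
      · rwa [frobenius_norm_isometry_mul hO']
      · rw [frobenius_norm_isometry_mul hO', frobenius_norm_isometry_mul hO, h1,
          ← norm_diagonal_mul_sq, Real.sqrt_sq (norm_nonneg _), two_mul]

lemma trace_queryState (step : ℕ → Instrument Unit Y X) {O : Matrix Y X ℂ}
    (hO : Oᴴ * O = 1) (ρ : Matrix X X ℂ) (j : ℕ) : trace (queryState step O ρ j) = trace ρ := by
  induction j with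
  | zero => rfl
  | succ j ih =>
    have h := (step j).sum_trace_apply (O * queryState step O ρ j * Oᴴ)
    rw [Fintype.sum_unique] at h
    rw [queryState, ← ih]
    refine h.trans ?_
    rw [trace_mul_comm, ← Matrix.mul_assoc, hO, Matrix.one_mul]

/-- The acceptance probabilities with two oracles that differ only on the queries in `s`. -/
lemma abs_accept_sub_le (step : ℕ → Instrument Unit Y X) (out : Instrument Bool X Unit)
    {O O' : Matrix Y X ℂ}
    (hO : Oᴴ * O = 1) (hO' : O'ᴴ * O' = 1) (s : Finset X) (hs : ∀ y, ∀ x ∉ s, O y x = O' y x)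
    {ρ : Matrix X X ℂ} (hρ : ∃ (U : Type) (_ : Fintype U) (V : Matrix X U ℂ), ρ = V * Vᴴ)
    (hρ' : trace ρ = 1) (q : ℕ) :
    |(trace (out.apply true (queryState step O ρ q))).re -
      (trace (out.apply true (queryState step O' ρ q))).re| ≤
      4 * ∑ i ∈ Finset.range q, √(queryMass s (queryState step O ρ i)) := by
  obtain ⟨U, hU, V, V', h1, h2, h3⟩ := exists_purifications step hO hO' s hs hρ q
  have hV : ‖V‖ ≤ 1 := by
    rw [← sq_le_one_iff₀ (norm_nonneg _), frobenius_sq_eq_trace, ← h1, trace_queryState step hO,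
      hρ']; simp
  have hV' : ‖V'‖ ≤ 1 := by
    rw [← sq_le_one_iff₀ (norm_nonneg _), frobenius_sq_eq_trace, ← h2, trace_queryState step hO',
      hρ']; simp
  -- Acceptance probabilities are squared norms of purifications. As a difference of squares, the
  -- gap is at most `2` times the distance, which supplies the second factor of two in the constant
  -- `4`.
  rw [h1, h2, ← Instrument.dilate_mul_conjTranspose, ← Instrument.dilate_mul_conjTranspose,
    ← frobenius_sq_eq_trace, ← frobenius_sq_eq_trace, sq_sub_sq, abs_mul]
  have h4 := out.norm_dilate_le true V
  have h5 := out.norm_dilate_le true V'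
  have h6 : |‖out.dilate true V‖ - ‖out.dilate true V'‖| ≤ ‖V - V'‖ := by
    refine (abs_norm_sub_norm_le _ _).trans ?_
    rw [← Instrument.dilate_sub]
    exact out.norm_dilate_le true _
  rw [← Finset.mul_sum] at h3
  have h7 : |‖out.dilate true V‖ + ‖out.dilate true V'‖| ≤ 2 := by
    rw [abs_of_nonneg (by positivity)]; linarith
  have := mul_le_mul h7 (h6.trans h3) (abs_nonneg _) (by norm_num)
  linarith

lemma accept_mem (step : ℕ → Instrument Unit Y X) (out : Instrument Bool X Unit)
    {O : Matrix Y X ℂ} (hO : Oᴴ * O = 1)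
    {ρ : Matrix X X ℂ} (hρ : ∃ (U : Type) (_ : Fintype U) (V : Matrix X U ℂ), ρ = V * Vᴴ)
    (hρ' : trace ρ = 1) (q : ℕ) :
    (trace (out.apply true (queryState step O ρ q))).re ∈ Set.Icc (0 : ℝ) 1 := by
  obtain ⟨U, hU, V, -, h1, -, -⟩ := exists_purifications step hO hO ∅ (fun _ _ _ => rfl) hρ q
  rw [h1, ← Instrument.dilate_mul_conjTranspose, ← frobenius_sq_eq_trace]
  refine ⟨sq_nonneg _, ?_⟩
  have h2 := out.norm_dilate_le true V
  have h3 : ‖V‖ ^ 2 = 1 := by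
    rw [frobenius_sq_eq_trace, ← h1, trace_queryState step hO, hρ']; simp
  rw [← h3]
  gcongr

/-- Disjoint sets of queries have total mass at most one. -/
lemma sum_queryMass_le (step : ℕ → Instrument Unit Y X) {O : Matrix Y X ℂ} (hO : Oᴴ * O = 1)
    {ρ : Matrix X X ℂ} (hρ : ∃ (U : Type) (_ : Fintype U) (V : Matrix X U ℂ), ρ = V * Vᴴ)
    (hρ' : trace ρ = 1) {κ : Type} [Fintype κ] (s : κ → Finset X)
    (hs : Pairwise fun k k' => Disjoint (s k) (s k')) (j : ℕ) :
    ∑ k, queryMass (s k) (queryState step O ρ j) ≤ 1 := by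
  obtain ⟨U, hU, V, -, h1, -, -⟩ := exists_purifications step hO hO ∅ (fun _ _ _ => rfl) hρ j
  classical
  have h2 : ∑ x, ((queryState step O ρ j) x x).re = 1 := by
    have := congrArg Complex.re ((trace_queryState step hO ρ j).trans hρ')
    simpa [trace, Complex.re_sum] using this
  rw [← h2]
  simp only [queryMass]
  rw [← Finset.sum_biUnion fun k _ k' _ hkk' => hs hkk']
  refine Finset.sum_le_sum_of_subset_of_nonneg (Finset.subset_univ _) fun x _ _ => ?_
  rw [h1, mul_conjTranspose_self_diag]
  positivity

lemma queryMass_nonneg (step : ℕ → Instrument Unit Y X) {O : Matrix Y X ℂ} (hO : Oᴴ * O = 1)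
    {ρ : Matrix X X ℂ} (hρ : ∃ (U : Type) (_ : Fintype U) (V : Matrix X U ℂ), ρ = V * Vᴴ)
    (s : Finset X) (j : ℕ) : 0 ≤ queryMass s (queryState step O ρ j) := by
  obtain ⟨U, hU, V, -, h1, -, -⟩ := exists_purifications step hO hO ∅ (fun _ _ _ => rfl) hρ j
  rw [h1, ← norm_diagonal_mul_sq]
  positivity

/-- Reprogramming a random one of the query sets `s k` is hard to notice. -/
lemma sum_abs_accept_sub_le (step : ℕ → Instrument Unit Y X) (out : Instrument Bool X Unit)
    {κ : Type} [Fintype κ] {O : Matrix Y X ℂ} {O' : κ → Matrix Y X ℂ}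
    (hO : Oᴴ * O = 1) (hO' : ∀ k, (O' k)ᴴ * O' k = 1) (s : κ → Finset X)
    (hs : ∀ k, ∀ y, ∀ x ∉ s k, O y x = O' k y x)
    (hdisj : Pairwise fun k k' => Disjoint (s k) (s k'))
    {ρ : Matrix X X ℂ} (hρ : ∃ (U : Type) (_ : Fintype U) (V : Matrix X U ℂ), ρ = V * Vᴴ)
    (hρ' : trace ρ = 1) (q : ℕ) :
    ∑ k, |(trace (out.apply true (queryState step O ρ q))).re -
      (trace (out.apply true (queryState step (O' k) ρ q))).re| ≤
      4 * (q * √(Fintype.card κ)) := by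
  refine (Finset.sum_le_sum fun k _ =>
    abs_accept_sub_le step out hO (hO' k) (s k) (hs k) hρ hρ' q).trans ?_
  rw [← Finset.mul_sum, Finset.sum_comm]
  refine mul_le_mul_of_nonneg_left ?_ (by norm_num)
  -- The masses refer to the run with the original oracle, which is the same for all `k`.
  -- Disjointness bounds their sum by one, and Cauchy–Schwarz turns this into a square root of the
  -- number of keys.
  have h : ∀ i ∈ Finset.range q,
      ∑ k, √(queryMass (s k) (queryState step O ρ i)) ≤ √(Fintype.card κ) := by
    intro i _
    refine Real.le_sqrt_of_sq_le ?_
    refine (sq_sum_le_card_mul_sum_sq).trans ?_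
    simp only [Real.sq_sqrt (queryMass_nonneg step hO hρ _ _), Finset.card_univ]
    exact mul_le_of_le_one_right (by positivity) (sum_queryMass_le step hO hρ hρ' s hdisj i)
  simpa using Finset.sum_le_card_nsmul _ _ _ h

end QueryProcesses

/-! ### The hybrid argument applied to security reductions. -/

section Distinguishers

variable {n : ℕ → ℕ} {C : Construction n} {w : ℕ → ℕ}

lemma redOracle_isometry (I : Generator n) (E : C.Eavesdropper w) (L N : ℕ) :
    (redOracle C I E L N)ᴴ * redOracle C I E L N = 1 := by
  have h1 : ∀ l, (E l : Matrix (C.EveReg w l) (C.EveReg w l) ℂ)ᴴ *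
      (E l : Matrix (C.EveReg w l) (C.EveReg w l) ℂ) = 1 :=
    fun l => Matrix.mem_unitaryGroup_iff'.1 (E l).2
  have h2 : ∀ l, (E l : Matrix (C.EveReg w l) (C.EveReg w l) ℂ) *
      (E l : Matrix (C.EveReg w l) (C.EveReg w l) ℂ)ᴴ = 1 :=
    fun l => Matrix.mem_unitaryGroup_iff.1 (E l).2
  simp only [redOracle, fromBlocks_conjTranspose, fromBlocks_multiply, conjTranspose_zero,
    Matrix.mul_zero, Matrix.zero_mul, add_zero, zero_add, genIsometry_isometry,
    blockDiagonal'_conjTranspose, conjTranspose_conjTranspose, ← blockDiagonal'_mul, h1, h2]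
  have h3 : (blockDiagonal' fun l : Fin (N + 1) => (1 : Matrix (C.EveReg w l) (C.EveReg w l) ℂ)) = 1 :=
    blockDiagonal'_one
  rw [h3, fromBlocks_one, fromBlocks_one]

namespace Distinguisher

variable (S : Distinguisher C w)

/-- The oracle, acting on work and query registers. -/
def oracle (I : Generator n) (E : C.Eavesdropper w) (l : ℕ) :
    Matrix (Fin (S.work l) × RedAnswer C w (S.keyLen l) (S.eveLen l))
      (Fin (S.work l) × RedQuery C w (S.keyLen l) (S.eveLen l)) ℂ :=
  (1 : Matrix (Fin (S.work l)) (Fin (S.work l)) ℂ) ⊗ₖ redOracle C I E (S.keyLen l) (S.eveLen l)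

lemma oracle_isometry (I : Generator n) (E : C.Eavesdropper w) (l : ℕ) :
    (S.oracle I E l)ᴴ * S.oracle I E l = 1 := by
  rw [oracle, conjTranspose_kronecker, ← mul_kronecker_mul, redOracle_isometry,
    conjTranspose_one, Matrix.one_mul, one_kronecker_one]

/-- The state in which the distinguisher starts on input `φ`. -/
def initial (l : ℕ) (φ : PureState (n l)) :
    Matrix (Fin (S.work l) × RedQuery C w (S.keyLen l) (S.eveLen l))
      (Fin (S.work l) × RedQuery C w (S.keyLen l) (S.eveLen l)) ℂ :=
  (S.prepare l).apply () (ketbra fun y => ∏ i, (φ : EuclideanSpace ℂ (BitString (n l))) (y i))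

lemma state_eq_queryState (I : Generator n) (E : C.Eavesdropper w) (l : ℕ) (φ : PureState (n l))
    (j : ℕ) :
    S.state I E l φ j = queryState (S.step l) (S.oracle I E l) (S.initial l φ) j := by
  induction j with
  | zero => rfl
  | succ j ih => rw [state, ih]; rfl

lemma exists_purification_initial (l : ℕ) (φ : PureState (n l)) :
    ∃ (U : Type) (_ : Fintype U) (V : Matrix _ U ℂ), S.initial l φ = V * Vᴴ := by
  refine ⟨_, inferInstance, (S.prepare l).dilate () (replicateCol Unit fun y =>
    ∏ i, (φ : EuclideanSpace ℂ (BitString (n l))) (y i)), ?_⟩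
  rw [Instrument.dilate_mul_conjTranspose, initial, ketbra, vecMulVec_eq Unit, conjTranspose_replicateCol]

lemma trace_initial (l : ℕ) (φ : PureState (n l)) : trace (S.initial l φ) = 1 := by
  have h := (S.prepare l).sum_trace_apply
    (ketbra fun y => ∏ i, (φ : EuclideanSpace ℂ (BitString (n l))) (y i))
  rw [Fintype.sum_unique] at h
  refine h.trans ?_
  have h1 : ∑ b, (φ : EuclideanSpace ℂ (BitString (n l))) b *
      star ((φ : EuclideanSpace ℂ (BitString (n l))) b) = 1 := by
    have h1 : ‖(φ : EuclideanSpace ℂ (BitString (n l)))‖ ^ 2 = 1 := by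
      rw [norm_eq_of_mem_sphere, one_pow]
    rw [EuclideanSpace.norm_sq_eq] at h1
    simp only [RCLike.star_def, Complex.mul_conj']
    exact_mod_cast h1
  simp only [trace, diag_apply, ketbra, vecMulVec_apply, Pi.star_apply, star_prod,
    ← Finset.prod_mul_distrib]
  rw [← Fintype.prod_sum fun (_ : Fin (S.copies l)) b => (φ : EuclideanSpace ℂ (BitString (n l))) b *
      star ((φ : EuclideanSpace ℂ (BitString (n l))) b)]
  rw [h1, Finset.prod_const_one]

lemma acceptProb_mem (I : Generator n) (E : C.Eavesdropper w) (l : ℕ) (φ : PureState (n l)) :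
    S.acceptProb I E l φ ∈ Set.Icc (0 : ℝ) 1 := by
  rw [acceptProb, state_eq_queryState]
  exact accept_mem _ _ (S.oracle_isometry I E l) (S.exists_purification_initial l φ)
    (S.trace_initial l φ) _

lemma acceptProb_congr (I : Generator n) {E E' : C.Eavesdropper w} {l : ℕ}
    (h : ∀ l' ≤ S.eveLen l, E l' = E' l') (φ : PureState (n l)) :
    S.acceptProb I E l φ = S.acceptProb I E' l φ := by
  have h1 : ∀ l' : Fin (S.eveLen l + 1), E l' = E' l' :=
    fun l' => h l' (Nat.lt_succ_iff.1 l'.2)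
  have : S.oracle I E l = S.oracle I E' l := by
    simp only [oracle, redOracle, h1]
  rw [acceptProb, acceptProb, state_eq_queryState, state_eq_queryState, this]

open scoped Classical in
/-- The queries to a given key. -/
def queriesTo (l : ℕ) (x : AnyKey) :
    Finset (Fin (S.work l) × RedQuery C w (S.keyLen l) (S.eveLen l)) :=
  Finset.univ.filter fun p => Sum.elim (fun y : Key (S.keyLen l) => y.toAny = x) (fun _ => False) p.2

lemma disjoint_queriesTo (l : ℕ) {x x' : AnyKey} (h : x ≠ x') :
    Disjoint (S.queriesTo l x) (S.queriesTo l x') := by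
  rw [Finset.disjoint_left]
  rintro ⟨a, y | y⟩ h1 h2
  · simp only [queriesTo, Finset.mem_filter, Sum.elim_inl] at h1 h2
    exact h (h1.2.symm.trans h2.2)
  · simp [queriesTo] at h1

lemma oracle_update_apply (ω : GenTable n) (E : C.Eavesdropper w) (l : ℕ) (x : AnyKey)
    (ψ : PureState (n x.1)) (y) {p} (hp : p ∉ S.queriesTo l x) :
    S.oracle ω.gen E l y p = S.oracle (GenTable.gen (Function.update ω x ψ)) E l y p := by
  obtain ⟨a, q | q⟩ := p
  · obtain ⟨b, z | z⟩ := y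
    · simp only [oracle, kroneckerMap_apply, redOracle, fromBlocks_apply₁₁]
      congr 1
      simp only [genIsometry]
      split_ifs with hz
      · have hne : q.toAny ≠ x := by simpa [queriesTo] using hp
        subst hz
        have : Function.update ω x ψ z.1.toAny = ω z.1.toAny := Function.update_of_ne hne _ _
        simp only [GenTable.gen]
        exact congrArg (fun v : PureState _ => (v : EuclideanSpace ℂ _) z.2) this.symm
      · rfl
    · rfl
  · obtain ⟨b, z | z⟩ := y <;> rfl

/-- A distinguisher hardly notices the reprogramming of a random key. -/
lemma sum_abs_acceptProb_update_sub_le (ω : GenTable n) (E : C.Eavesdropper w) (l : ℕ)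
    (φ : PureState (n l)) (ψ : BitString l → PureState (n l)) :
    ∑ k, |S.acceptProb ω.gen E l φ -
      S.acceptProb (GenTable.gen (Function.update ω ⟨l, k⟩ (ψ k))) E l φ| ≤
      4 * (S.queries l * √(2 ^ l)) := by
  simp only [acceptProb, state_eq_queryState]
  refine (sum_abs_accept_sub_le (S.step l) (S.out l) (κ := BitString l) (S.oracle_isometry ω.gen E l)
    (O' := fun k => S.oracle (GenTable.gen (Function.update ω ⟨l, k⟩ (ψ k))) E l)
    (fun k => S.oracle_isometry _ E l)
    (fun k => S.queriesTo l ⟨l, k⟩) (fun k y p hp => S.oracle_update_apply ω E l ⟨l, k⟩ (ψ k) y hp)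
    (fun k k' hk => S.disjoint_queriesTo l (by simpa using hk))
    (S.exists_purification_initial l φ) (S.trace_initial l φ) (S.queries l)).trans (le_of_eq ?_)
  simp

end Distinguisher
end Distinguishers

/-! ### Measurable dependence of acceptance probabilities on the generator. -/

section Measurability

variable {α X Y Z : Type*} [MeasurableSpace α]

/-- A random matrix with measurable entries. -/
def MeasurableEntries (A : α → Matrix X Y ℂ) : Prop := ∀ i j, Measurable fun a => A a i j

namespace MeasurableEntries

lemma const (A : Matrix X Y ℂ) : MeasurableEntries fun _ : α => A := fun _ _ => measurable_const

lemma mul [Fintype Y] {A : α → Matrix X Y ℂ} {B : α → Matrix Y Z ℂ} (hA : MeasurableEntries A)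
    (hB : MeasurableEntries B) : MeasurableEntries fun a => A a * B a := by
  intro i j
  simp only [mul_apply]
  exact Finset.measurable_sum _ fun k _ => (hA i k).mul (hB k j)

lemma conjTranspose {A : α → Matrix X Y ℂ} (hA : MeasurableEntries A) :
    MeasurableEntries fun a => (A a)ᴴ := fun i j => continuous_star.measurable.comp (hA j i)

lemma sum {ι : Type*} [Fintype ι] {A : ι → α → Matrix X Y ℂ} (hA : ∀ i, MeasurableEntries (A i)) :
    MeasurableEntries fun a => ∑ i, A i a := by
  intro i j
  simp only [Matrix.sum_apply]
  exact Finset.measurable_sum _ fun k _ => hA k i j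

lemma trace [Fintype X] {A : α → Matrix X X ℂ} (hA : MeasurableEntries A) :
    Measurable fun a => Matrix.trace (A a) :=
  Finset.measurable_sum _ fun i _ => hA i i

lemma fromBlocks {X' Y' : Type*} {A : α → Matrix X Y ℂ} {B : α → Matrix X' Y' ℂ}
    (hA : MeasurableEntries A) (hB : MeasurableEntries B) :
    MeasurableEntries fun a => Matrix.fromBlocks (A a) 0 0 (B a) := by
  rintro (i | i) (j | j)
  · exact hA i j
  · exact measurable_const
  · exact measurable_const
  · exact hB i j

end MeasurableEntries

lemma MeasurableEntries.instrument_apply {Ω X Y : Type} [Fintype Ω] [Fintype X] [DecidableEq X]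
    [Fintype Y] (E : Instrument Ω X Y) (o : Ω) {ρ : α → Matrix X X ℂ} (hρ : MeasurableEntries ρ) :
    MeasurableEntries fun a => E.apply o (ρ a) :=
  .sum fun _ => ((MeasurableEntries.const _).mul hρ).mul (.const _)

lemma MeasurableEntries.queryState {X Y : Type} [Fintype X] [DecidableEq X] [Fintype Y]
    [DecidableEq Y] (step : ℕ → Instrument Unit Y X) {O : α → Matrix Y X ℂ} {ρ : α → Matrix X X ℂ}
    (hO : MeasurableEntries O) (hρ : MeasurableEntries ρ) (j : ℕ) :
    MeasurableEntries fun a => QCCC.queryState step (O a) (ρ a) j := by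
  induction j with
  | zero => exact hρ
  | succ j ih => exact .instrument_apply _ _ ((hO.mul ih).mul hO.conjTranspose)

variable {n : ℕ → ℕ}

lemma measurableEntries_eve (C : Construction n) (l : ℕ) :
    MeasurableEntries fun ω : GenTable n =>
      (C.eve ω l : Matrix (C.EveReg (fun _ => 0) l) (C.EveReg (fun _ => 0) l) ℂ) := by
  intro i j
  have h : Measurable fun b : Bool =>
      if i = (j.1, xor j.2.1 b, j.2.2) then (1 : ℂ) else 0 := measurable_of_countable _
  exact h.comp (measurable_eveGuess C l j.1)

lemma measurableEntries_genIsometry (L : ℕ) :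
    MeasurableEntries fun ω : GenTable n => genIsometry ω.gen L := by
  intro s x
  simp only [genIsometry]
  split_ifs
  · simp only [GenTable.gen]
    fun_prop
  · exact measurable_const

/-- The table enters both through the generator and through the eavesdropper. Joint measurability in
table and input is needed because the input will itself be an entry of the table or a resampled one.
-/
lemma measurable_acceptProb {C : Construction n} (S : Distinguisher C fun _ => 0) (l : ℕ) :
    Measurable fun p : GenTable n × PureState (n l) =>
      S.acceptProb p.1.gen (C.eve p.1) l p.2 := by
  simp only [Distinguisher.acceptProb, Distinguisher.state_eq_queryState]
  refine Complex.measurable_re.comp (MeasurableEntries.trace (.instrument_apply _ _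
    (.queryState _ ?_ (.instrument_apply _ _ ?_) _)))
  · have hE : MeasurableEntries fun ω : GenTable n => blockDiagonal' fun l' : Fin (S.eveLen l + 1) =>
        (C.eve ω l' : Matrix (C.EveReg (fun _ => 0) l') (C.EveReg (fun _ => 0) l') ℂ) := by
      rintro ⟨i, i'⟩ ⟨j, j'⟩
      by_cases h : i = j
      · subst h
        simp only [blockDiagonal'_apply_eq]
        exact measurableEntries_eve C i i' j'
      · simp only [blockDiagonal'_apply_ne _ _ _ h]
        exact measurable_const
    have hO : MeasurableEntries fun ω : GenTable n =>
        redOracle C ω.gen (C.eve ω) (S.keyLen l) (S.eveLen l) := by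
      refine (measurableEntries_genIsometry _).fromBlocks (hE.fromBlocks ?_)
      have := hE.conjTranspose
      simpa only [blockDiagonal'_conjTranspose] using this
    intro i j
    exact measurable_const.mul ((hO i.2 j.2).comp measurable_fst)
  · intro y y'
    simp only [ketbra, vecMulVec_apply, Pi.star_apply]
    fun_prop

end Measurability

/-! ### Second moment of the bias of an insensitive test. -/

section SecondMoment

variable {n : ℕ → ℕ} {l : ℕ}

/-- The average of `f` over a Haar random state. -/
def haarAvg (f : GenTable n × PureState (n l) → ℝ) (ω : GenTable n) : ℝ :=
  ∫ φ, f (ω, φ) ∂(haarState (n l))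

/-- The difference between the averages of `f` over the table's states and over Haar random
states. -/
def tableBias (f : GenTable n × PureState (n l) → ℝ) (ω : GenTable n) : ℝ :=
  (∑ k : BitString l, f (ω, ω ⟨l, k⟩)) / 2 ^ l - haarAvg f ω

variable {f : GenTable n × PureState (n l) → ℝ}

lemma integrable_section (hf : Measurable f) (hf01 : ∀ p, f p ∈ Set.Icc (0 : ℝ) 1)
    (ω : GenTable n) : Integrable (fun φ => f (ω, φ)) (haarState (n l)) :=
  Integrable.of_bound (hf.comp measurable_prodMk_left).aestronglyMeasurable 1
    (ae_of_all _ fun φ => by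
      rw [Real.norm_of_nonneg (hf01 _).1]; exact (hf01 _).2)

lemma haarAvg_mem (hf : Measurable f) (hf01 : ∀ p, f p ∈ Set.Icc (0 : ℝ) 1) (ω : GenTable n) :
    haarAvg f ω ∈ Set.Icc (0 : ℝ) 1 := by
  refine ⟨integral_nonneg fun φ => (hf01 _).1, ?_⟩
  refine (integral_mono (integrable_section hf hf01 ω) (integrable_const 1)
    fun φ => (hf01 _).2).trans ?_
  simp

lemma tableAvg_mem (hf01 : ∀ p, f p ∈ Set.Icc (0 : ℝ) 1) (ω : GenTable n) :
    (∑ k : BitString l, f (ω, ω ⟨l, k⟩)) / 2 ^ l ∈ Set.Icc (0 : ℝ) 1 := by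
  refine ⟨div_nonneg (Finset.sum_nonneg fun k _ => (hf01 _).1) (by positivity), ?_⟩
  rw [div_le_one (by positivity)]
  refine (Finset.sum_le_sum fun k _ => (hf01 _).2).trans ?_
  simp

lemma abs_tableBias_le (hf : Measurable f) (hf01 : ∀ p, f p ∈ Set.Icc (0 : ℝ) 1)
    (ω : GenTable n) : |tableBias f ω| ≤ 1 := by
  have h1 := tableAvg_mem hf01 ω
  have h2 := haarAvg_mem hf hf01 ω
  rw [tableBias, abs_le]
  constructor <;> linarith [h1.1, h1.2, h2.1, h2.2]

lemma abs_sub_haarAvg_le (hf : Measurable f) (hf01 : ∀ p, f p ∈ Set.Icc (0 : ℝ) 1)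
    (p : GenTable n × PureState (n l)) (ω : GenTable n) : |f p - haarAvg f ω| ≤ 1 := by
  have h1 := hf01 p
  have h2 := haarAvg_mem hf hf01 ω
  rw [abs_le]
  constructor <;> linarith [h1.1, h1.2, h2.1, h2.2]

lemma measurable_haarAvg (hf : Measurable f) : Measurable (haarAvg f) :=
  (hf.stronglyMeasurable.integral_prod_right' (ν := haarState (n l))).measurable

lemma measurable_tableBias (hf : Measurable f) : Measurable (tableBias f) := by
  refine Measurable.sub (Measurable.div_const (Finset.measurable_sum _ fun k _ => ?_) _)
    (measurable_haarAvg hf)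
  exact hf.comp (measurable_id.prodMk (measurable_pi_apply _))

/-- Sensitivity of `f` to reprogramming of a random key. -/
def Insensitive (f : GenTable n × PureState (n l) → ℝ) (ε : ℝ) : Prop :=
  ∀ (ω : GenTable n) (φ ψ : PureState (n l)),
    ∑ k : BitString l, |f (Function.update ω ⟨l, k⟩ ψ, φ) - f (ω, φ)| ≤ 2 ^ l * ε

/-- If `ψ` is programmed into the table at a random key, then by insensitivity the test behaves as
if it were not. The four `ε` pay for replacing `f` and its Haar average in the first factor, and the
table average and the Haar average inside the bias. -/
lemma sum_resampled_le (hf : Measurable f) (hf01 : ∀ p, f p ∈ Set.Icc (0 : ℝ) 1) {ε : ℝ}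
    (hε : Insensitive f ε) (ω : GenTable n) (ψ : PureState (n l)) :
    ∑ k : BitString l, (f (Function.update ω ⟨l, k⟩ ψ, ψ) -
        haarAvg f (Function.update ω ⟨l, k⟩ ψ)) * tableBias f (Function.update ω ⟨l, k⟩ ψ) ≤
      2 ^ l * ((f (ω, ψ) - haarAvg f ω) * tableBias f ω) + 2 ^ l * (4 * ε) + 1 := by
  set up : BitString l → GenTable n := fun k => Function.update ω ⟨l, k⟩ ψ
  set D : BitString l → PureState (n l) → ℝ := fun k φ => |f (up k, φ) - f (ω, φ)|
  have hD : ∀ φ, ∑ k, D k φ ≤ 2 ^ l * ε := fun φ => hε ω φ ψ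
  have hDint : ∀ k, Integrable (D k) (haarState (n l)) := fun k =>
    ((integrable_section hf hf01 _).sub (integrable_section hf hf01 _)).abs
  have hm : ∀ k, |haarAvg f (up k) - haarAvg f ω| ≤ ∫ φ, D k φ ∂(haarState (n l)) := by
    intro k
    rw [haarAvg, haarAvg, ← integral_sub (integrable_section hf hf01 _)
      (integrable_section hf hf01 _)]
    exact abs_integral_le_integral_abs
  have hDsum : ∑ k, ∫ φ, D k φ ∂(haarState (n l)) ≤ 2 ^ l * ε := by
    rw [← integral_finsetSum _ fun k _ => hDint k]
    refine (integral_mono (integrable_finsetSum _ fun k _ => hDint k) (integrable_const (2 ^ l * ε))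
      hD).trans ?_
    simp
  have hY : ∀ k, |∑ j : BitString l, f (up k, up k ⟨l, j⟩) - ∑ j : BitString l, f (ω, ω ⟨l, j⟩)| ≤
      1 + ∑ j : BitString l, D k (ω ⟨l, j⟩) := by
    intro k
    rw [← Finset.sum_sub_distrib]
    refine (Finset.abs_sum_le_sum_abs _ _).trans ?_
    -- The entry `j = k` is itself replaced and may change by up to one. Divided by `2 ^ l` and
    -- summed over `k`, this is the additive `1` of the statement.
    have h1 : (1 : ℝ) = ∑ j : BitString l, if j = k then 1 else 0 := by simp
    rw [h1, ← Finset.sum_add_distrib]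
    refine Finset.sum_le_sum fun j _ => ?_
    split_ifs with hj
    · have h2 := hf01 (up k, up k ⟨l, j⟩)
      have h3 := hf01 (ω, ω ⟨l, j⟩)
      have h4 : 0 ≤ D k (ω ⟨l, j⟩) := abs_nonneg _
      have : |f (up k, up k ⟨l, j⟩) - f (ω, ω ⟨l, j⟩)| ≤ 1 := by
        rw [abs_le]; constructor <;> linarith [h2.1, h2.2, h3.1, h3.2]
      linarith
    · have : up k ⟨l, j⟩ = ω ⟨l, j⟩ := Function.update_of_ne (by simpa using hj) _ _
      rw [this, zero_add]
  have hZ : ∀ k, |tableBias f (up k) - tableBias f ω| ≤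
      (1 + ∑ j : BitString l, D k (ω ⟨l, j⟩)) / 2 ^ l + ∫ φ, D k φ ∂(haarState (n l)) := by
    intro k
    have : tableBias f (up k) - tableBias f ω =
        (∑ j : BitString l, f (up k, up k ⟨l, j⟩) - ∑ j : BitString l, f (ω, ω ⟨l, j⟩)) / 2 ^ l -
        (haarAvg f (up k) - haarAvg f ω) := by
      simp only [tableBias]; ring
    rw [this]
    refine (abs_sub _ _).trans (add_le_add ?_ (hm k))
    rw [abs_div, abs_of_pos (by positivity : (0 : ℝ) < 2 ^ l)]
    gcongr
    exact hY k
  have hA : ∀ k, (f (up k, ψ) - haarAvg f (up k)) * tableBias f (up k) ≤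
      (f (ω, ψ) - haarAvg f ω) * tableBias f ω + (D k ψ + ∫ φ, D k φ ∂(haarState (n l)) +
        ((1 + ∑ j : BitString l, D k (ω ⟨l, j⟩)) / 2 ^ l + ∫ φ, D k φ ∂(haarState (n l)))) := by
    intro k
    have e : (f (up k, ψ) - haarAvg f (up k)) * tableBias f (up k) -
        (f (ω, ψ) - haarAvg f ω) * tableBias f ω =
        ((f (up k, ψ) - f (ω, ψ)) - (haarAvg f (up k) - haarAvg f ω)) * tableBias f (up k) +
        (f (ω, ψ) - haarAvg f ω) * (tableBias f (up k) - tableBias f ω) := by ring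
    have h1 : ((f (up k, ψ) - f (ω, ψ)) - (haarAvg f (up k) - haarAvg f ω)) * tableBias f (up k) ≤
        D k ψ + ∫ φ, D k φ ∂(haarState (n l)) := by
      refine (le_abs_self _).trans ?_
      rw [abs_mul]
      refine (mul_le_of_le_one_right (abs_nonneg _) (abs_tableBias_le hf hf01 _)).trans ?_
      exact (abs_sub _ _).trans (add_le_add le_rfl (hm k))
    have h2 : (f (ω, ψ) - haarAvg f ω) * (tableBias f (up k) - tableBias f ω) ≤
        (1 + ∑ j : BitString l, D k (ω ⟨l, j⟩)) / 2 ^ l + ∫ φ, D k φ ∂(haarState (n l)) := by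
      refine (le_abs_self _).trans ?_
      rw [abs_mul]
      exact (mul_le_of_le_one_left (abs_nonneg _) (abs_sub_haarAvg_le hf hf01 _ _)).trans (hZ k)
    linarith
  refine (Finset.sum_le_sum fun k _ => hA k).trans ?_
  simp only [Finset.sum_add_distrib, ← Finset.sum_div]
  have hswap : ∑ k, ∑ j : BitString l, D k (ω ⟨l, j⟩) ≤ 2 ^ l * (2 ^ l * ε) := by
    rw [Finset.sum_comm]
    refine (Finset.sum_le_sum fun j _ => hD _).trans (le_of_eq ?_)
    simp
  have hdiv : (∑ _k : BitString l, (1 : ℝ) + ∑ k, ∑ j : BitString l, D k (ω ⟨l, j⟩)) / 2 ^ l ≤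
      1 + 2 ^ l * ε := by
    rw [div_le_iff₀ (by positivity)]
    simp only [Finset.sum_const, Finset.card_univ, Fintype.card_pi, Fintype.card_bool,
      Finset.prod_const, Fintype.card_fin, nsmul_eq_mul]
    push_cast
    linarith
  have hc : ∑ _k : BitString l, (f (ω, ψ) - haarAvg f ω) * tableBias f ω =
      2 ^ l * ((f (ω, ψ) - haarAvg f ω) * tableBias f ω) := by simp
  rw [hc]
  linarith [hD ψ]

/-- The bias of an insensitive function has small second moment. -/
lemma integral_tableBias_sq_le (hf : Measurable f) (hf01 : ∀ p, f p ∈ Set.Icc (0 : ℝ) 1) {ε : ℝ}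
    (hε : Insensitive f ε) :
    ∫ ω, tableBias f ω ^ 2 ∂(randomTable n) ≤ (2 ^ l : ℝ)⁻¹ + 4 * ε := by
  set g : BitString l → GenTable n → ℝ := fun k ω =>
    (f (ω, ω ⟨l, k⟩) - haarAvg f ω) * tableBias f ω
  have hgm : ∀ k, Measurable (g k) := fun k =>
    ((hf.comp (measurable_id.prodMk (measurable_pi_apply _))).sub (measurable_haarAvg hf)).mul
      (measurable_tableBias hf)
  have hgb : ∀ k ω, ‖g k ω‖ ≤ 1 := by
    intro k ω
    rw [Real.norm_eq_abs, abs_mul]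
    exact mul_le_one₀ (abs_sub_haarAvg_le hf hf01 _ _) (abs_nonneg _) (abs_tableBias_le hf hf01 _)
  have hgi : ∀ k, Integrable (g k) (randomTable n) := fun k =>
    Integrable.of_bound (hgm k).aestronglyMeasurable 1 (ae_of_all _ (hgb k))
  -- Only one factor of the square is opened as a sum over keys. The other stays intact, so that
  -- resampling key `k` barely affects it.
  have hsq : ∀ ω, 2 ^ l * tableBias f ω ^ 2 = ∑ k, g k ω := by
    intro ω
    simp only [g, ← Finset.sum_mul, Finset.sum_sub_distrib]
    have : ∑ k : BitString l, f (ω, ω ⟨l, k⟩) - ∑ _k : BitString l, haarAvg f ω =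
        2 ^ l * tableBias f ω := by
      rw [tableBias, mul_sub, mul_div_cancel₀ _ (by positivity)]
      simp
    rw [this]; ring
  set μν := (randomTable n).prod (haarState (n l))
  set h : BitString l → GenTable n × PureState (n l) → ℝ := fun k p =>
    g k (Function.update p.1 ⟨l, k⟩ p.2)
  have hmp : ∀ k : BitString l, MeasurePreserving
      (fun p : GenTable n × PureState (n l) => Function.update p.1 (⟨l, k⟩ : AnyKey) p.2) μν
      (randomTable n) := fun k => measurePreserving_update (n := n) ⟨l, k⟩
  have hhi : ∀ k, Integrable (h k) μν := fun k => (hmp k).integrable_comp_of_integrable (hgi k)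
  have hint : ∀ k, ∫ p, h k p ∂μν = ∫ ω, g k ω ∂(randomTable n) := by
    intro k
    rw [← (hmp k).map_eq, integral_map (hmp k).measurable.aemeasurable]
    exact (hgm k).aestronglyMeasurable
  set r : GenTable n × PureState (n l) → ℝ := fun p =>
    (f p - haarAvg f p.1) * tableBias f p.1
  have hri : Integrable r μν := by
    refine Integrable.of_bound ((hf.sub ((measurable_haarAvg hf).comp measurable_fst)).mul
      ((measurable_tableBias hf).comp measurable_fst)).aestronglyMeasurable 1
      (ae_of_all _ fun p => ?_)
    rw [Real.norm_eq_abs, abs_mul]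
    exact mul_le_one₀ (abs_sub_haarAvg_le hf hf01 _ _) (abs_nonneg _) (abs_tableBias_le hf hf01 _)
  -- After decoupling, the input is an independent Haar state, so the centred first factor averages
  -- to zero for each fixed table.
  have hr0 : ∫ p, r p ∂μν = 0 := by
    rw [integral_prod _ hri]
    refine integral_eq_zero_of_ae (ae_of_all _ fun ω => ?_)
    simp only [r, integral_mul_const, Pi.zero_apply]
    rw [integral_sub (integrable_section hf hf01 ω) (integrable_const _)]
    simp [haarAvg]
  have hpt : ∀ p, ∑ k, h k p ≤ 2 ^ l * r p + (2 ^ l * (4 * ε) + 1) := by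
    intro p
    refine le_trans (le_of_eq ?_) ((sum_resampled_le hf hf01 hε p.1 p.2).trans (le_of_eq ?_))
    · simp only [h, g, Function.update_self]
    · simp only [r, add_assoc]
  have hmain : 2 ^ l * ∫ ω, tableBias f ω ^ 2 ∂(randomTable n) ≤ 2 ^ l * (4 * ε) + 1 := by
    rw [← integral_const_mul]
    simp only [hsq]
    rw [integral_finsetSum _ fun k _ => hgi k]
    simp only [← hint]
    rw [← integral_finsetSum _ fun k _ => hhi k]
    refine (integral_mono (integrable_finsetSum _ fun k _ => hhi k)
      ((hri.const_mul _).add (integrable_const _)) hpt).trans (le_of_eq ?_)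
    rw [integral_add' (hri.const_mul _) (integrable_const _), integral_const_mul, hr0]
    simp
  have h2 : (0 : ℝ) < 2 ^ l := by positivity
  have : ∫ ω, tableBias f ω ^ 2 ∂(randomTable n) ≤ (2 ^ l * (4 * ε) + 1) / 2 ^ l := by
    rw [le_div_iff₀ h2]; linarith
  refine this.trans (le_of_eq ?_)
  field_simp
  ring

end SecondMoment

/-! ### The advantage relative to the eavesdropper. -/

section Advantage

variable {n : ℕ → ℕ} {C : Construction n}

/-- The acceptance probability as a function of the generator and the input. -/
def Distinguisher.accept (S : Distinguisher C fun _ => 0) (l : ℕ)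
    (p : GenTable n × PureState (n l)) : ℝ :=
  S.acceptProb p.1.gen (C.eve p.1) l p.2

lemma advantage_eq (S : Distinguisher C fun _ => 0) (l : ℕ) (ω : GenTable n) :
    S.advantage ω.gen (C.eve ω) l = |tableBias (S.accept l) ω| := rfl

/-- The eavesdropper's guess depends on short states only, so a distinguisher cannot use it. -/
lemma insensitive_accept (S : Distinguisher C fun _ => 0) {l : ℕ}
    (hl : ∀ l' ≤ S.eveLen l, C.longDim l' ≤ 2 ^ n l) :
    Insensitive (S.accept l) (4 * S.queries l / √(2 ^ l)) := by
  intro ω φ ψ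
  have h : ∀ k : BitString l, S.accept l (Function.update ω ⟨l, k⟩ ψ, φ) =
      S.acceptProb (GenTable.gen (Function.update ω ⟨l, k⟩ ψ)) (C.eve ω) l φ := by
    intro k
    refine S.acceptProb_congr _ (fun l' hl' => ?_) φ
    simp only [Construction.eve, eveGuess_update C l' (x := ⟨l, k⟩) (hl l' hl')]
  have h' : ∀ k : BitString l,
      |S.accept l (Function.update ω ⟨l, k⟩ ψ, φ) - S.accept l (ω, φ)| =
      |S.acceptProb ω.gen (C.eve ω) l φ -
        S.acceptProb (GenTable.gen (Function.update ω ⟨l, k⟩ ψ)) (C.eve ω) l φ| := by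
    intro k
    rw [h k, abs_sub_comm, Distinguisher.accept]
  rw [Finset.sum_congr rfl fun k _ => h' k]
  refine (S.sum_abs_acceptProb_update_sub_le ω (C.eve ω) l φ fun _ => ψ).trans (le_of_eq ?_)
  have h2 : (2 : ℝ) ^ l = √(2 ^ l) * √(2 ^ l) := (Real.mul_self_sqrt (by positivity)).symm
  have h3 : √((2 : ℝ) ^ l) ≠ 0 := by positivity
  rw [h2, Real.sqrt_mul_self (by positivity)]
  field_simp

lemma integral_advantage_sq_le (S : Distinguisher C fun _ => 0) {l : ℕ}
    (hl : ∀ l' ≤ S.eveLen l, C.longDim l' ≤ 2 ^ n l) :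
    ∫ ω : GenTable n, S.advantage ω.gen (C.eve ω) l ^ 2 ∂(randomTable n) ≤
      (2 ^ l : ℝ)⁻¹ + 16 * S.queries l / √(2 ^ l) := by
  simp only [advantage_eq, sq_abs]
  refine (integral_tableBias_sq_le (measurable_acceptProb S l)
    (fun p => S.acceptProb_mem _ _ l p.2) (insensitive_accept S hl)).trans (le_of_eq ?_)
  ring

lemma measurable_advantage (S : Distinguisher C fun _ => 0) (l : ℕ) :
    Measurable fun ω : GenTable n => S.advantage ω.gen (C.eve ω) l := by
  simp only [advantage_eq]
  exact (measurable_tableBias (measurable_acceptProb S l)).abs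

end Advantage

/-! ### Growth rates and almost sure convergence. -/

section Asymptotics

lemma eval_mono_nat (p : Polynomial ℕ) {a b : ℕ} (h : a ≤ b) : p.eval a ≤ p.eval b := by
  rw [Polynomial.eval_eq_sum_range, Polynomial.eval_eq_sum_range]
  gcongr

lemma eventually_eval_le_pow (p : Polynomial ℕ) :
    ∃ d : ℕ, ∀ᶠ l : ℕ in atTop, p.eval l ≤ l ^ d := by
  refine ⟨p.natDegree + 1, ?_⟩
  filter_upwards [eventually_ge_atTop (max 1 (p.eval 1))] with l hl
  have h1 : 1 ≤ l := (le_max_left _ _).trans hl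
  have h2 : p.eval 1 ≤ l := (le_max_right _ _).trans hl
  calc p.eval l ≤ p.eval 1 * l ^ p.natDegree := by
        rw [Polynomial.eval_eq_sum_range, Polynomial.eval_eq_sum_range, Finset.sum_mul]
        refine Finset.sum_le_sum fun i hi => ?_
        rw [one_pow, mul_one]
        gcongr
        exact Nat.lt_succ_iff.1 (Finset.mem_range.1 hi)
    _ ≤ l * l ^ p.natDegree := by gcongr
    _ = l ^ (p.natDegree + 1) := by ring

/-- The dimension of `ω(log l)` qubits exceeds every polynomial. -/
lemma SuperLog.eventually_eval_le {n : ℕ → ℕ} (hn : SuperLog n) (p : Polynomial ℕ) :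
    ∀ᶠ l : ℕ in atTop, ((p.eval l : ℕ) : ℝ) ≤ 2 ^ n l := by
  obtain ⟨d, hd⟩ := eventually_eval_le_pow p
  -- This little-o constant yields `(d + 1) * log l ≤ n l * log 2`; using `d + 1` instead of `d`
  -- avoids a division by zero.
  have hc : (0 : ℝ) < Real.log 2 / (d + 1) := div_pos (Real.log_pos (by norm_num)) (by positivity)
  filter_upwards [hd, hn.def hc, eventually_ge_atTop 1] with l h1 h2 h3
  have hl : (1 : ℝ) ≤ l := by exact_mod_cast h3
  rw [Real.norm_of_nonneg (Real.log_nonneg hl), Real.norm_of_nonneg (by positivity)] at h2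
  have h4 : d * Real.log l ≤ n l * Real.log 2 := by
    have : (d + 1) * Real.log l ≤ n l * Real.log 2 := by
      calc (d + 1) * Real.log l ≤ (d + 1) * (Real.log 2 / (d + 1) * n l) := by gcongr
        _ = n l * Real.log 2 := by field_simp
    linarith [Real.log_nonneg hl]
  rw [← Real.log_pow, ← Real.log_pow] at h4
  calc ((p.eval l : ℕ) : ℝ) ≤ (l : ℝ) ^ d := by exact_mod_cast h1
    _ ≤ 2 ^ n l := (Real.log_le_log_iff (by positivity) (by positivity)).1 h4

/-- The eavesdropper is called on polynomially large parameters, where the round count is again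
polynomial. Polynomials compose, and `2 ^ n l` eventually exceeds the result. -/
lemma eventually_longDim_le {n : ℕ → ℕ} (hn : SuperLog n) {C : Construction n} (hC : C.Efficient)
    {e : ℕ → ℕ} (he : PolyBounded e) :
    ∀ᶠ l : ℕ in atTop, ∀ l' ≤ e l, C.longDim l' ≤ 2 ^ n l := by
  obtain ⟨p, hp⟩ := hC.1
  obtain ⟨q, hq⟩ := he
  filter_upwards [hn.eventually_eval_le (8 * (p.comp q + 1) ^ 2)] with l hl l' hl'
  refine le_trans ?_ hl
  have h1 : C.rounds l' ≤ p.eval (q.eval l) :=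
    (hp l').trans (eval_mono_nat p (hl'.trans (hq l)))
  simp only [Polynomial.eval_mul, Polynomial.eval_pow, Polynomial.eval_add, Polynomial.eval_comp,
    Polynomial.eval_one, Polynomial.eval_ofNat]
  rw [Construction.longDim]
  push_cast
  gcongr

/-- A Borel–Cantelli argument through expectations: the tail sum has finite mean, so it is almost
surely finite and its terms tend to zero. -/
lemma ae_tendsto_zero_of_summable {Ω : Type*} [MeasurableSpace Ω] {μ : Measure Ω} {X : ℕ → Ω → ℝ}
    (hm : ∀ l, Measurable (X l)) (hi : ∀ l, Integrable (X l) μ) (h0 : ∀ l ω, 0 ≤ X l ω)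
    {b : ℕ → ℝ} (hb : Summable b) (hX : ∀ᶠ l in atTop, ∫ ω, X l ω ∂μ ≤ b l) :
    ∀ᵐ ω ∂μ, Tendsto (fun l => X l ω) atTop (nhds 0) := by
  obtain ⟨m, hm'⟩ := eventually_atTop.1 hX
  have hsum : ∫⁻ ω, ∑' l, ENNReal.ofReal (X (l + m) ω) ∂μ ≠ ⊤ := by
    rw [lintegral_tsum fun l => (hm _).ennreal_ofReal.aemeasurable]
    refine ne_top_of_le_ne_top ((summable_nat_add_iff m).2 hb).tsum_ofReal_ne_top
      (ENNReal.tsum_le_tsum fun l => ?_)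
    rw [← ofReal_integral_eq_lintegral_ofReal (hi _) (ae_of_all _ (h0 _))]
    exact ENNReal.ofReal_le_ofReal (hm' _ (Nat.le_add_left _ _))
  filter_upwards [ae_lt_top (Measurable.tsum fun l => (hm (l + m)).ennreal_ofReal) hsum]
    with ω hω
  have h1 := ENNReal.tendsto_atTop_zero_of_tsum_ne_top hω.ne
  have h2 := (ENNReal.tendsto_toReal ENNReal.zero_ne_top).comp h1
  rw [← tendsto_add_atTop_iff_nat m]
  simpa [Function.comp_def, ENNReal.toReal_ofReal (h0 _ _)] using h2

end Asymptotics

/-! ### Almost sure security of the random generator and the contradiction. -/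

section Reduction

variable {n : ℕ → ℕ} {C : Construction n}

lemma summable_advantage_bound {q : ℕ → ℕ} (hq : PolyBounded q) (d : ℕ) :
    Summable fun l : ℕ => ((l : ℝ) ^ d) ^ 2 * ((2 ^ l : ℝ)⁻¹ + 16 * q l / √(2 ^ l)) := by
  obtain ⟨p, hp⟩ := hq
  obtain ⟨e, he⟩ := eventually_eval_le_pow p
  have hr : ‖(√2)⁻¹‖ < 1 := by
    rw [norm_inv, Real.norm_of_nonneg (Real.sqrt_nonneg _)]
    exact inv_lt_one_of_one_lt₀ (Real.lt_sqrt_of_sq_lt (by norm_num))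
  have hr' : ‖(2 : ℝ)⁻¹‖ < 1 := by norm_num
  have h1 := summable_pow_mul_geometric_of_norm_lt_one (d * 2) hr'
  have h2 := (summable_pow_mul_geometric_of_norm_lt_one (d * 2 + e) hr).mul_left 16
  refine Summable.of_norm_bounded_eventually_nat (h1.add h2) ?_
  filter_upwards [he] with l hl
  rw [Real.norm_of_nonneg (by positivity), mul_add]
  have hq' : (q l : ℝ) ≤ (l : ℝ) ^ e := by exact_mod_cast (hp l).trans hl
  have hs : √((2 : ℝ) ^ l) = √2 ^ l := by
    rw [Real.sqrt_eq_iff_mul_self_eq (by positivity) (by positivity), ← mul_pow]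
    norm_num
  rw [hs]
  refine add_le_add (le_of_eq ?_) ?_
  · rw [← pow_mul, inv_pow]
  · calc ((l : ℝ) ^ d) ^ 2 * (16 * q l / √2 ^ l) ≤ ((l : ℝ) ^ d) ^ 2 * (16 * l ^ e / √2 ^ l) := by
          gcongr
      _ = 16 * ((l : ℝ) ^ (d * 2 + e) * (√2)⁻¹ ^ l) := by
          rw [pow_add, pow_mul, inv_pow]; ring

/-- A random generator is secure, even relative to the eavesdropper. -/
lemma ae_negligible_advantage (hn : SuperLog n) (hC : C.Efficient)
    {S : Distinguisher C fun _ => 0} (hS : S.Efficient) :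
    ∀ᵐ ω : GenTable n ∂(randomTable n), Negligible (S.advantage ω.gen (C.eve ω)) := by
  have hA : ∀ (l : ℕ) (ω : GenTable n), |S.advantage ω.gen (C.eve ω) l| ≤ 1 := by
    intro l ω
    rw [advantage_eq, abs_abs]
    exact abs_tableBias_le (measurable_acceptProb S l) (fun p => S.acceptProb_mem _ _ l p.2) ω
  -- Only second moments are controlled, so the squared advantage is weighted by `l ^ (2 * d)`; a
  -- square root at the end recovers the weight `l ^ d`. The countably many exceptional sets, one
  -- per `d`, are then united.
  have key : ∀ d : ℕ, ∀ᵐ ω : GenTable n ∂(randomTable n), Tendsto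
      (fun l : ℕ => ((l : ℝ) ^ d) ^ 2 * S.advantage ω.gen (C.eve ω) l ^ 2) atTop (nhds 0) := by
    intro d
    refine ae_tendsto_zero_of_summable (fun l => ((measurable_advantage S l).pow_const 2).const_mul _)
      (fun l => ?_) (fun l ω => by positivity) (summable_advantage_bound hS.2.1 d) ?_
    · refine Integrable.const_mul (Integrable.of_bound
        ((measurable_advantage S l).pow_const 2).aestronglyMeasurable 1
        (ae_of_all _ fun ω => ?_)) _
      rw [norm_pow]
      exact pow_le_one₀ (norm_nonneg _) (hA l ω)
    · filter_upwards [eventually_longDim_le hn hC hS.2.2.2] with l hl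
      rw [integral_const_mul]
      exact mul_le_mul_of_nonneg_left (integral_advantage_sq_le S hl) (by positivity)
  filter_upwards [ae_all_iff.2 key] with ω hω d
  have h := (hω d).sqrt
  rw [Real.sqrt_zero] at h
  refine h.congr fun l => ?_
  rw [← mul_pow, Real.sqrt_sq]
  exact mul_nonneg (by positivity) (abs_nonneg _)

lemma Negligible.tendsto {δ : ℕ → ℝ} (h : Negligible δ) : Tendsto δ atTop (nhds 0) := by
  simpa using h 0

lemma tendsto_ofReal_of_le {u δ : ℕ → ℝ} (hδ : Negligible δ) (h : ∀ l, u l ≤ δ l) :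
    Tendsto (fun l => ENNReal.ofReal (u l)) atTop (nhds 0) := by
  have h1 := ENNReal.tendsto_ofReal hδ.tendsto
  rw [ENNReal.ofReal_zero] at h1
  exact tendsto_of_tendsto_of_tendsto_of_le_of_le tendsto_const_nhds h1 (fun _ => zero_le)
    fun l => ENNReal.ofReal_le_ofReal (h l)

lemma tendsto_lintegral_zero {X : ℕ → GenTable n → ℝ} (hm : ∀ l, Measurable (X l))
    (h1 : ∀ l ω, X l ω ≤ 1)
    (hX : ∀ᵐ ω ∂(randomTable n), Tendsto (fun l => ENNReal.ofReal (X l ω)) atTop (nhds 0)) :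
    Tendsto (fun l => ∫⁻ ω, ENNReal.ofReal (X l ω) ∂(randomTable n)) atTop (nhds 0) := by
  have := tendsto_lintegral_of_dominated_convergence (μ := randomTable n)
    (F := fun l ω => ENNReal.ofReal (X l ω)) (f := fun _ => 0) (fun _ => 1)
    (fun l => (hm l).ennreal_ofReal) (fun l => ae_of_all _ fun ω => by
      simpa using ENNReal.ofReal_le_ofReal (h1 l ω)) (by simp) hX
  simpa using this

/-- There is no fully black-box reduction. -/
lemma not_isFullyBlackBoxReduction (hn : SuperLog n) (S : ∀ w : ℕ → ℕ, Distinguisher C w) :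
    ¬ IsFullyBlackBoxReduction C S := by
  intro h
  -- The negligible bound depends on the generator with no uniformity, so only limits of means
  -- survive, by dominated convergence. The positive part of the excess over `1 / 2` is used because
  -- the eavesdropper may also do worse than guessing.
  have hwin : Tendsto (fun l => ∫⁻ ω : GenTable n,
      ENNReal.ofReal (C.eveWinProb ω.gen (C.eve ω) l - 1 / 2) ∂(randomTable n)) atTop (nhds 0) := by
    refine tendsto_lintegral_zero (fun l => (measurable_eveWinProb_eve C l).sub_const _)
      (fun l ω => by linarith [(eveWinProb_eve_mem C ω l).2]) ?_
    filter_upwards [ae_negligible_advantage hn h.efficient_construction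
      (h.efficient_reduction fun _ => 0)] with ω hω
    have hnb : ¬ C.IsBrokenBy ω.gen (C.eve ω) := fun hb => h.security _ _ _ hb hω
    obtain ⟨δ, hδ, hle⟩ := not_not.1 hnb
    exact tendsto_ofReal_of_le hδ fun l => by linarith [hle l]
  have hagree : Tendsto (fun l => ∫⁻ ω : GenTable n,
      ENNReal.ofReal (1 - C.agreeProb ω.gen l) ∂(randomTable n)) atTop (nhds 0) := by
    refine tendsto_lintegral_zero (fun l => (measurable_agreeProb C l).const_sub _)
      (fun l ω => (one_sub_agreeProb_mem C ω l).2) (ae_of_all _ fun ω => ?_)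
    obtain ⟨ε, hε, hle⟩ := h.correctness ω.gen
    exact tendsto_ofReal_of_le hε fun l => by linarith [hle l]
  have hlim := (hwin.add_const (ENNReal.ofReal (1 / 2))).add hagree
  rw [zero_add, add_zero] at hlim
  -- The mean winning probability is at most `1 / 2` plus the mean excess. Excess and disagreement
  -- both vanish in the limit, against the constant lower bound `7 / 8`.
  have hle : ENNReal.ofReal (7 / 8) ≤ ENNReal.ofReal (1 / 2) := by
    refine ge_of_tendsto' hlim fun l => (le_lintegral_eveWinProb_add C l).trans ?_
    gcongr
    calc ∫⁻ ω : GenTable n, ENNReal.ofReal (C.eveWinProb ω.gen (C.eve ω) l) ∂(randomTable n)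
        ≤ ∫⁻ ω : GenTable n, (ENNReal.ofReal (C.eveWinProb ω.gen (C.eve ω) l - 1 / 2) +
            ENNReal.ofReal (1 / 2)) ∂(randomTable n) := by
          refine lintegral_mono fun ω => ?_
          refine le_trans (le_of_eq ?_) ENNReal.ofReal_add_le
          rw [sub_add_cancel]
      _ = _ := by
          rw [lintegral_add_right _ measurable_const]
          simp
  rw [ENNReal.ofReal_le_ofReal_iff (by norm_num)] at hle
  norm_num at hle

end Reduction

end QCCC

end

theorem mainTheorem4 (n : ℕ → ℕ) (hn : QCCC.SuperLog n) :
    ¬ ∃ (C : QCCC.Construction n) (S : ∀ w : ℕ → ℕ, QCCC.Distinguisher C w),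
      QCCC.IsFullyBlackBoxReduction C S := by
  rintro ⟨C, S, h⟩
  exact QCCC.not_isFullyBlackBoxReduction hn S h
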